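/- **Notation.** Let $X$ be a complex Banach space with dual $X'$, $\Sigma_\omega=\{z\neq 0: |\arg z|<\omega\}$, $\langle t\rangle=\sqrt{1+t^2}$, and $f_e(u)=f(e^u)$ for $f:(0,\infty)\to\mathbb C$. An operator $A$ on $X$ is *$0$-sectorial* if it is closed, with dense domain and dense range, and for every $\omega\in(0,\pi)$ its spectrum lies in $\overline{\Sigma_\omega}$ and $\lambda(\lambda-A)^{-1}$ is bounded outside every larger closed sector $\overline{\Sigma_\theta}$, $\theta\in(\omega,\pi)$. For $\alpha>\frac12$ let $W^\alpha_2=\{g\in L^2(\mathbb R): \|g\|_{W^\alpha_2}=\|(\hat g(t)(1+|t|)^\alpha)^{\vee}\|_2<\infty\}$ and $\mathcal W^\alpha_2=\{f:(0,\infty)\to\mathbb C:\ \|f\|_{\mathcal W^\alpha_2}=\|f_e\|_{W^\alpha_2}<\infty\}$. Say that $\phi\in W^\alpha_{2,\mathrm{loc}}(\mathbb R_+)$ if $\phi_e\eta\in W^\alpha_2$ for all $\eta\in C_c^\infty(\mathbb R)$. A set $\tau\subset B(X)$ is *$R$-bounded* if there is $C<\infty$ with $\mathbb E\|\sum_k\epsilon_kT_kx_k\|\le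 C\,\mathbb E\|\sum_k\epsilon_kx_k\|$ for all finite families $T_k\in\tau$, $x_k\in X$, where the $\epsilon_k$ are independent random signs; $R(\tau)$ is the smallest such $C$. **Calculus.** $A$ has a *bounded $\mathcal W^\alpha_2$ calculus* if $\|f(A)\|\le C\|f\|_{\mathcal W^\alpha_2}$ for all $f\in\mathcal W^\alpha_2\cap\bigcap_{0<\omega<\pi}H^\infty(\Sigma_\omega)$, where $f(A)=\rho(A)^{-1}(\rho f)(A)$, $\rho(\lambda)=\lambda(1+\lambda)^{-2}$, and $\rho(A)$, $(\rho f)(A)$ are given by the Cauchy integral $\frac1{2\pi i}\int_{\partial\Sigma_\sigma}g(\lambda)(\lambda-A)^{-1}d\lambda$. By density the calculus then extends to $f\in\mathcal W^\alpha_2$, and it is *$R$-bounded* if $R(\{f(A):\|f\|_{\mathcal W^\alpha_2}\le1\})<\infty$. Let $\psi\in C_c^\infty(\mathbb R_+)$, $\operatorname{supp}\psi\subset[\frac12,2]$, with $\sum_{n\in\mathbb Z}\psi(2^{-n}t)=1$ for $t>0$, and put $\psi_n=\psi(2^{-n}\cdot)$ and $D_A=\{x\in X:\ \psi_n(A)x=0\text{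 for all large }|n|\}$. For $f\in W^\alpha_{2,\mathrm{loc}}(\mathbb R_+)$ let $f(A)$ be the closure of $D_A\to X$, $x\mapsto\sum_{n}(f\psi_n)(A)x$ (a finite sum), and put $f(tA)=(f(t\,\cdot))(A)$ for $t>0$. **Averaged $R$-boundedness.** A family $(N(t))_{t>0}$ of closed operators is *$R[L^2(\mathbb R_+,\frac{dt}t)]$-bounded* on a dense subspace $D$ contained in all their domains if for all $x\in D$, $x'\in X'$ and $h\in L^2(\mathbb R_+,\frac{dt}t)$ the map $t\mapsto N(t)x$ is (strongly) measurable and $h(\cdot)\langle N(\cdot)x,x'\rangle$ is integrable for $\frac{dt}t$; if for every such $h$ there is $N_h\in B(X)$ with $\langle N_hx,x'\rangle=\int_0^\infty h(t)\langle N(t)x,x'\rangle\frac{dt}t$ for all $x\in D$, $x'\in X'$; and if the set $\{N_h:\|h\|_{L^2(dt/t)}\le1\}$ is $R$-bounded. The $R$-bound of this set is the *bound* of the family. **Proposition.** Let $A$ be a $0$-sectorial operator on $X$ that has an $R$-bounded $\mathcal W^\alpha_2$ calculus for some $\alpha>\frac12$. Then there is a constant $C<\infty$ such that for every $\phi\in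 W^\alpha_{2,\mathrm{loc}}(\mathbb R_+)\cap L^2(\mathbb R_+,\frac{ds}s)$ whose Mellin transform $M\phi(t)=\int_0^\infty s^{it}\phi(s)\frac{ds}s$ (taken in the sense of $M:L^2(\mathbb R_+,\frac{ds}s)\to L^2(\mathbb R,dt)$) satisfies $\langle t\rangle^\alpha M\phi(t)\in L^\infty(\mathbb R)$, the family $(\phi(tA))_{t>0}$ is $R[L^2(\mathbb R_+,\frac{dt}t)]$-bounded on $D_A$, with bound at most $C\,\|\langle t\rangle^\alpha M\phi(t)\|_{L^\infty(\mathbb R)}$. -/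

import Mathlib

open MeasureTheory Set Filter Topology
open scoped NNReal ENNReal FourierTransform

noncomputable section

namespace AvgR

/-! ### Sectors and sectorial operators -/

/-- The open sector `{z ≠ 0 : |arg z| < w}`. -/
def sector (w : ℝ) : Set ℂ := {z | z ≠ 0 ∧ |z.arg| < w}

section Operators

variable {X : Type*} [NormedAddCommGroup X] [NormedSpace ℂ X]

/-- `R` is the bounded two-sided inverse of `l - A : D(A) → X`. -/
def IsResolventAt (A : X →ₗ.[ℂ] X) (l : ℂ) (R : X →L[ℂ] X) : Prop :=
  (∀ y : X, ∃ h : R y ∈ A.domain, l • R y - A ⟨R y, h⟩ = y) ∧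
    ∀ x : A.domain, R (l • (x : X) - A x) = x

/-- The spectrum of an unbounded operator. -/
def opSpectrum (A : X →ₗ.[ℂ] X) : Set ℂ := {l | ¬ ∃ R, IsResolventAt A l R}

open Classical in
/-- The resolvent `(l - A)⁻¹` (zero on the spectrum). -/
def resolv (A : X →ₗ.[ℂ] X) (l : ℂ) : X →L[ℂ] X :=
  if h : ∃ R, IsResolventAt A l R then h.choose else 0

/-- `w`-sectorial operators: closed, densely defined, with dense range, spectrum in the closed
sector of half-angle `w`, and `‖l (l - A)⁻¹‖` bounded off every larger closed sector. -/
structure IsSectorial (A : X →ₗ.[ℂ] X) (w : ℝ) : Prop where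
  isClosed : A.IsClosed
  dense_domain : Dense (A.domain : Set X)
  dense_range : Dense (Set.range (fun x : A.domain => A x))
  spectrum_subset : opSpectrum A ⊆ closure (sector w)
  resolvent_bound : ∀ θ ∈ Ioo w Real.pi, ∃ C : ℝ, ∀ l ∈ (closure (sector θ))ᶜ,
    ‖l • resolv A l‖ ≤ C

/-- `0`-sectorial: `w`-sectorial for every `w > 0`. -/
def IsZeroSectorial (A : X →ₗ.[ℂ] X) : Prop := ∀ w ∈ Ioo 0 Real.pi, IsSectorial A w

/-! ### Holomorphic functional calculus -/

/-- `(2πi)⁻¹ ∫_Γ f(l) (l - A)⁻¹ dl`, where `Γ` is the boundary of the sector of half-angle `σ`,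
run through with the sector on its left: inwards along `r e^{iσ}`, outwards along `r e^{-iσ}`. -/
def cauchyOp (A : X →ₗ.[ℂ] X) (σ : ℝ) (f : ℂ → ℂ) : X →L[ℂ] X :=
  (2 * Real.pi * Complex.I)⁻¹ •
    ((∫ r in Ioi (0 : ℝ), (f (r * Complex.exp (-(σ * Complex.I))) *
        Complex.exp (-(σ * Complex.I))) • resolv A (r * Complex.exp (-(σ * Complex.I)))) -
      ∫ r in Ioi (0 : ℝ), (f (r * Complex.exp (σ * Complex.I)) *
        Complex.exp (σ * Complex.I)) • resolv A (r * Complex.exp (σ * Complex.I)))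

/-- The regularizer `ρ(l) = l (1 + l)⁻²`. -/
def rho (l : ℂ) : ℂ := l / (1 + l) ^ 2

/-- `f ∈ ⋂_{0<w<π} H^∞(Σ_w)`: holomorphic off `(-∞, 0]` and bounded on every sector `Σ_w`. -/
def IsHInf (f : ℂ → ℂ) : Prop :=
  DifferentiableOn ℂ f Complex.slitPlane ∧
    ∀ w ∈ Ioo 0 Real.pi, ∃ C : ℝ, ∀ z ∈ sector w, ‖f z‖ ≤ C

/-- The bounded everywhere defined operator `T` is `f(A)` in the extended holomorphic calculus,
`f(A) = ρ(A)⁻¹ (ρ f)(A)` for `f` bounded; `ρ(A)` and `(ρ f)(A)` are Cauchy integrals, which do not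
depend on the angle of the contour. -/
def IsHolOp (A : X →ₗ.[ℂ] X) (f : ℂ → ℂ) (T : X →L[ℂ] X) : Prop :=
  ∀ σ ∈ Ioo 0 Real.pi, ∀ x : X, cauchyOp A σ rho (T x) = cauchyOp A σ (fun l => rho l * f l) x

end Operators

/-! ### Sobolev spaces on the line and on the half-line, Mellin transform -/

open Classical in
/-- The `L²` Fourier transform `ξ ↦ ∫ g(u) e^{-2πiuξ} du` of `g ∈ L²(ℝ)` (zero otherwise). -/
def fourierL2 (g : ℝ → ℂ) : ℝ → ℂ :=
  if h : MemLp g 2 (volume : Measure ℝ) then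
    ((𝓕 (h.toLp g) : Lp ℂ 2 (volume : Measure ℝ)) : ℝ → ℂ) else 0

/-- The norm of `W^α_2(ℝ)`: the `L²` norm of the inverse Fourier transform of
`(1 + |t|)^α ĝ(t)`, `ĝ(t) = ∫ g(u) e^{-itu} du`. By Plancherel and `t = 2πξ` it is the
`L²` norm of `(1 + 2π|ξ|)^α fourierL2 g ξ`. -/
def sobNorm (α : ℝ) (g : ℝ → ℂ) : ℝ≥0∞ :=
  eLpNorm (fun ξ : ℝ => (((1 + 2 * Real.pi * |ξ|) ^ α : ℝ) : ℂ) * fourierL2 g ξ) 2 volume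

/-- `g ∈ W^α_2(ℝ)`. -/
def MemSob (α : ℝ) (g : ℝ → ℂ) : Prop := MemLp g 2 volume ∧ sobNorm α g < ∞

/-- `g ∈ W^α_{2,loc}(ℝ)`. -/
def MemSobLoc (α : ℝ) (g : ℝ → ℂ) : Prop :=
  ∀ η : ℝ → ℂ, ContDiff ℝ (⊤ : ℕ∞) η → HasCompactSupport η → MemSob α (fun u => g u * η u)

/-- `f_e(u) = f(e^u)`, which transports functions on `(0, ∞)` to functions on `ℝ`. -/
def pull (f : ℝ → ℂ) : ℝ → ℂ := fun u => f (Real.exp u)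

/-- The measure `dt/t` on `(0, ∞)`. -/
def haarPos : Measure (Ioi (0 : ℝ)) :=
  (Measure.comap Subtype.val (volume : Measure ℝ)).withDensity
    (fun t => ENNReal.ofReal (1 / (t : ℝ)))

/-- The Mellin transform `t ↦ ∫_0^∞ s^{it} f(s) ds/s`, as a map `L²(ds/s) → L²(ℝ)`. With
`s = e^{-u}` the integral is `∫ f(e^{-u}) e^{-itu} du`. -/
def mellinL2 (f : ℝ → ℂ) : ℝ → ℂ :=
  fun t => fourierL2 (fun u => f (Real.exp (-u))) (t / (2 * Real.pi))

/-- A (smooth) dyadic partition of unity `∑_n ψ(2^{-n} t) = 1` on `(0, ∞)`. -/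
structure IsDyadicPartition (ψ : ℝ → ℂ) : Prop where
  contDiff : ContDiff ℝ (⊤ : ℕ∞) ψ
  tsupport_subset : tsupport ψ ⊆ Icc (1 / 2) 2
  hasSum : ∀ t : ℝ, 0 < t → HasSum (fun n : ℤ => ψ ((2 : ℝ) ^ (-n) * t)) 1

/-- `ψ_n = ψ(2^{-n} ·)`. -/
def dyad (ψ : ℝ → ℂ) (n : ℤ) : ℝ → ℂ := fun t => ψ ((2 : ℝ) ^ (-n) * t)

section Calculus

variable {X : Type*} [NormedAddCommGroup X] [NormedSpace ℂ X]

/-! ### R-boundedness -/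

/-- `E ‖∑_k ε_k x_k‖` for independent symmetric signs `ε_k`. -/
def radNorm {n : ℕ} (x : Fin n → X) : ℝ :=
  ((2 : ℝ) ^ n)⁻¹ * ∑ ε : Fin n → Bool, ‖∑ k, (if ε k then (1 : ℂ) else -1) • x k‖

/-- The `R`-bound of a set of operators: the smallest admissible constant, `∞` if there is none. -/
def rBound (τ : Set (X →L[ℂ] X)) : ℝ≥0∞ :=
  ⨅ (C : ℝ≥0) (_ : ∀ (n : ℕ) (T : Fin n → X →L[ℂ] X) (x : Fin n → X), (∀ k, T k ∈ τ) →
    radNorm (fun k => T k (x k)) ≤ C * radNorm x), (C : ℝ≥0∞)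

/-! ### Sobolev calculus -/

/-- `A` has a bounded `𝓦^α_2` calculus, where `𝓦^α_2 = {f : f_e ∈ W^α_2(ℝ)}`:
`‖f(A)‖ ≤ C ‖f_e‖` for all `f ∈ 𝓦^α_2` in all `H^∞(Σ_w)`. -/
def HasSobolevCalculus (A : X →ₗ.[ℂ] X) (α : ℝ) : Prop :=
  ∃ C : ℝ≥0, ∀ f : ℂ → ℂ, IsHInf f → MemSob α (pull fun s => f s) →
    ∃ T : X →L[ℂ] X, IsHolOp A f T ∧ ‖T‖ₑ ≤ C * sobNorm α (pull fun s => f s)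

/-- `T = f(A)` for `f ∈ 𝓦^α_2`, in the sense of the continuous extension of the calculus:
`T` is the norm limit of `g_n(A)` for holomorphic `g_n → f` in `𝓦^α_2`. -/
def IsSobOp (A : X →ₗ.[ℂ] X) (α : ℝ) (f : ℝ → ℂ) (T : X →L[ℂ] X) : Prop :=
  MemSob α (pull f) ∧ ∃ (g : ℕ → ℂ → ℂ) (S : ℕ → X →L[ℂ] X),
    (∀ n, IsHInf (g n) ∧ MemSob α (pull fun s => g n s) ∧ IsHolOp A (g n) (S n)) ∧
    Tendsto (fun n => sobNorm α (pull fun s => g n s - f s)) atTop (𝓝 0) ∧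
    Tendsto S atTop (𝓝 T)

/-- `A` has an `R`-bounded `𝓦^α_2` calculus. -/
def HasRBoundedSobolevCalculus (A : X →ₗ.[ℂ] X) (α : ℝ) : Prop :=
  HasSobolevCalculus A α ∧
    rBound {T : X →L[ℂ] X | ∃ f : ℝ → ℂ, MemSob α (pull f) ∧ sobNorm α (pull f) ≤ 1 ∧
      IsSobOp A α f T} < ∞

open Classical in
/-- The operator `f(A)` of the `𝓦^α_2` calculus, for `f ∈ 𝓦^α_2`. -/
def sobOp (A : X →ₗ.[ℂ] X) (α : ℝ) (f : ℝ → ℂ) : X →L[ℂ] X :=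
  if h : ∃ T, IsSobOp A α f T then h.choose else 0

/-- The calculus core `D_A = {x : ψ_n(A) x = 0 for all large |n|}`. -/
def core (A : X →ₗ.[ℂ] X) (α : ℝ) (ψ : ℝ → ℂ) : Submodule ℂ X where
  carrier := {x | ∃ N : ℕ, ∀ n : ℤ, (N : ℤ) ≤ |n| → sobOp A α (dyad ψ n) x = 0}
  add_mem' := by
    rintro x y ⟨N, hN⟩ ⟨M, hM⟩
    refine ⟨max N M, fun n hn => ?_⟩
    have h := hn
    push_cast at h
    rw [map_add, hN n (le_trans (le_max_left _ _) h), hM n (le_trans (le_max_right _ _) h),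
      add_zero]
  zero_mem' := ⟨0, fun n _ => map_zero _⟩
  smul_mem' := by
    rintro c x ⟨N, hN⟩
    exact ⟨N, fun n hn => by rw [map_smul, hN n hn, smul_zero]⟩

/-- The graph of `D_A → X`, `x ↦ ∑_n (f ψ_n)(A) x`, where for `x ∈ D_A` only finitely many terms
do not vanish. -/
def locGraph (A : X →ₗ.[ℂ] X) (α : ℝ) (ψ f : ℝ → ℂ) : Submodule ℂ (X × X) where
  carrier := {p | p.1 ∈ core A α ψ ∧ ∀ᶠ M : ℕ in atTop,
    ∑ n ∈ Finset.Icc (-(M : ℤ)) M, sobOp A α (fun s => f s * dyad ψ n s) p.1 = p.2}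
  add_mem' := by
    rintro p q ⟨hp, hp2⟩ ⟨hq, hq2⟩
    refine ⟨add_mem hp hq, ?_⟩
    filter_upwards [hp2, hq2] with M h1 h2
    simp only [Prod.fst_add, Prod.snd_add, map_add, Finset.sum_add_distrib, h1, h2]
  zero_mem' := ⟨zero_mem _, Eventually.of_forall fun M => by simp⟩
  smul_mem' := by
    rintro c p ⟨hp, hp2⟩
    refine ⟨Submodule.smul_mem _ c hp, ?_⟩
    filter_upwards [hp2] with M h1
    simp only [Prod.smul_fst, Prod.smul_snd, map_smul, ← Finset.smul_sum, h1]

/-- The closed operator `f(A)` for `f_e ∈ W^α_{2,loc}(ℝ)`: the closure of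
`D_A → X`, `x ↦ ∑_n (f ψ_n)(A) x`. -/
def locOp (A : X →ₗ.[ℂ] X) (α : ℝ) (ψ f : ℝ → ℂ) : X →ₗ.[ℂ] X :=
  (locGraph A α ψ f).toLinearPMap.closure

/-! ### Averaged R-boundedness -/

/-- `T = N_f`, i.e. `⟨T x, x'⟩ = ∫ f(t) ⟨N(t) x, x'⟩ dμ(t)` for `x ∈ D`, `x' ∈ X'`. -/
def IsAverage {Ω : Type*} [MeasurableSpace Ω] (μ : Measure Ω) (D : Submodule ℂ X)
    (N : Ω → X →ₗ.[ℂ] X) (hD : ∀ t, D ≤ (N t).domain) (f : Lp ℂ 2 μ) (T : X →L[ℂ] X) : Prop :=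
  ∀ (x : X) (hx : x ∈ D) (x' : StrongDual ℂ X),
    x' (T x) = ∫ t, f t * x' (N t ⟨x, hD t hx⟩) ∂μ

/-- The family `N(t)` of closed operators is `R[L²(Ω, μ)]`-bounded with `D_N = D`, with
`R[L²(Ω, μ)]`-bound at most `c < ∞`. -/
structure IsRL2BoundedWith {Ω : Type*} [MeasurableSpace Ω] (μ : Measure Ω) (D : Submodule ℂ X)
    (N : Ω → X →ₗ.[ℂ] X) (c : ℝ≥0∞) : Prop where
  isClosed : ∀ t, (N t).IsClosed
  dense : Dense (D : Set X)
  le_domain : ∀ t, D ≤ (N t).domain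
  measurable : ∀ (x : X) (hx : x ∈ D), StronglyMeasurable fun t => N t ⟨x, le_domain t hx⟩
  integrable : ∀ (x : X) (hx : x ∈ D) (x' : StrongDual ℂ X) (f : Lp ℂ 2 μ),
    Integrable (fun t => f t * x' (N t ⟨x, le_domain t hx⟩)) μ
  exists_average : ∀ f : Lp ℂ 2 μ, ∃ T : X →L[ℂ] X, IsAverage μ D N le_domain f T
  rBound_le : rBound {T : X →L[ℂ] X | ∃ f : Lp ℂ 2 μ, ‖f‖ ≤ 1 ∧
    IsAverage μ D N le_domain f T} ≤ c
  lt_top : c < ∞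

end Calculus

end AvgR

end

open AvgR

/-! In the variable `u = log s`, dilation becomes translation: for `t = e^s`, the operator `φ(tA)`
is the translate `φ_e(· + s)` evaluated at `A`. The average of `φ(tA)` against `h` should therefore
be `g(A)`, where `g(u) = ∫ h(s) φ_e(u + s) ds`. On the Fourier side `ĝ = φ̂_e · 𝓕⁻h`, so
`‖g‖_{W^α_2} ≤ ‖(1 + |t|)^α φ̂_e‖_∞ ‖h‖_2`. Up to a reflection and a factor `√2^α`, the sup norm is
that of `⟨t⟩^α Mφ` (`norm_wt_mul_fourierL2_le`). Every average with `‖h‖ ≤ 1` is thus a fixed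
multiple of an operator `f(A)` with `‖f‖ ≤ 1`, and these form an `R`-bounded set by hypothesis.

To make this precise, `coef` identifies `W^α_2` isometrically with `L²`, and the calculus becomes
one bounded linear map `Φ : L² → B(X)` (`exists_isCalc`), defined on a dense set of holomorphic
functions whose Fourier transforms have compact support. It is multiplicative (`IsCalc.map_mulH`),
because Cauchy integrals over nested contours multiply (`DecayHol.cauchyOp_mul`) and because `W^α_2`
is an algebra for `α > 1/2` (`exists_memSob_mul`). The formula `ρ(A) = (1 + A)⁻¹ - (1 + A)⁻²` gives
that `ρ(A)` is injective with dense range. Hence vectors are separated, and a dense subspace is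
generated, by the operators `η(A)` with `η` a test function in `u`. From this come the density of
`D_A`, the closability of `f(A)` and the formula `f(A)x = (f Ψ)(A)x` whenever `Ψ(A)x = x`.

The average itself is treated in `IsCalc.integral_orbit`. For test functions `h` it is a Bochner
integral, computed pointwise in `u`. For general `h`, the functional `h ↦ x'(Φ(B h) x)` is bounded
on `L²`, so Riesz representation shows that the scalar orbit lies in `L²`, which yields
integrability and the formula at once. -/

noncomputable section

namespace AvgR

/-! ### Integrals along rays and Cauchy's theorem in a sector -/

section Rays

variable {E : Type*} [NormedAddCommGroup E] [NormedSpace ℂ E]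

/-- The integral of `G` along the ray of argument `θ`, outwards. -/
def ray (θ : ℝ) (G : ℂ → E) : E :=
  ∫ r in Ioi (0 : ℝ), Complex.exp (θ * Complex.I) • G (r * Complex.exp (θ * Complex.I))

/-- Compactness of `[ε, K]` takes care of the middle range, so integrands with a pole at a fixed
modulus need be estimated only near `0` and `∞`. -/
lemma exists_bound_of_bound_outside {f : ℝ → E} (hf : ContinuousOn f (Ioi 0)) {C ε K : ℝ}
    (hε : 0 < ε) (hb : ∀ r > 0, (r ≤ ε ∨ K ≤ r) → ‖f r‖ ≤ C / (1 + r ^ 2)) :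
    ∃ C' : ℝ, ∀ r > 0, ‖f r‖ ≤ C' * (1 + r ^ 2)⁻¹ := by
  obtain ⟨D, hD⟩ := (isCompact_Icc (a := ε) (b := K)).exists_bound_of_continuousOn
    (f := fun r => (1 + r ^ 2) • f r) (by
      have h1 : ContinuousOn (fun r : ℝ => 1 + r ^ 2) (Icc ε K) := by fun_prop
      exact h1.smul (hf.mono fun r hr => lt_of_lt_of_le hε hr.1))
  refine ⟨max C D, fun r hr => ?_⟩
  have h1 : (0 : ℝ) < 1 + r ^ 2 := by positivity
  rw [← div_eq_mul_inv]
  by_cases h : r ≤ ε ∨ K ≤ r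
  · exact (hb r hr h).trans (by gcongr; exact le_max_left _ _)
  · push Not at h
    have := hD r ⟨h.1.le, h.2.le⟩
    rw [norm_smul, Real.norm_of_nonneg h1.le] at this
    rw [le_div_iff₀ h1, mul_comm]
    exact this.trans (le_max_right _ _)

lemma integrableOn_of_bound_outside {f : ℝ → E} (hf : ContinuousOn f (Ioi 0)) {C ε K : ℝ}
    (hε : 0 < ε) (hb : ∀ r > 0, (r ≤ ε ∨ K ≤ r) → ‖f r‖ ≤ C / (1 + r ^ 2)) :
    IntegrableOn f (Ioi 0) := by
  obtain ⟨C', hC'⟩ := exists_bound_of_bound_outside hf hε hb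
  refine Integrable.mono' (integrable_inv_one_add_sq.integrableOn.const_mul C')
    (hf.aestronglyMeasurable measurableSet_Ioi) ?_
  filter_upwards [ae_restrict_mem measurableSet_Ioi] with r hr using hC' r hr

lemma exp_image_univ : Real.exp '' univ = Ioi 0 := by
  rw [image_univ, Real.range_exp]

lemma integral_exp_smul (f : ℝ → E) :
    ∫ u : ℝ, Real.exp u • f (Real.exp u) = ∫ r in Ioi (0 : ℝ), f r := by
  have := integral_image_eq_integral_abs_deriv_smul (f := Real.exp) (f' := Real.exp)
    MeasurableSet.univ (fun x _ => (Real.hasDerivAt_exp x).hasDerivWithinAt)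
    Real.exp_injective.injOn f
  rw [exp_image_univ] at this
  simpa [abs_of_pos (Real.exp_pos _)] using this.symm

lemma integrable_exp_smul {f : ℝ → E} (hf : IntegrableOn f (Ioi 0)) :
    Integrable fun u : ℝ => Real.exp u • f (Real.exp u) := by
  have := integrableOn_image_iff_integrableOn_abs_deriv_smul (f := Real.exp) (f' := Real.exp)
    MeasurableSet.univ (fun x _ => (Real.hasDerivAt_exp x).hasDerivWithinAt)
    Real.exp_injective.injOn f
  rw [exp_image_univ] at this
  simpa [abs_of_pos (Real.exp_pos _)] using this.1 hf

/-- Cauchy's theorem for a sector. -/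
lemma ray_eq_ray [CompleteSpace E] {G : ℂ → E} {a b : ℝ} (hab : a ≤ b)
    (hG : ∀ r > (0 : ℝ), ∀ θ ∈ Icc a b, DifferentiableAt ℂ G (r * Complex.exp (θ * Complex.I)))
    {C ε K : ℝ} (hε : 0 < ε)
    (hb : ∀ r > (0 : ℝ), ∀ θ ∈ Icc a b, (r ≤ ε ∨ K ≤ r) →
      ‖G (r * Complex.exp (θ * Complex.I))‖ ≤ C / (1 + r ^ 2)) : ray a G = ray b G := by
  -- The substitution `z ↦ e^z` unfolds the sector into a horizontal strip and its rays into
  -- horizontal lines, so that Cauchy's theorem on rectangles applies.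
  set g : ℂ → E := fun z => Complex.exp z • G (Complex.exp z) with hg
  have hexp (u v : ℝ) : Complex.exp (u + v * Complex.I) =
      (Real.exp u : ℝ) * Complex.exp (v * Complex.I) := by
    rw [Complex.exp_add, Complex.ofReal_exp]
  have key (θ : ℝ) (hθ : θ ∈ Icc a b) :
      Tendsto (fun n : ℕ => ∫ x in (-(n : ℝ))..n, g (x + θ * Complex.I)) atTop (𝓝 (ray θ G)) := by
    have hI : IntegrableOn (fun r : ℝ => Complex.exp (θ * Complex.I) •
        G (r * Complex.exp (θ * Complex.I))) (Ioi 0) := by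
      apply Integrable.smul
      refine integrableOn_of_bound_outside (C := C) (K := K) ?_ hε fun r hr h => hb r hr θ hθ h
      intro r hr
      have h1 : ContinuousAt (fun r : ℝ => (r : ℂ) * Complex.exp (θ * Complex.I)) r := by fun_prop
      exact (ContinuousAt.comp (f := fun r : ℝ => (r : ℂ) * Complex.exp (θ * Complex.I))
        (hG r hr θ hθ).continuousAt h1).continuousWithinAt
    have h1 := integral_exp_smul (fun r : ℝ => Complex.exp (θ * Complex.I) •
        G (r * Complex.exp (θ * Complex.I)))
    have h2 := integrable_exp_smul hI
    have h3 (u : ℝ) : Real.exp u • Complex.exp (θ * Complex.I) •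
        G ((Real.exp u : ℝ) * Complex.exp (θ * Complex.I)) = g (u + θ * Complex.I) := by
      simp only [hg, hexp]
      rw [mul_smul, Complex.coe_smul]
    simp only [h3] at h1 h2
    rw [ray, ← h1]
    exact intervalIntegral_tendsto_integral h2
      (tendsto_neg_atTop_atBot.comp tendsto_natCast_atTop_atTop) tendsto_natCast_atTop_atTop
  -- On the vertical sides the integrand is at most `e^s C / (1 + e^{2s})`, which tends to `0` at
  -- both ends of the strip.
  have hbound : ∀ s : ℝ, (Real.exp s ≤ ε ∨ K ≤ Real.exp s) →
      ‖∫ y in a..b, g (s + y * Complex.I)‖ ≤ (Real.exp s * (C / (1 + Real.exp s ^ 2))) * |b - a| := by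
    intro s hs
    apply intervalIntegral.norm_integral_le_of_norm_le_const
    intro y hy
    rw [uIoc_of_le hab] at hy
    have := hb (Real.exp s) (Real.exp_pos s) y ⟨hy.1.le, hy.2⟩ hs
    simp only [hg, hexp, norm_smul, norm_mul, Complex.norm_exp_ofReal_mul_I, mul_one,
      Complex.norm_real, Real.norm_of_nonneg (Real.exp_pos s).le]
    gcongr
  have hlim : Tendsto (fun n : ℕ => Real.exp (n : ℝ)) atTop atTop :=
    Real.tendsto_exp_atTop.comp tendsto_natCast_atTop_atTop
  have hlim' : Tendsto (fun n : ℕ => Real.exp (-(n : ℝ))) atTop (𝓝 0) :=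
    Real.tendsto_exp_neg_atTop_nhds_zero.comp tendsto_natCast_atTop_atTop
  have hone (t : ℝ) (ht : 0 < t) : t * (C / (1 + t ^ 2)) * |b - a| ≤ t⁻¹ * (|C| * |b - a|) := by
    have : t * (C / (1 + t ^ 2)) ≤ t⁻¹ * |C| := by
      rw [← mul_div_assoc, div_le_iff₀ (by positivity)]
      have h4 : t⁻¹ * |C| * (1 + t ^ 2) = t⁻¹ * |C| + t * |C| := by field_simp
      rw [h4]
      have := mul_le_mul_of_nonneg_left (le_abs_self C) ht.le
      have : 0 ≤ t⁻¹ * |C| := by positivity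
      linarith
    calc _ ≤ t⁻¹ * |C| * |b - a| := by gcongr
      _ = _ := by ring
  have hone' (t : ℝ) (ht : 0 < t) : t * (C / (1 + t ^ 2)) * |b - a| ≤ t * (|C| * |b - a|) := by
    rw [mul_assoc]
    gcongr
    rw [div_le_iff₀ (by positivity)]
    have := le_abs_self C
    nlinarith [mul_nonneg (abs_nonneg C) (sq_nonneg t)]
  have hR : Tendsto (fun n : ℕ => ∫ y in a..b, g (((n : ℝ) : ℂ) + y * Complex.I)) atTop (𝓝 0) := by
    apply squeeze_zero_norm' (a := fun n : ℕ => (Real.exp (n : ℝ))⁻¹ * (|C| * |b - a|))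
    · filter_upwards [hlim.eventually_ge_atTop K] with n hn
      exact (hbound _ (Or.inr hn)).trans (hone _ (Real.exp_pos _))
    · simpa using (tendsto_inv_atTop_zero.comp hlim).mul_const (|C| * |b - a|)
  have hL : Tendsto (fun n : ℕ => ∫ y in a..b, g (((-(n : ℝ) : ℝ) : ℂ) + y * Complex.I))
      atTop (𝓝 0) := by
    apply squeeze_zero_norm' (a := fun n : ℕ => Real.exp (-(n : ℝ)) * (|C| * |b - a|))
    · filter_upwards [hlim'.eventually_le_const hε] with n hn
      exact (hbound _ (Or.inl hn)).trans (hone' _ (Real.exp_pos _))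
    · simpa using hlim'.mul_const (|C| * |b - a|)
  have hzero (n : ℕ) : (∫ x in (-(n : ℝ))..n, g (x + a * Complex.I)) -
      (∫ x in (-(n : ℝ))..n, g (x + b * Complex.I)) +
      Complex.I • (∫ y in a..b, g (((n : ℝ) : ℂ) + y * Complex.I)) -
      Complex.I • (∫ y in a..b, g (((-(n : ℝ) : ℝ) : ℂ) + y * Complex.I)) = 0 := by
    have := Complex.integral_boundary_rect_eq_zero_of_differentiableOn g
      ⟨-(n : ℝ), a⟩ ⟨n, b⟩ (by
        intro z hz
        have him : z.im ∈ Icc a b := by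
          have := hz.2
          simpa [uIcc_of_le hab] using this
        have hz' : Complex.exp z = (Real.exp z.re : ℝ) * Complex.exp (z.im * Complex.I) := by
          rw [← hexp, Complex.re_add_im]
        have h1 := hG (Real.exp z.re) (Real.exp_pos _) z.im him
        rw [← hz'] at h1
        exact (DifferentiableAt.smul (by fun_prop)
          (h1.comp z Complex.differentiableAt_exp)).differentiableWithinAt)
    simpa using this
  have hfin := (((key a ⟨le_rfl, hab⟩).sub (key b ⟨hab, le_rfl⟩)).add
    (hR.const_smul Complex.I)).sub (hL.const_smul Complex.I)
  simp only [smul_zero, add_zero, sub_zero] at hfin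
  have h0 := tendsto_nhds_unique hfin (tendsto_const_nhds.congr fun n => (hzero n).symm)
  exact sub_eq_zero.1 h0

end Rays

/-! ### The resolvent of a 0-sectorial operator -/

section Resolvent

variable {X : Type*} [NormedAddCommGroup X] [NormedSpace ℂ X] {A : X →ₗ.[ℂ] X}

lemma isResolventAt_resolv {l : ℂ} (h : l ∉ opSpectrum A) : IsResolventAt A l (resolv A l) := by
  have h' : ∃ R, IsResolventAt A l R := by simpa [opSpectrum] using h
  rw [resolv, dif_pos h']
  exact h'.choose_spec

lemma IsResolventAt.sub_eq {l m : ℂ} {R S : X →L[ℂ] X} (hR : IsResolventAt A l R)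
    (hS : IsResolventAt A m S) : R - S = (m - l) • (R * S) := by
  ext y
  obtain ⟨hy, e⟩ := hS.1 y
  have h1 := hR.2 ⟨S y, hy⟩
  have h2 : l • S y - A ⟨S y, hy⟩ = y + (l - m) • S y := by
    calc l • S y - A ⟨S y, hy⟩ = (m • S y - A ⟨S y, hy⟩) + (l - m) • S y := by module
      _ = _ := by rw [e]
  simp only at h1
  rw [h2, map_add, map_smul] at h1
  change R y - S y = (m - l) • R (S y)
  rw [eq_sub_of_add_eq h1]
  module

/-- Since `arg` is discontinuous, closed sectors are described by the closed condition `‖z‖ cos w ≤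
Re z`, which also admits `z = 0`. -/
lemma closure_sector_subset {w : ℝ} (hw : w ∈ Ioo 0 Real.pi) :
    closure (sector w) ⊆ {z | ‖z‖ * Real.cos w ≤ z.re} := by
  apply closure_minimal
  · rintro z ⟨-, hz⟩
    have h := Complex.norm_mul_cos_arg z
    rw [mem_ofPred_eq, ← h]
    gcongr
    rw [← Real.cos_abs z.arg]
    exact Real.cos_le_cos_of_nonneg_of_le_pi (abs_nonneg _) hw.2.le hz.le
  · exact isClosed_le (by fun_prop) (by fun_prop)

/-- The inequality `Re l < ‖l‖` expresses `l ∉ [0, ∞)` as an open condition; such an `l` is left out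
by the closed sector of some small angle. -/
lemma IsZeroSectorial.notMem_spectrum (hA : IsZeroSectorial A) {l : ℂ} (hl : l.re < ‖l‖) :
    l ∉ opSpectrum A := by
  have h0 : 0 < ‖l‖ := by
    rcases eq_or_ne l 0 with rfl | h
    · simp at hl
    · exact norm_pos_iff.2 h
  intro h
  have hlt : l.re / ‖l‖ < 1 := (div_lt_one h0).2 hl
  have hev : ∀ᶠ w in 𝓝[>] (0 : ℝ), l.re / ‖l‖ < Real.cos w ∧ w ∈ Ioo 0 Real.pi := by
    have h1 : Tendsto Real.cos (𝓝[>] 0) (𝓝 1) := by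
      simpa using (Real.continuous_cos.tendsto 0).mono_left nhdsWithin_le_nhds
    exact (h1.eventually_const_lt hlt).and (Ioo_mem_nhdsGT Real.pi_pos)
  obtain ⟨w, hw, hw'⟩ := hev.exists
  have := closure_sector_subset hw' ((hA w hw').spectrum_subset h)
  rw [div_lt_iff₀ h0] at hw
  rw [mem_ofPred_eq] at this
  linarith

/-- The bound must hold on the rays of angle `±θ` themselves, hence the passage to the smaller
angles `θ/3 < θ/2`. -/
lemma IsZeroSectorial.exists_bound (hA : IsZeroSectorial A) {θ : ℝ} (hθ : θ ∈ Ioo 0 Real.pi) :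
    ∃ C : ℝ, 0 ≤ C ∧ ∀ l : ℂ, l ≠ 0 → l.re ≤ ‖l‖ * Real.cos θ → ‖l • resolv A l‖ ≤ C := by
  obtain ⟨C, hC⟩ := (hA (θ / 3) ⟨by linarith [hθ.1], by linarith [hθ.1, hθ.2]⟩).resolvent_bound
    (θ / 2) ⟨by linarith [hθ.1], by linarith [hθ.1, hθ.2]⟩
  refine ⟨max C 0, le_max_right _ _, fun l h0 hl => (hC l fun h => ?_).trans (le_max_left _ _)⟩
  have h1 := closure_sector_subset (w := θ / 2) ⟨by linarith [hθ.1], by linarith [hθ.1, hθ.2]⟩ h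
  have h2 : Real.cos θ < Real.cos (θ / 2) :=
    Real.cos_lt_cos_of_nonneg_of_le_pi (by linarith [hθ.1]) hθ.2.le (by linarith [hθ.1])
  have h3 : 0 < ‖l‖ := norm_pos_iff.2 h0
  rw [mem_ofPred_eq] at h1
  nlinarith

lemma exists_angle {l : ℂ} (hl : l.re < ‖l‖) :
    ∃ θ ∈ Ioo 0 Real.pi, l.re < ‖l‖ * Real.cos θ := by
  have h0 : 0 < ‖l‖ := by
    rcases eq_or_ne l 0 with rfl | h
    · simp at hl
    · exact norm_pos_iff.2 h
  have hlt : l.re / ‖l‖ < 1 := (div_lt_one h0).2 hl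
  have hev : ∀ᶠ w in 𝓝[>] (0 : ℝ), l.re / ‖l‖ < Real.cos w ∧ w ∈ Ioo 0 Real.pi := by
    have h1 : Tendsto Real.cos (𝓝[>] 0) (𝓝 1) := by
      simpa using (Real.continuous_cos.tendsto 0).mono_left nhdsWithin_le_nhds
    exact (h1.eventually_const_lt hlt).and (Ioo_mem_nhdsGT Real.pi_pos)
  obtain ⟨w, hw, hw'⟩ := hev.exists
  exact ⟨w, hw', by rwa [div_lt_iff₀ h0, mul_comm] at hw⟩

/-- The resolvent identity and a local bound give continuity; dividing the same identity by `m - l`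
then gives the derivative `-R(l)²`. -/
lemma IsZeroSectorial.differentiableAt_resolv (hA : IsZeroSectorial A) {l : ℂ}
    (hl : l.re < ‖l‖) : DifferentiableAt ℂ (resolv A) l := by
  obtain ⟨θ, hθ, hlθ⟩ := exists_angle hl
  obtain ⟨C, hC0, hC⟩ := hA.exists_bound hθ
  have h0 : 0 < ‖l‖ := by
    rcases eq_or_ne l 0 with rfl | h
    · simp at hl
    · exact norm_pos_iff.2 h
  have hev1 : ∀ᶠ m in 𝓝 l, m.re < ‖m‖ * Real.cos θ :=
    (isOpen_lt (by fun_prop) (by fun_prop)).mem_nhds hlθ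
  have hev2 : ∀ᶠ m : ℂ in 𝓝 l, ‖l‖ / 2 < ‖m‖ :=
    (isOpen_lt (by fun_prop) (by fun_prop)).mem_nhds (by simp only [mem_ofPred_eq]; linarith)
  have hev3 : ∀ᶠ m : ℂ in 𝓝 l, m.re < ‖m‖ :=
    (isOpen_lt (by fun_prop) (by fun_prop)).mem_nhds hl
  have hid : ∀ᶠ m in 𝓝 l, resolv A m - resolv A l = (l - m) • (resolv A m * resolv A l) := by
    filter_upwards [hev3] with m hm
    exact (isResolventAt_resolv (hA.notMem_spectrum hm)).sub_eq
      (isResolventAt_resolv (hA.notMem_spectrum hl))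
  have hbd : ∀ᶠ m in 𝓝 l, ‖resolv A m‖ ≤ C / (‖l‖ / 2) := by
    filter_upwards [hev1, hev2] with m h1 h2
    have hm : 0 < ‖m‖ := by linarith
    have := hC m (norm_pos_iff.1 hm) h1.le
    rw [norm_smul] at this
    rw [le_div_iff₀ (by linarith)]
    nlinarith [norm_nonneg (resolv A m)]
  have hcont : Tendsto (resolv A) (𝓝 l) (𝓝 (resolv A l)) := by
    rw [tendsto_iff_norm_sub_tendsto_zero]
    apply squeeze_zero' (g := fun m => ‖l - m‖ * (C / (‖l‖ / 2) * ‖resolv A l‖))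
    · exact Eventually.of_forall fun _ => norm_nonneg _
    · filter_upwards [hid, hbd] with m h1 h2
      rw [h1, norm_smul]
      gcongr
      exact (norm_mul_le _ _).trans (by gcongr)
    · have : Tendsto (fun m => ‖l - m‖ * (C / (‖l‖ / 2) * ‖resolv A l‖)) (𝓝 l)
          (𝓝 (‖l - l‖ * (C / (‖l‖ / 2) * ‖resolv A l‖))) :=
        Continuous.tendsto (by fun_prop) l
      simpa using this
  have hder : HasDerivAt (resolv A) (-(resolv A l * resolv A l)) l := by
    rw [hasDerivAt_iff_tendsto_slope]
    have h1 : Tendsto (fun m => -(resolv A m * resolv A l)) (𝓝[≠] l)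
        (𝓝 (-(resolv A l * resolv A l))) :=
      ((hcont.mul tendsto_const_nhds).neg).mono_left nhdsWithin_le_nhds
    refine h1.congr' ?_
    filter_upwards [hid.filter_mono nhdsWithin_le_nhds, self_mem_nhdsWithin] with m hm hne
    rw [slope_def_module, hm, smul_smul, ← neg_sub m l, mul_neg,
      inv_mul_cancel₀ (sub_ne_zero.2 hne), neg_one_smul]
  exact hder.differentiableAt

end Resolvent

/-! ### Decaying holomorphic functions and contours around a sector -/

section Cauchy

/-- The contour integral over the boundary of the sector of half-angle `σ`. -/
def cint {E : Type*} [NormedAddCommGroup E] [NormedSpace ℂ E] (σ : ℝ) (G : ℂ → E) : E :=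
  ray (-σ) G - ray σ G

lemma cauchyOp_eq_cint {X : Type*} [NormedAddCommGroup X] [NormedSpace ℂ X] (A : X →ₗ.[ℂ] X)
    (σ : ℝ) (f : ℂ → ℂ) :
    cauchyOp A σ f = (2 * Real.pi * Complex.I)⁻¹ • cint σ (fun l => f l • resolv A l) := by
  simp only [cauchyOp, cint, ray, smul_smul, Complex.ofReal_neg, neg_mul, mul_comm (f _)]

lemma norm_ofReal_mul_exp {r : ℝ} (hr : 0 < r) (θ : ℝ) :
    ‖(r : ℂ) * Complex.exp (θ * Complex.I)‖ = r := by
  simp [Complex.norm_exp_ofReal_mul_I, abs_of_pos hr]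

lemma arg_ofReal_mul_exp {r : ℝ} (hr : 0 < r) {θ : ℝ} (hθ : |θ| < Real.pi) :
    ((r : ℂ) * Complex.exp (θ * Complex.I)).arg = θ := by
  rw [Complex.arg_real_mul _ hr, Complex.arg_exp_mul_I]
  rw [abs_lt] at hθ
  exact (toIocMod_eq_self Real.two_pi_pos).2 ⟨hθ.1, by linarith⟩

lemma ofReal_mul_exp_ne_zero {r : ℝ} (hr : 0 < r) (θ : ℝ) :
    (r : ℂ) * Complex.exp (θ * Complex.I) ≠ 0 := by
  simp [hr.ne']

lemma ofReal_mul_exp_mem_sector {r : ℝ} (hr : 0 < r) {θ w : ℝ} (hθ : |θ| < w)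
    (hw : w ≤ Real.pi) : (r : ℂ) * Complex.exp (θ * Complex.I) ∈ sector w :=
  ⟨ofReal_mul_exp_ne_zero hr θ, by rwa [arg_ofReal_mul_exp hr (hθ.trans_le hw)]⟩

lemma sector_subset_slitPlane {w : ℝ} (hw : w ≤ Real.pi) : sector w ⊆ Complex.slitPlane := by
  rintro z ⟨h0, hz⟩
  rw [Complex.mem_slitPlane_iff_arg]
  refine ⟨fun h => ?_, h0⟩
  rw [h, abs_of_pos Real.pi_pos] at hz
  linarith

/-- Holomorphic functions off `(-∞, 0]` which are `O(|z| / (1 + |z|²))` on every sector. -/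
structure DecayHol (f : ℂ → ℂ) : Prop where
  diff : DifferentiableOn ℂ f Complex.slitPlane
  bound : ∀ w ∈ Ioo 0 Real.pi, ∃ C : ℝ, 0 ≤ C ∧ ∀ z ∈ sector w, ‖f z‖ ≤ C * (‖z‖ / (1 + ‖z‖ ^ 2))

lemma DecayHol.differentiableAt {f : ℂ → ℂ} (hf : DecayHol f) {z : ℂ}
    (hz : z ∈ Complex.slitPlane) : DifferentiableAt ℂ f z :=
  hf.diff.differentiableAt (Complex.isOpen_slitPlane.mem_nhds hz)

lemma abs_le_of_mem_Icc {σ θ : ℝ} (h : θ ∈ Icc (-σ) σ) : |θ| ≤ σ := abs_le.2 h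

lemma DecayHol.exists_bound_ray {f : ℂ → ℂ} (hf : DecayHol f) {σ : ℝ} (hσ : σ ∈ Ioo 0 Real.pi) :
    ∃ C : ℝ, 0 ≤ C ∧ ∀ r > (0 : ℝ), ∀ θ : ℝ, |θ| ≤ σ →
      ‖f (r * Complex.exp (θ * Complex.I))‖ ≤ C * (r / (1 + r ^ 2)) := by
  obtain ⟨C, hC0, hC⟩ := hf.bound ((σ + Real.pi) / 2) ⟨by linarith [hσ.1, hσ.2], by linarith [hσ.2]⟩
  refine ⟨C, hC0, fun r hr θ hθ => ?_⟩
  have := hC _ (ofReal_mul_exp_mem_sector (θ := θ) hr (hθ.trans_lt (by linarith [hσ.2]))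
    (by linarith [hσ.2]))
  rwa [norm_ofReal_mul_exp hr] at this

/-- Away from the annulus around `|l|` one has `|z - l| ≥ |z|/2`, and this cancels the factor `|z|`
in the decay of `c`. -/
lemma norm_div_sub_le {z l c : ℂ} {C : ℝ} (hC : 0 ≤ C) (hl : l ≠ 0)
    (hc : ‖c‖ ≤ C * (‖z‖ / (1 + ‖z‖ ^ 2)))
    (h : ‖z‖ ≤ ‖l‖ / 2 ∨ 2 * ‖l‖ ≤ ‖z‖) : ‖c / (z - l)‖ ≤ (2 * C) / (1 + ‖z‖ ^ 2) := by
  have hl' : 0 < ‖l‖ := norm_pos_iff.2 hl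
  have h1 : ‖z‖ / 2 ≤ ‖z - l‖ := by
    rcases h with h | h
    · have := norm_sub_norm_le l z
      rw [norm_sub_rev] at this
      linarith
    · have := norm_sub_norm_le z l
      linarith
  have h2 : 0 < ‖z - l‖ := by
    rcases h with h | h
    · have := norm_sub_norm_le l z
      rw [norm_sub_rev] at this
      linarith
    · linarith
  rw [norm_div, div_le_iff₀ h2]
  refine hc.trans ?_
  have h3 : (0 : ℝ) < 1 + ‖z‖ ^ 2 := by positivity
  rw [← mul_div_assoc, div_mul_eq_mul_div]
  exact div_le_div_of_nonneg_right (by nlinarith) h3.le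

/-- The pole lies outside the closed sector, so one boundary ray can be rotated into the other
through the sector. -/
lemma DecayHol.cint_div_sub_eq_zero {f : ℂ → ℂ} (hf : DecayHol f) {σ : ℝ}
    (hσ : σ ∈ Ioo 0 Real.pi) {m : ℂ} (h0 : m ≠ 0) (hm : σ < |m.arg|) :
    cint σ (fun l => f l / (m - l)) = 0 := by
  obtain ⟨C, hC0, hC⟩ := hf.exists_bound_ray hσ
  rw [cint, sub_eq_zero]
  have hm0 : 0 < ‖m‖ := norm_pos_iff.2 h0
  refine ray_eq_ray (by linarith [hσ.1]) (fun r hr θ hθ => ?_) (C := 2 * C) (ε := ‖m‖ / 2)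
    (K := 2 * ‖m‖) (by linarith) (fun r hr θ hθ h => ?_)
  · have hθ' := abs_le_of_mem_Icc hθ
    refine (hf.differentiableAt (sector_subset_slitPlane le_rfl
      (ofReal_mul_exp_mem_sector hr (hθ'.trans_lt hσ.2) le_rfl))).div (by fun_prop) ?_
    rw [sub_ne_zero]
    rintro rfl
    rw [arg_ofReal_mul_exp hr (hθ'.trans_lt hσ.2)] at hm
    linarith
  · have := norm_div_sub_le (z := (r : ℂ) * Complex.exp (θ * Complex.I)) (l := m)
      (c := f (r * Complex.exp (θ * Complex.I))) hC0 h0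
      (by rw [norm_ofReal_mul_exp hr]; exact hC r hr θ (abs_le_of_mem_Icc hθ))
      (by rw [norm_ofReal_mul_exp hr]; exact h)
    rw [norm_ofReal_mul_exp hr] at this
    rwa [← neg_sub, div_neg, norm_neg]

end Cauchy

/-! ### Cauchy's integral formula in a sector -/

section Cauchy

lemma continuousOn_comp_ray {E : Type*} [NormedAddCommGroup E] {G : ℂ → E} {θ : ℝ}
    (hG : ∀ r > (0 : ℝ), ContinuousAt G (r * Complex.exp (θ * Complex.I))) :
    ContinuousOn (fun r : ℝ => G (r * Complex.exp (θ * Complex.I))) (Ioi 0) := by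
  intro r hr
  have h1 : ContinuousAt (fun r : ℝ => (r : ℂ) * Complex.exp (θ * Complex.I)) r := by fun_prop
  exact (ContinuousAt.comp (f := fun r : ℝ => (r : ℂ) * Complex.exp (θ * Complex.I))
    (hG r hr) h1).continuousWithinAt

/-- `1/(z - l) - 1/(1 + z)`, written as one fraction. -/
def cauchyKer (l z : ℂ) : ℂ := (1 + l) / ((1 + z) * (z - l))

lemma norm_one_add_ge {z : ℂ} (h : ‖z‖ ≤ 1 / 2 ∨ 2 ≤ ‖z‖) : (1 + ‖z‖) / 3 ≤ ‖1 + z‖ := by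
  rcases h with h | h
  · have := norm_sub_norm_le (1 : ℂ) (-z)
    rw [sub_neg_eq_add, norm_neg, norm_one] at this
    linarith
  · have := norm_sub_norm_le z (-1 : ℂ)
    rw [sub_neg_eq_add, norm_neg, norm_one, add_comm z] at this
    linarith

lemma norm_sub_ge {z l : ℂ} (h : ‖z‖ ≤ ‖l‖ / 2 ∨ 2 * ‖l‖ ≤ ‖z‖) :
    (‖l‖ + ‖z‖) / 3 ≤ ‖z - l‖ := by
  rcases h with h | h
  · have := norm_sub_norm_le l z
    rw [norm_sub_rev] at this
    linarith
  · have := norm_sub_norm_le z l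
    linarith

/-- The extra pole at `-1` lies outside every sector considered, and it improves the decay of `1/(z
- l)` from order one to the integrable order two. -/
lemma norm_cauchyKer_le {l : ℂ} (hl : l ≠ 0) : ∃ C : ℝ, 0 ≤ C ∧ ∀ z : ℂ,
    (‖z‖ ≤ min (1 / 2) (‖l‖ / 2) ∨ 2 + 2 * ‖l‖ ≤ ‖z‖) → ‖cauchyKer l z‖ ≤ C / (1 + ‖z‖ ^ 2) := by
  have hl' : 0 < ‖l‖ := norm_pos_iff.2 hl
  refine ⟨9 * ‖1 + l‖ * (1 + 1 / ‖l‖), by positivity, fun z hz => ?_⟩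
  have h1 : (1 + ‖z‖) / 3 ≤ ‖1 + z‖ := by
    apply norm_one_add_ge
    rcases hz with h | h
    · exact Or.inl (h.trans (min_le_left _ _))
    · exact Or.inr (by linarith)
  have h2 : (‖l‖ + ‖z‖) / 3 ≤ ‖z - l‖ := by
    apply norm_sub_ge
    rcases hz with h | h
    · exact Or.inl (h.trans (min_le_right _ _))
    · exact Or.inr (by linarith)
  have hz0 := norm_nonneg z
  have h1' : 0 < ‖1 + z‖ := by linarith
  have h2' : 0 < ‖z - l‖ := by linarith
  rw [cauchyKer, norm_div, norm_mul, div_le_div_iff₀ (by positivity) (by positivity)]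
  have h3 : (1 + ‖z‖) / 3 * ((‖l‖ + ‖z‖) / 3) ≤ ‖1 + z‖ * ‖z - l‖ := by gcongr
  have h4 : 1 + ‖z‖ ^ 2 ≤ (1 + 1 / ‖l‖) * ((1 + ‖z‖) * (‖l‖ + ‖z‖)) := by
    have : (1 + 1 / ‖l‖) * ((1 + ‖z‖) * (‖l‖ + ‖z‖)) =
      (1 + ‖z‖) * (‖l‖ + ‖z‖) + (1 + ‖z‖) * (1 + ‖z‖ / ‖l‖) := by field_simp
    rw [this]
    have : 0 ≤ ‖z‖ / ‖l‖ := by positivity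
    nlinarith [mul_nonneg hz0 this, mul_nonneg hz0 hl'.le]
  calc ‖1 + l‖ * (1 + ‖z‖ ^ 2)
      ≤ ‖1 + l‖ * ((1 + 1 / ‖l‖) * ((1 + ‖z‖) * (‖l‖ + ‖z‖))) := by gcongr
    _ = 9 * ‖1 + l‖ * (1 + 1 / ‖l‖) * ((1 + ‖z‖) / 3 * ((‖l‖ + ‖z‖) / 3)) := by ring
    _ ≤ _ := by gcongr

lemma one_add_ne_zero_of_mem_slitPlane {z : ℂ} (hz : z ∈ Complex.slitPlane) : 1 + z ≠ 0 := by
  intro h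
  have : z = -1 := by linear_combination h
  rw [this, Complex.mem_slitPlane_iff] at hz
  rcases hz with h | h <;> norm_num at h

lemma integrableOn_cauchyKer {l : ℂ} (hl : l ≠ 0) {θ : ℝ} (hθ : |θ| < Real.pi)
    (h : ∀ r > (0 : ℝ), (r : ℂ) * Complex.exp (θ * Complex.I) ≠ l) :
    IntegrableOn (fun r : ℝ => cauchyKer l (r * Complex.exp (θ * Complex.I))) (Ioi 0) := by
  obtain ⟨C, -, hC⟩ := norm_cauchyKer_le hl
  have hl' : 0 < ‖l‖ := norm_pos_iff.2 hl
  refine integrableOn_of_bound_outside (C := C) (ε := min (1 / 2) (‖l‖ / 2)) (K := 2 + 2 * ‖l‖)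
    (continuousOn_comp_ray fun r hr => ?_) (lt_min (by norm_num) (by linarith)) fun r hr h' => ?_
  · have h1 := one_add_ne_zero_of_mem_slitPlane
      (sector_subset_slitPlane le_rfl (ofReal_mul_exp_mem_sector hr hθ le_rfl))
    have h2 := sub_ne_zero.2 (h r hr)
    unfold cauchyKer
    exact ContinuousAt.div (by fun_prop) (by fun_prop) (mul_ne_zero h1 h2)
  · have := hC (r * Complex.exp (θ * Complex.I)) (by rwa [norm_ofReal_mul_exp hr])
    rwa [norm_ofReal_mul_exp hr] at this

lemma tendsto_log_sub_log (a b : ℂ) :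
    Tendsto (fun r : ℝ => Complex.log (r + a) - Complex.log (r + b)) atTop (𝓝 0) := by
  have key (a : ℂ) : Tendsto (fun r : ℝ => Complex.log (1 + a / r)) atTop (𝓝 0) := by
    have h1 : Tendsto (fun r : ℝ => 1 + a / (r : ℂ)) atTop (𝓝 1) := by
      have : Tendsto (fun r : ℝ => a * ((r⁻¹ : ℝ) : ℂ)) atTop (𝓝 (a * ((0 : ℝ) : ℂ))) :=
        ((Complex.continuous_ofReal.tendsto 0).comp tendsto_inv_atTop_zero).const_mul a
      simpa [div_eq_mul_inv] using this.const_add 1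
    have := (continuousAt_clog (x := 1) (by simp)).tendsto.comp h1
    simpa [Function.comp_def] using this
  have hev (a : ℂ) : ∀ᶠ r : ℝ in atTop, Complex.log (r + a) =
      Real.log r + Complex.log (1 + a / r) := by
    filter_upwards [eventually_gt_atTop ‖a‖, eventually_gt_atTop 0] with r hr h0
    have h0' : (r : ℂ) ≠ 0 := by exact_mod_cast h0.ne'
    rw [← Complex.log_ofReal_mul h0]
    · congr 1
      field_simp
    · intro h
      have : a = -r := by
        field_simp at h
        linear_combination h
      rw [this, norm_neg, Complex.norm_real, Real.norm_of_nonneg h0.le] at hr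
      exact lt_irrefl _ hr
  have := (key a).sub (key b)
  rw [sub_zero] at this
  refine this.congr' ?_
  filter_upwards [hev a, hev b] with r h1 h2
  rw [h1, h2]
  ring

lemma add_mem_slitPlane {a : ℂ} (ha : a ∈ Complex.slitPlane) {r : ℝ} (hr : 0 ≤ r) :
    (r : ℂ) + a ∈ Complex.slitPlane := by
  rw [Complex.mem_slitPlane_iff] at ha ⊢
  simp only [Complex.add_re, Complex.ofReal_re, Complex.add_im, Complex.ofReal_im, zero_add]
  rcases ha with h | h
  · left; linarith
  · right; exact h

/-- After factoring out `e^{iθ}`, an antiderivative is `log(r - l e^{-iθ}) - log(r + e^{-iθ})`.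
Adding `r ≥ 0` does not leave the slit plane, so principal logarithms suffice along the whole ray.
-/
lemma ray_cauchyKer {l : ℂ} (hl : l ≠ 0) {θ : ℝ} (hθ : |θ| < Real.pi)
    (h : -(l * Complex.exp (-(θ * Complex.I))) ∈ Complex.slitPlane) :
    ray θ (cauchyKer l) = Complex.log (Complex.exp (-(θ * Complex.I))) -
      Complex.log (-(l * Complex.exp (-(θ * Complex.I)))) := by
  set e := Complex.exp (θ * Complex.I) with he
  set e' := Complex.exp (-(θ * Complex.I)) with he'
  have hee : e * e' = 1 := by rw [he, he', ← Complex.exp_add]; simp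
  have hb : e' ∈ Complex.slitPlane := by
    have := sector_subset_slitPlane le_rfl
      (ofReal_mul_exp_mem_sector (r := 1) one_pos (θ := -θ) (by rwa [abs_neg]) le_rfl)
    simpa [he'] using this
  have hne (r : ℝ) (hr : 0 ≤ r) : (r : ℂ) - l * e' ≠ 0 := by
    have := Complex.slitPlane_ne_zero (add_mem_slitPlane h hr)
    rwa [← sub_eq_add_neg] at this
  have hne' (r : ℝ) (hr : 0 ≤ r) : (r : ℂ) + e' ≠ 0 :=
    Complex.slitPlane_ne_zero (add_mem_slitPlane hb hr)
  have hint : IntegrableOn (fun r : ℝ => e • cauchyKer l (r * e)) (Ioi 0) := by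
    refine Integrable.smul e (f := fun r : ℝ => cauchyKer l (r * e)) ?_
    refine integrableOn_cauchyKer hl hθ fun r hr heq => hne r hr.le ?_
    rw [← heq, mul_assoc, hee, mul_one, sub_self]
  have hderiv : ∀ r ∈ Ici (0 : ℝ), HasDerivAt
      (fun r : ℝ => Complex.log (r + -(l * e')) - Complex.log (r + e')) (e • cauchyKer l (r * e)) r := by
    intro r hr
    have h1 := (((hasDerivAt_id r).ofReal_comp).add_const (-(l * e'))).clog_real
      (add_mem_slitPlane h hr)
    have h2 := (((hasDerivAt_id r).ofReal_comp).add_const e').clog_real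
      (add_mem_slitPlane hb hr)
    convert! h1.sub h2 using 1
    have hr1 := hne r hr
    have hr2 := hne' r hr
    have h3 : 1 + r * e = e * (r + e') := by linear_combination (-1 : ℂ) * hee
    have h4 : r * e - l = e * (r - l * e') := by linear_combination l * hee
    have h5 : e ≠ 0 := left_ne_zero_of_mul_eq_one hee
    simp only [cauchyKer, smul_eq_mul, id, Complex.ofReal_one, ← sub_eq_add_neg]
    rw [h3, h4, div_sub_div _ _ hr1 hr2]
    rw [← mul_div_assoc, div_eq_div_iff (by positivity) (by positivity)]
    linear_combination (r - l * e') * (r + e') * (-e) * (1 + l) * hee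
  have := integral_Ioi_of_hasDerivAt_of_tendsto (hderiv 0 self_mem_Ici).continuousAt.continuousWithinAt
    (fun r hr => hderiv r (mem_Ici.2 (le_of_lt hr))) hint (tendsto_log_sub_log _ _)
  rw [ray, this]
  simp

/-- The value `2πi` comes from the branch of the logarithm: `-l e^{-iσ}` and `-l e^{iσ}` have
arguments `arg l - σ + π` and `arg l + σ - π`, differing by `2π - 2σ`, and the logarithms of
`e^{±iσ}` supply the remaining `2σ`. -/
lemma cint_cauchyKer {l : ℂ} (hl : l ≠ 0) {σ : ℝ} (hσ : σ < Real.pi) (hls : |l.arg| < σ) :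
    cint σ (cauchyKer l) = 2 * Real.pi * Complex.I := by
  have hσ0 : 0 < σ := (abs_nonneg _).trans_lt hls
  have hb := abs_lt.1 hls
  have hl' : (‖l‖ : ℂ) ≠ 0 := by exact_mod_cast (norm_pos_iff.2 hl).ne'
  have hle : l = Complex.exp (Real.log ‖l‖ + l.arg * Complex.I) := by
    rw [Complex.exp_add, ← Complex.ofReal_exp, Real.exp_log (norm_pos_iff.2 hl)]
    exact (Complex.norm_mul_exp_arg_mul_I l).symm
  have e1 : -(l * Complex.exp (-(σ * Complex.I))) =
      Complex.exp (Real.log ‖l‖ + ((l.arg - σ + Real.pi : ℝ) : ℂ) * Complex.I) := by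
    nth_rewrite 1 [hle]
    rw [← Complex.exp_add, neg_eq_neg_one_mul, ← Complex.exp_pi_mul_I, ← Complex.exp_add]
    congr 1
    push_cast
    ring
  have e2 : -(l * Complex.exp (-(((-σ : ℝ) : ℂ) * Complex.I))) =
      Complex.exp (Real.log ‖l‖ + ((l.arg + σ - Real.pi : ℝ) : ℂ) * Complex.I) := by
    nth_rewrite 1 [hle]
    rw [← Complex.exp_add, neg_eq_neg_one_mul, ← Complex.exp_neg_pi_mul_I, ← Complex.exp_add]
    congr 1
    push_cast
    ring
  have hslit (t : ℝ) (ht : |t| < Real.pi) :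
      Complex.exp (Real.log ‖l‖ + (t : ℂ) * Complex.I) ∈ Complex.slitPlane := by
    rw [Complex.exp_add, ← Complex.ofReal_exp]
    exact sector_subset_slitPlane le_rfl (ofReal_mul_exp_mem_sector (Real.exp_pos _) ht le_rfl)
  have hlog (t : ℝ) (ht : |t| < Real.pi) :
      Complex.log (Complex.exp (Real.log ‖l‖ + (t : ℂ) * Complex.I)) =
        Real.log ‖l‖ + (t : ℂ) * Complex.I := by
    rw [abs_lt] at ht
    apply Complex.log_exp <;> simp <;> linarith
  have hlog' (t : ℝ) (ht : |t| < Real.pi) :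
      Complex.log (Complex.exp (-((t : ℂ) * Complex.I))) = -((t : ℂ) * Complex.I) := by
    rw [abs_lt] at ht
    apply Complex.log_exp <;> simp <;> linarith
  have t1 : |l.arg - σ + Real.pi| < Real.pi := by rw [abs_lt]; constructor <;> linarith
  have t2 : |l.arg + σ - Real.pi| < Real.pi := by rw [abs_lt]; constructor <;> linarith
  have t3 : |σ| < Real.pi := by rwa [abs_of_pos hσ0]
  have t4 : |-σ| < Real.pi := by rwa [abs_neg]
  rw [cint, ray_cauchyKer hl t4 (by rw [e2]; exact hslit _ t2),
    ray_cauchyKer hl t3 (by rw [e1]; exact hslit _ t1), e1, e2, hlog _ t1, hlog _ t2, hlog' _ t3,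
    hlog' _ t4]
  push_cast
  ring

lemma ray_sub_of_integrable {E : Type*} [NormedAddCommGroup E] [NormedSpace ℂ E] {F G : ℂ → E}
    {θ : ℝ}
    (hF : IntegrableOn (fun r : ℝ => F (r * Complex.exp (θ * Complex.I))) (Ioi 0))
    (hG : IntegrableOn (fun r : ℝ => G (r * Complex.exp (θ * Complex.I))) (Ioi 0)) :
    ray θ (fun z => F z - G z) = ray θ F - ray θ G := by
  simp only [ray, smul_sub]
  exact integral_sub (Integrable.smul _ hF) (Integrable.smul _ hG)

lemma ray_const_mul {θ : ℝ} (c : ℂ) (F : ℂ → ℂ) :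
    ray θ (fun z => c * F z) = c * ray θ F := by
  simp only [ray, smul_eq_mul, mul_left_comm _ c]
  exact integral_const_mul _ _

lemma DecayHol.integrableOn_div_sub {f : ℂ → ℂ} (hf : DecayHol f) {θ : ℝ}
    (hθ : |θ| < Real.pi) {l : ℂ} (hl : l ≠ 0)
    (h : ∀ r > (0 : ℝ), (r : ℂ) * Complex.exp (θ * Complex.I) ≠ l) :
    IntegrableOn (fun r : ℝ => f (r * Complex.exp (θ * Complex.I)) /
      (r * Complex.exp (θ * Complex.I) - l)) (Ioi 0) := by
  obtain ⟨C, hC0, hC⟩ := hf.exists_bound_ray (σ := (|θ| + Real.pi) / 2)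
    ⟨by linarith [abs_nonneg θ], by linarith⟩
  have hl' : 0 < ‖l‖ := norm_pos_iff.2 hl
  refine integrableOn_of_bound_outside (C := 2 * C) (ε := ‖l‖ / 2) (K := 2 * ‖l‖)
    (continuousOn_comp_ray (G := fun z => f z / (z - l)) fun r hr => ?_) (by linarith)
    fun r hr h' => ?_
  · have h1 := sector_subset_slitPlane le_rfl (ofReal_mul_exp_mem_sector hr hθ le_rfl)
    exact (hf.differentiableAt h1).continuousAt.div (by fun_prop) (sub_ne_zero.2 (h r hr))
  · have := norm_div_sub_le (z := (r : ℂ) * Complex.exp (θ * Complex.I)) (l := l)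
      (c := f (r * Complex.exp (θ * Complex.I))) hC0 hl
      (by rw [norm_ofReal_mul_exp hr]; exact hC r hr θ (by linarith))
      (by rw [norm_ofReal_mul_exp hr]; exact h')
    rwa [norm_ofReal_mul_exp hr] at this

/-- Cauchy's integral formula on a sector. -/
lemma DecayHol.cint_div_sub {f : ℂ → ℂ} (hf : DecayHol f) {σ : ℝ}
    (hσ : σ ∈ Ioo 0 Real.pi) {l : ℂ} (h0 : l ≠ 0) (hl : |l.arg| < σ) :
    cint σ (fun z => f z / (z - l)) = 2 * Real.pi * Complex.I * f l := by
  have hl' : 0 < ‖l‖ := norm_pos_iff.2 h0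
  have hls : l ∈ Complex.slitPlane := sector_subset_slitPlane hσ.2.le ⟨h0, hl⟩
  -- Subtracting this multiple of `1/(1 + z)` makes the function vanish at `l`. Its `dslope` is then
  -- holomorphic across `l`, integrates to zero, and differs from `f z / (z - l)` only by `f l *
  -- cauchyKer l z`.
  set P : ℂ → ℂ := fun z => f z - f l * ((1 + l) / (1 + z)) with hP
  have hPl : P l = 0 := by
    simp only [hP]
    rw [div_self (one_add_ne_zero_of_mem_slitPlane hls), mul_one, sub_self]
  have hPd : DifferentiableOn ℂ P Complex.slitPlane := by
    refine hf.diff.sub ((DifferentiableOn.div (by fun_prop) (by fun_prop) fun z hz =>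
      one_add_ne_zero_of_mem_slitPlane hz).const_mul _)
  have hQ : DifferentiableOn ℂ (dslope P l) Complex.slitPlane :=
    (Complex.differentiableOn_dslope (Complex.isOpen_slitPlane.mem_nhds hls)).2 hPd
  have hform (z : ℂ) (hz : z ≠ l) (hz' : z ∈ Complex.slitPlane) :
      dslope P l z = f z / (z - l) - f l * cauchyKer l z := by
    have h1 := one_add_ne_zero_of_mem_slitPlane hz'
    have h2 := sub_ne_zero.2 hz
    rw [dslope_of_ne _ hz, slope_def_field, hPl, hP, cauchyKer]
    field_simp
    ring
  obtain ⟨C, hC0, hC⟩ := hf.exists_bound_ray hσ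
  obtain ⟨D, hD0, hD⟩ := norm_cauchyKer_le h0
  have hmem (r : ℝ) (hr : 0 < r) (θ : ℝ) (hθ : |θ| ≤ σ) :=
    sector_subset_slitPlane le_rfl (ofReal_mul_exp_mem_sector hr (hθ.trans_lt hσ.2) le_rfl)
  have heq : ray (-σ) (dslope P l) = ray σ (dslope P l) := by
    refine ray_eq_ray (by linarith [hσ.1]) (fun r hr θ hθ => ?_) (C := 2 * C + ‖f l‖ * D)
      (ε := min (1 / 2) (‖l‖ / 2)) (K := 2 + 2 * ‖l‖) (lt_min (by norm_num) (by linarith))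
      (fun r hr θ hθ h => ?_)
    · exact hQ.differentiableAt
        (Complex.isOpen_slitPlane.mem_nhds (hmem r hr θ (abs_le_of_mem_Icc hθ)))
    · have hθ' := abs_le_of_mem_Icc hθ
      have hor : r ≤ ‖l‖ / 2 ∨ 2 * ‖l‖ ≤ r := by
        rcases h with h | h
        · exact Or.inl (h.trans (min_le_right _ _))
        · exact Or.inr (by linarith)
      have hne : (r : ℂ) * Complex.exp (θ * Complex.I) ≠ l := by
        intro h'
        rw [← h', norm_ofReal_mul_exp hr] at hor
        rcases hor with h | h <;> linarith
      rw [hform _ hne (hmem r hr θ hθ')]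
      have h1 := norm_div_sub_le (z := (r : ℂ) * Complex.exp (θ * Complex.I)) (l := l)
        (c := f (r * Complex.exp (θ * Complex.I))) hC0 h0
        (by rw [norm_ofReal_mul_exp hr]; exact hC r hr θ hθ')
        (by rw [norm_ofReal_mul_exp hr]; exact hor)
      have h2 := hD (r * Complex.exp (θ * Complex.I)) (by rwa [norm_ofReal_mul_exp hr])
      rw [norm_ofReal_mul_exp hr] at h1 h2
      refine (norm_sub_le _ _).trans ?_
      rw [norm_mul, add_div, mul_div_assoc ‖f l‖]
      gcongr
  have hray (θ : ℝ) (hθ : |θ| = σ) :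
      ray θ (dslope P l) = ray θ (fun z => f z / (z - l)) - f l * ray θ (cauchyKer l) := by
    have hθ' : |θ| < Real.pi := by rw [hθ]; exact hσ.2
    have hne (r : ℝ) (hr : r > 0) : (r : ℂ) * Complex.exp (θ * Complex.I) ≠ l := by
      intro h'
      rw [← h', arg_ofReal_mul_exp hr hθ'] at hl
      linarith
    rw [← ray_const_mul, ← ray_sub_of_integrable (F := fun z => f z / (z - l))
      (G := fun z => f l * cauchyKer l z) (hf.integrableOn_div_sub hθ' h0 hne)
      ((integrableOn_cauchyKer h0 hθ' hne).const_mul _)]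
    refine setIntegral_congr_fun measurableSet_Ioi fun r hr => ?_
    simp only
    rw [hform _ (hne r hr) (hmem r hr θ hθ.le)]
  have a1 := hray (-σ) (by rw [abs_neg, abs_of_pos hσ.1])
  have a2 := hray σ (abs_of_pos hσ.1)
  have a3 := cint_cauchyKer h0 hσ.2 hl
  rw [cint] at a3 ⊢
  linear_combination heq - a1 + a2 + f l * a3

end Cauchy

/-! ### Fubini for two contours -/

section Swap

variable {E : Type*} [NormedAddCommGroup E] [NormedSpace ℂ E]

/-- Integrability of a function of two variables on a product of two rays. -/
def IntegrableRays (θ η : ℝ) (H : ℂ → ℂ → E) : Prop :=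
  Integrable (fun p : ℝ × ℝ => H (p.1 * Complex.exp (θ * Complex.I))
    (p.2 * Complex.exp (η * Complex.I)))
    ((volume.restrict (Ioi (0 : ℝ))).prod (volume.restrict (Ioi (0 : ℝ))))

lemma IntegrableRays.left {θ η : ℝ} {H : ℂ → ℂ → E} (h : IntegrableRays θ η H) :
    IntegrableOn (fun r : ℝ => ray η (H (r * Complex.exp (θ * Complex.I)))) (Ioi 0) :=
  (h.smul (Complex.exp (η * Complex.I))).integral_prod_left

lemma IntegrableRays.right {θ η : ℝ} {H : ℂ → ℂ → E} (h : IntegrableRays θ η H) :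
    IntegrableOn (fun r : ℝ => ray θ (fun z => H z (r * Complex.exp (η * Complex.I)))) (Ioi 0) :=
  (h.smul (Complex.exp (θ * Complex.I))).integral_prod_right

lemma IntegrableRays.swap {θ η : ℝ} {H : ℂ → ℂ → E} (h : IntegrableRays θ η H) :
    ray θ (fun z => ray η (H z)) = ray η (fun w => ray θ (fun z => H z w)) := by
  simp only [ray, ← integral_smul]
  have := integral_integral_swap (f := fun r s : ℝ => Complex.exp (θ * Complex.I) •
    Complex.exp (η * Complex.I) • H (r * Complex.exp (θ * Complex.I))
    (s * Complex.exp (η * Complex.I))) ((h.smul (Complex.exp (η * Complex.I))).smul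
      (Complex.exp (θ * Complex.I)))
  rw [this]
  congr 1
  ext s
  congr 1
  ext r
  rw [smul_comm]

lemma cint_swap {σ τ : ℝ} {H : ℂ → ℂ → E}
    (h : ∀ θ η : ℝ, |θ| = |σ| → |η| = |τ| → IntegrableRays θ η H) :
    cint σ (fun z => cint τ (H z)) = cint τ (fun w => cint σ (fun z => H z w)) := by
  have h1 := h σ τ rfl rfl
  have h2 := h (-σ) τ (abs_neg _) rfl
  have h3 := h σ (-τ) rfl (abs_neg _)
  have h4 := h (-σ) (-τ) (abs_neg _) (abs_neg _)
  simp only [cint]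
  rw [ray_sub_of_integrable (F := fun z => ray (-τ) (H z)) h4.left h2.left,
    ray_sub_of_integrable (F := fun z => ray (-τ) (H z)) h3.left h1.left,
    ray_sub_of_integrable (F := fun w => ray (-σ) (fun z => H z w)) h4.right h3.right,
    ray_sub_of_integrable (F := fun w => ray (-σ) (fun z => H z w)) h2.right h1.right,
    h1.swap, h2.swap, h3.swap, h4.swap]
  abel

end Swap

/-! ### Products of operator-valued Cauchy integrals -/

section CauchyOp

variable {X : Type*} [NormedAddCommGroup X] [NormedSpace ℂ X] {A : X →ₗ.[ℂ] X}

lemma re_ofReal_mul_exp (r θ : ℝ) :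
    ((r : ℂ) * Complex.exp (θ * Complex.I)).re = r * Real.cos θ := by
  rw [Complex.re_ofReal_mul, Complex.exp_ofReal_mul_I_re]

lemma cos_lt_one_of_abs {θ : ℝ} (h0 : 0 < |θ|) (hθ : |θ| < Real.pi) : Real.cos θ < 1 := by
  rw [← Real.cos_abs, ← Real.cos_zero]
  exact Real.cos_lt_cos_of_nonneg_of_le_pi le_rfl hθ.le h0

lemma re_lt_norm_ray {r θ : ℝ} (hr : 0 < r) (h0 : 0 < |θ|) (hθ : |θ| < Real.pi) :
    ((r : ℂ) * Complex.exp (θ * Complex.I)).re < ‖(r : ℂ) * Complex.exp (θ * Complex.I)‖ := by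
  rw [re_ofReal_mul_exp, norm_ofReal_mul_exp hr]
  nlinarith [cos_lt_one_of_abs h0 hθ]

lemma IsZeroSectorial.exists_bound_ray (hA : IsZeroSectorial A) {θ : ℝ} (h0 : 0 < |θ|)
    (hθ : |θ| < Real.pi) : ∃ C : ℝ, 0 ≤ C ∧ ∀ r > (0 : ℝ),
      ‖resolv A (r * Complex.exp (θ * Complex.I))‖ ≤ C / r := by
  obtain ⟨C, hC0, hC⟩ := hA.exists_bound ⟨h0, hθ⟩
  refine ⟨C, hC0, fun r hr => ?_⟩
  have := hC _ (ofReal_mul_exp_ne_zero hr θ) (by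
    rw [re_ofReal_mul_exp, norm_ofReal_mul_exp hr, Real.cos_abs])
  rw [norm_smul, norm_ofReal_mul_exp hr] at this
  rwa [le_div_iff₀ hr, mul_comm]

lemma IsZeroSectorial.continuousOn_ray (hA : IsZeroSectorial A) {θ : ℝ} (h0 : 0 < |θ|)
    (hθ : |θ| < Real.pi) :
    ContinuousOn (fun r : ℝ => resolv A (r * Complex.exp (θ * Complex.I))) (Ioi 0) :=
  continuousOn_comp_ray fun _ hr =>
    (hA.differentiableAt_resolv (re_lt_norm_ray hr h0 hθ)).continuousAt

lemma DecayHol.continuousOn_ray {f : ℂ → ℂ} (hf : DecayHol f) {θ : ℝ} (hθ : |θ| < Real.pi) :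
    ContinuousOn (fun r : ℝ => f (r * Complex.exp (θ * Complex.I))) (Ioi 0) :=
  continuousOn_comp_ray fun _ hr => (hf.differentiableAt (sector_subset_slitPlane le_rfl
    (ofReal_mul_exp_mem_sector hr hθ le_rfl))).continuousAt

lemma DecayHol.exists_bound_ray' {f : ℂ → ℂ} (hf : DecayHol f) {θ : ℝ} (hθ : |θ| < Real.pi) :
    ∃ C : ℝ, 0 ≤ C ∧ ∀ r > (0 : ℝ),
      ‖f (r * Complex.exp (θ * Complex.I))‖ ≤ C * (r / (1 + r ^ 2)) := by
  obtain ⟨C, hC0, hC⟩ := hf.exists_bound_ray (σ := (|θ| + Real.pi) / 2)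
    ⟨by linarith [abs_nonneg θ], by linarith⟩
  exact ⟨C, hC0, fun r hr => hC r hr θ (by linarith)⟩

lemma DecayHol.integrableOn_smul_resolv {f : ℂ → ℂ} (hf : DecayHol f) (hA : IsZeroSectorial A)
    {θ : ℝ} (h0 : 0 < |θ|) (hθ : |θ| < Real.pi) :
    IntegrableOn (fun r : ℝ => f (r * Complex.exp (θ * Complex.I)) •
      resolv A (r * Complex.exp (θ * Complex.I))) (Ioi 0) := by
  obtain ⟨C, hC0, hC⟩ := hf.exists_bound_ray' hθ
  obtain ⟨D, hD0, hD⟩ := hA.exists_bound_ray h0 hθ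
  refine integrableOn_of_bound_outside (C := C * D) (ε := 1) (K := 0)
    ((hf.continuousOn_ray hθ).smul (hA.continuousOn_ray h0 hθ)) one_pos fun r hr _ => ?_
  rw [norm_smul]
  calc _ ≤ (C * (r / (1 + r ^ 2))) * (D / r) := by
        gcongr
        · exact hC r hr
        · exact hD r hr
    _ = C * D / (1 + r ^ 2) := by field_simp

/-- Points on two distinct rays are separated by a multiple of their modulus; this controls the
kernel `1/(m - l)` uniformly in `l`. -/
lemma norm_ray_sub_ray_ge {r s θ η : ℝ} (hr : 0 < r) (hs : 0 < s) :
    (1 - Real.cos (θ - η)) / 2 * r ^ 2 ≤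
      ‖(r : ℂ) * Complex.exp (θ * Complex.I) - s * Complex.exp (η * Complex.I)‖ ^ 2 := by
  have h1 : ‖(r : ℂ) * Complex.exp (θ * Complex.I) - s * Complex.exp (η * Complex.I)‖ ^ 2 =
      r ^ 2 + s ^ 2 - 2 * r * s * Real.cos (θ - η) := by
    rw [← Complex.normSq_eq_norm_sq, Complex.normSq_apply, Complex.sub_re, Complex.sub_im,
      Complex.re_ofReal_mul, Complex.exp_ofReal_mul_I_re, Complex.re_ofReal_mul,
      Complex.exp_ofReal_mul_I_re, Complex.im_ofReal_mul, Complex.exp_ofReal_mul_I_im,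
      Complex.im_ofReal_mul, Complex.exp_ofReal_mul_I_im, Real.cos_sub]
    linear_combination r ^ 2 * Real.sin_sq_add_cos_sq θ + s ^ 2 * Real.sin_sq_add_cos_sq η
  rw [h1]
  have h2 := Real.cos_le_one (θ - η)
  have h3 := Real.neg_one_le_cos (θ - η)
  set c := Real.cos (θ - η)
  nlinarith [mul_nonneg (by linarith : 0 ≤ (1 + c) / 2) (sq_nonneg (r - s)),
    mul_nonneg (mul_nonneg hr.le hs.le) (by linarith : 0 ≤ 1 - c),
    mul_nonneg (by linarith : 0 ≤ (1 - c) / 2) (sq_nonneg s)]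

lemma cos_sub_lt_one {θ η σ τ : ℝ} (hσ : σ ∈ Ioo 0 τ) (hτ : τ < Real.pi) (hθ : |θ| = τ)
    (hη : |η| = σ) : Real.cos (θ - η) < 1 := by
  have h1 := hσ.1
  have h2 := hσ.2
  have h3 : 0 < |θ - η| := by
    rw [abs_pos, sub_ne_zero]
    rintro rfl
    linarith
  have h4 : |θ - η| < 2 * Real.pi := (abs_sub θ η).trans_lt (by linarith)
  refine lt_of_le_of_ne (Real.cos_le_one _) fun h => ?_
  rw [abs_lt] at h4
  rw [Real.cos_eq_one_iff_of_lt_of_lt h4.1 h4.2] at h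
  rw [h, abs_zero] at h3
  exact lt_irrefl _ h3

/-- The factor `|m|` from the decay of `g` is absorbed by `|m - l| ≥ c|m|`, and the factor `|l|`
from `f` by `‖R(l)‖ ≤ D/|l|`. What remains is a product of two functions `1/(1 + r²)`. -/
lemma integrableRays_mul {f g : ℂ → ℂ} (hf : DecayHol f) (hg : DecayHol g)
    (hA : IsZeroSectorial A) {θ η σ τ : ℝ} (hσ : σ ∈ Ioo 0 τ) (hτ : τ < Real.pi)
    (hθ : |θ| = τ) (hη : |η| = σ) :
    IntegrableRays θ η (fun m l => (g m * f l / (m - l)) • resolv A l) := by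
  have hθ' : |θ| < Real.pi := by rwa [hθ]
  have hη' : |η| < Real.pi := by rw [hη]; exact hσ.2.trans hτ
  have hη0 : 0 < |η| := by rw [hη]; exact hσ.1
  obtain ⟨C, hC0, hC⟩ := hf.exists_bound_ray' hη'
  obtain ⟨G, hG0, hG⟩ := hg.exists_bound_ray' hθ'
  obtain ⟨D, hD0, hD⟩ := hA.exists_bound_ray hη0 hη'
  have hcos := cos_sub_lt_one hσ hτ hθ hη
  set c := √((1 - Real.cos (θ - η)) / 2) with hc
  have hc0 : 0 < c := Real.sqrt_pos.2 (by linarith)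
  have hlow (r : ℝ) (hr : 0 < r) (s : ℝ) (hs : 0 < s) :
      c * r ≤ ‖(r : ℂ) * Complex.exp (θ * Complex.I) - s * Complex.exp (η * Complex.I)‖ := by
    refine abs_le_of_sq_le_sq' ?_ (norm_nonneg _) |>.2
    rw [mul_pow, hc, Real.sq_sqrt (by linarith)]
    exact norm_ray_sub_ray_ge hr hs
  have hint : Integrable (fun p : ℝ × ℝ => (1 + p.1 ^ 2)⁻¹ * (G / c * (C * D) * (1 + p.2 ^ 2)⁻¹))
      ((volume.restrict (Ioi (0 : ℝ))).prod (volume.restrict (Ioi (0 : ℝ)))) :=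
    Integrable.mul_prod (f := fun r : ℝ => (1 + r ^ 2)⁻¹) integrable_inv_one_add_sq.integrableOn
      (g := fun r : ℝ => G / c * (C * D) * (1 + r ^ 2)⁻¹)
      (integrable_inv_one_add_sq.integrableOn.const_mul _)
  rw [IntegrableRays]
  refine hint.mono' ?_ ?_
  · rw [Measure.prod_restrict]
    apply ContinuousOn.aestronglyMeasurable _ (measurableSet_Ioi.prod measurableSet_Ioi)
    have c1 := (hf.continuousOn_ray hη').comp continuousOn_snd
      (s := Ioi (0 : ℝ) ×ˢ Ioi (0 : ℝ)) (fun p hp => hp.2)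
    have c2 := (hg.continuousOn_ray hθ').comp continuousOn_fst
      (s := Ioi (0 : ℝ) ×ˢ Ioi (0 : ℝ)) (fun p hp => hp.1)
    have c3 := (hA.continuousOn_ray hη0 hη').comp continuousOn_snd
      (s := Ioi (0 : ℝ) ×ˢ Ioi (0 : ℝ)) (fun p hp => hp.2)
    refine ContinuousOn.smul (ContinuousOn.div (c2.mul c1) (by fun_prop) fun p hp => ?_) c3
    rw [← norm_pos_iff]
    exact lt_of_lt_of_le (mul_pos hc0 hp.1) (hlow p.1 hp.1 p.2 hp.2)
  · rw [Measure.prod_restrict]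
    filter_upwards [ae_restrict_mem (measurableSet_Ioi.prod measurableSet_Ioi)] with p hp
    have hp1 : 0 < p.1 := hp.1
    have hp2 : 0 < p.2 := hp.2
    rw [norm_smul, norm_div, norm_mul]
    calc _ ≤ ((G * (p.1 / (1 + p.1 ^ 2))) * (C * (p.2 / (1 + p.2 ^ 2))) / (c * p.1)) *
          (D / p.2) := by
          gcongr
          · exact hG _ hp1
          · exact hC _ hp2
          · exact hlow _ hp1 _ hp2
          · exact hD _ hp2
      _ = _ := by field_simp

lemma DecayHol.mul_ray {g : ℂ → ℂ} (hg : DecayHol g) (hA : IsZeroSectorial A) (T : X →L[ℂ] X)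
    {θ : ℝ} (h0 : 0 < |θ|) (hθ : |θ| < Real.pi) :
    T * ray θ (fun l => g l • resolv A l) = ray θ (fun l => g l • (T * resolv A l)) := by
  have hI : Integrable (fun r : ℝ => Complex.exp (θ * Complex.I) •
      (g (r * Complex.exp (θ * Complex.I)) • resolv A (r * Complex.exp (θ * Complex.I))))
      (volume.restrict (Ioi 0)) :=
    Integrable.smul (Complex.exp (θ * Complex.I)) (hg.integrableOn_smul_resolv hA h0 hθ)
  rw [ray, ← integral_const_mul_of_integrable hI]
  simp only [ray, mul_smul_comm]

variable [CompleteSpace X]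

/-- This is the resolvent identity `R(l)R(m) = (R(l) - R(m))/(m - l)`, integrated along the ray. -/
lemma DecayHol.ray_mul_resolv {f : ℂ → ℂ} (hf : DecayHol f) (hA : IsZeroSectorial A)
    {θ : ℝ} (h0 : 0 < |θ|) (hθ : |θ| < Real.pi) {m : ℂ} (hm0 : m ≠ 0) (hm : |θ| < |m.arg|) :
    ray θ (fun l => f l • resolv A l) * resolv A m =
      ray θ (fun l => (f l / (m - l)) • resolv A l) - ray θ (fun l => f l / (m - l)) • resolv A m := by
  have hne (r : ℝ) (hr : r > 0) : (r : ℂ) * Complex.exp (θ * Complex.I) ≠ m := by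
    intro h'
    rw [← h', arg_ofReal_mul_exp hr hθ] at hm
    linarith
  have hmre : m.re < ‖m‖ := by
    rw [← Complex.norm_mul_cos_arg]
    have := cos_lt_one_of_abs (h0.trans hm)
    rcases eq_or_lt_of_le (Complex.abs_arg_le_pi m) with h | h
    · rw [← Real.cos_abs, h, Real.cos_pi]
      linarith [norm_pos_iff.2 hm0]
    · nlinarith [this h, norm_pos_iff.2 hm0]
  have hI := hf.integrableOn_smul_resolv hA h0 hθ
  have hI2 : IntegrableOn (fun r : ℝ => f (r * Complex.exp (θ * Complex.I)) /
      (m - r * Complex.exp (θ * Complex.I))) (Ioi 0) := by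
    have := (hf.integrableOn_div_sub hθ hm0 hne).neg
    refine this.congr (Eventually.of_forall fun r => ?_)
    simp only [Pi.neg_apply]
    rw [← neg_sub m, div_neg, neg_neg]
  have hptw (r : ℝ) (hr : r ∈ Ioi (0 : ℝ)) :
      (Complex.exp (θ * Complex.I) • (f (r * Complex.exp (θ * Complex.I)) •
        resolv A (r * Complex.exp (θ * Complex.I)))) * resolv A m =
      Complex.exp (θ * Complex.I) • ((f (r * Complex.exp (θ * Complex.I)) /
        (m - r * Complex.exp (θ * Complex.I))) • resolv A (r * Complex.exp (θ * Complex.I))) -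
      (Complex.exp (θ * Complex.I) • (f (r * Complex.exp (θ * Complex.I)) /
        (m - r * Complex.exp (θ * Complex.I)))) • resolv A m := by
    have h1 := (isResolventAt_resolv (hA.notMem_spectrum (re_lt_norm_ray hr h0 hθ))).sub_eq
      (isResolventAt_resolv (hA.notMem_spectrum hmre))
    have h2 := sub_ne_zero.2 (hne r hr).symm
    rw [smul_mul_assoc, smul_mul_assoc, smul_assoc, ← smul_sub, ← smul_sub, h1,
      smul_smul (f _ / _), div_mul_cancel₀ _ h2]
  -- Integrability of this piece needs no estimate: it is the sum of the other two terms of `hptw`,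
  -- both integrable.
  have hI3 : IntegrableOn (fun r : ℝ => Complex.exp (θ * Complex.I) •
      ((f (r * Complex.exp (θ * Complex.I)) / (m - r * Complex.exp (θ * Complex.I))) •
        resolv A (r * Complex.exp (θ * Complex.I)))) (Ioi 0) := by
    have h4 : Integrable (fun r : ℝ => (Complex.exp (θ * Complex.I) •
        (f (r * Complex.exp (θ * Complex.I)) •
        resolv A (r * Complex.exp (θ * Complex.I)))) * resolv A m) (volume.restrict (Ioi 0)) :=
      Integrable.mul_const (Integrable.smul (Complex.exp (θ * Complex.I)) hI) (resolv A m)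
    have h5 : Integrable (fun r : ℝ => (Complex.exp (θ * Complex.I) •
        (f (r * Complex.exp (θ * Complex.I)) /
        (m - r * Complex.exp (θ * Complex.I)))) • resolv A m) (volume.restrict (Ioi 0)) :=
      Integrable.smul_const (Integrable.smul (Complex.exp (θ * Complex.I)) hI2) (resolv A m)
    refine (Integrable.sub h4 h5.neg).congr ?_
    filter_upwards [ae_restrict_mem measurableSet_Ioi] with r hr
    simp only [Pi.sub_apply, Pi.neg_apply]
    rw [hptw r hr, sub_neg_eq_add, sub_add_cancel]
  have hI' : Integrable (fun r : ℝ => Complex.exp (θ * Complex.I) •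
      (f (r * Complex.exp (θ * Complex.I)) • resolv A (r * Complex.exp (θ * Complex.I))))
      (volume.restrict (Ioi 0)) := Integrable.smul (Complex.exp (θ * Complex.I)) hI
  rw [ray, ← integral_mul_const_of_integrable hI', setIntegral_congr_fun measurableSet_Ioi hptw]
  have h5 : IntegrableOn (fun r : ℝ => (Complex.exp (θ * Complex.I) •
        (f (r * Complex.exp (θ * Complex.I)) /
        (m - r * Complex.exp (θ * Complex.I)))) • resolv A m) (Ioi 0) :=
      Integrable.smul_const (Integrable.smul (Complex.exp (θ * Complex.I)) hI2) (resolv A m)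
  rw [integral_sub hI3 h5, integral_smul_const]
  rfl

lemma DecayHol.cint_mul_resolv {f : ℂ → ℂ} (hf : DecayHol f) (hA : IsZeroSectorial A)
    {σ : ℝ} (hσ : σ ∈ Ioo 0 Real.pi) {m : ℂ} (hm0 : m ≠ 0) (hm : σ < |m.arg|) :
    cint σ (fun l => f l • resolv A l) * resolv A m =
      cint σ (fun l => (f l / (m - l)) • resolv A l) := by
  have h1 := hf.cint_div_sub_eq_zero hσ hm0 hm
  have e1 : |σ| = σ := abs_of_pos hσ.1
  have e2 : |-σ| = σ := by rw [abs_neg, e1]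
  rw [cint, sub_mul, hf.ray_mul_resolv hA (e2.symm ▸ hσ.1) (e2.symm ▸ hσ.2) hm0 (e2.symm ▸ hm),
    hf.ray_mul_resolv hA (e1.symm ▸ hσ.1) (e1.symm ▸ hσ.2) hm0 (e1.symm ▸ hm), sub_sub_sub_comm,
    ← sub_smul]
  rw [cint] at h1
  rw [h1, zero_smul, sub_zero, cint]

lemma cint_congr {E : Type*} [NormedAddCommGroup E] [NormedSpace ℂ E] {σ : ℝ} {F G : ℂ → E}
    (h : ∀ r > (0 : ℝ), ∀ θ : ℝ, |θ| = |σ| → F (r * Complex.exp (θ * Complex.I)) =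
      G (r * Complex.exp (θ * Complex.I))) : cint σ F = cint σ G := by
  rw [cint, cint]
  congr 1
  · refine setIntegral_congr_fun measurableSet_Ioi fun r hr => ?_
    rw [h r hr _ (abs_neg _)]
  · refine setIntegral_congr_fun measurableSet_Ioi fun r hr => ?_
    rw [h r hr _ rfl]

lemma cint_const_smul {E : Type*} [NormedAddCommGroup E] [NormedSpace ℂ E] {σ : ℝ} (c : ℂ)
    (F : ℂ → E) : cint σ (fun z => c • F z) = c • cint σ F := by
  simp only [cint, ray, smul_comm _ c, integral_smul, smul_sub]

lemma cint_smul_const {E : Type*} [NormedAddCommGroup E] [NormedSpace ℂ E] [CompleteSpace E]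
    {σ : ℝ} (F : ℂ → ℂ) (x : E) : cint σ (fun z => F z • x) = cint σ F • x := by
  simp only [cint, ray, ← smul_assoc, integral_smul_const, sub_smul]

/-- Multiplicativity of the Cauchy integrals, over contours one inside the other. -/
theorem DecayHol.cauchyOp_mul {f g : ℂ → ℂ} (hf : DecayHol f) (hg : DecayHol g)
    (hA : IsZeroSectorial A) {σ τ : ℝ} (hσ : σ ∈ Ioo 0 τ) (hτ : τ < Real.pi) :
    cauchyOp A σ f * cauchyOp A τ g = cauchyOp A σ (fun l => f l * g l) := by
  have hσ' : σ ∈ Ioo 0 Real.pi := ⟨hσ.1, hσ.2.trans hτ⟩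
  have hτ0 : 0 < τ := hσ.1.trans hσ.2
  have e1 : |σ| = σ := abs_of_pos hσ.1
  have t1 : |τ| = τ := abs_of_pos hτ0
  have t2 : |-τ| = τ := by rw [abs_neg, t1]
  simp only [cauchyOp_eq_cint]
  set κ : ℂ := 2 * Real.pi * Complex.I with hκ
  have hκ0 : κ ≠ 0 := Complex.two_pi_I_ne_zero
  -- Every `m` on the outer contour lies outside the inner one, so the `R(m)` term of the resolvent
  -- identity integrates to zero.
  have s1 : cint σ (fun l => f l • resolv A l) * cint τ (fun m => g m • resolv A m) =
      cint τ (fun m => cint σ (fun l => (g m * f l / (m - l)) • resolv A l)) := by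
    calc _ = cint τ (fun m => g m • (cint σ (fun l => f l • resolv A l) * resolv A m)) := by
          set T := cint σ (fun l => f l • resolv A l)
          change T * (ray (-τ) _ - ray τ _) = ray (-τ) _ - ray τ _
          rw [mul_sub, hg.mul_ray hA _ (t2.symm ▸ hτ0) (t2.symm ▸ hτ),
            hg.mul_ray hA _ (t1.symm ▸ hτ0) (t1.symm ▸ hτ)]
      _ = _ := by
          refine cint_congr fun r hr θ hθ => ?_
          rw [t1] at hθ
          rw [hf.cint_mul_resolv hA hσ' (ofReal_mul_exp_ne_zero hr θ)
            (by rw [arg_ofReal_mul_exp hr (hθ.symm ▸ hτ), hθ]; exact hσ.2), ← cint_const_smul]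
          simp only [smul_smul, mul_div_assoc]
  -- After the exchange of integrals, `l` lies inside the outer contour and Cauchy's formula
  -- produces `2πi g(l)`.
  have s2 : cint σ (fun l => cint τ (fun m => (g m * f l / (m - l)) • resolv A l)) =
      cint σ (fun l => κ • ((f l * g l) • resolv A l)) := by
    refine cint_congr fun r hr θ hθ => ?_
    rw [e1] at hθ
    rw [cint_smul_const, smul_smul]
    congr 1
    have := hg.cint_div_sub ⟨hτ0, hτ⟩ (ofReal_mul_exp_ne_zero hr θ)
      (by rw [arg_ofReal_mul_exp hr (hθ.symm ▸ hσ'.2), hθ]; exact hσ.2)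
    rw [← hκ] at this
    calc _ = cint τ (fun m => f (r * Complex.exp (θ * Complex.I)) •
          (g m / (m - r * Complex.exp (θ * Complex.I)))) := by
          congr 1
          ext m
          rw [smul_eq_mul]
          ring
      _ = _ := by
          rw [cint_const_smul, this, smul_eq_mul]
          ring
  rw [smul_mul_smul_comm, s1, cint_swap (fun θ η hθ hη => integrableRays_mul hf hg hA hσ hτ
    (hθ.trans t1) (hη.trans e1)), s2, cint_const_smul, smul_smul]
  congr 1
  field_simp

end CauchyOp

/-! ### Bounded holomorphic functions and their regularization by `ρ` -/

lemma norm_one_add_sq_ge {w : ℝ} (hw : w ∈ Ioo 0 Real.pi) {z : ℂ} (hz : z ∈ sector w) :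
    (1 + Real.cos w) / 2 * (1 + ‖z‖ ^ 2) ≤ ‖1 + z‖ ^ 2 := by
  have h1 : ‖1 + z‖ ^ 2 = 1 + ‖z‖ ^ 2 + 2 * z.re := by
    rw [← Complex.normSq_eq_norm_sq, ← Complex.normSq_eq_norm_sq, Complex.normSq_apply,
      Complex.normSq_apply]
    simp
    ring
  have h2 := closure_sector_subset hw (subset_closure hz)
  rw [mem_ofPred_eq] at h2
  have h3 := Real.cos_le_one w
  have h4 := Real.neg_one_le_cos w
  rw [h1]
  nlinarith [mul_nonneg (by linarith : 0 ≤ (1 - Real.cos w) / 2) (sq_nonneg (1 - ‖z‖)),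
    mul_nonneg (norm_nonneg z) (by linarith : 0 ≤ 1 + Real.cos w)]

lemma IsHInf.decayHol {f : ℂ → ℂ} (hf : IsHInf f) : DecayHol (fun l => rho l * f l) where
  diff := by
    refine DifferentiableOn.mul ?_ hf.1
    refine DifferentiableOn.div (by fun_prop) (by fun_prop) fun z hz => ?_
    exact pow_ne_zero 2 (one_add_ne_zero_of_mem_slitPlane hz)
  bound := by
    intro w hw
    obtain ⟨C, hC⟩ := hf.2 w hw
    have hc : 0 < 1 + Real.cos w := by
      have := Real.cos_lt_cos_of_nonneg_of_le_pi hw.1.le le_rfl hw.2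
      rw [Real.cos_pi] at this
      linarith
    refine ⟨|C| * (2 / (1 + Real.cos w)), by positivity, fun z hz => ?_⟩
    have h1 := norm_one_add_sq_ge hw hz
    have h2 : 0 < ‖1 + z‖ ^ 2 := lt_of_lt_of_le (by positivity) h1
    rw [norm_mul, rho, norm_div, norm_pow]
    calc ‖z‖ / ‖1 + z‖ ^ 2 * ‖f z‖
        ≤ ‖z‖ / ((1 + Real.cos w) / 2 * (1 + ‖z‖ ^ 2)) * |C| := by
          gcongr
          exact (hC z hz).trans (le_abs_self C)
      _ = _ := by field_simp

lemma isHInf_const (c : ℂ) : IsHInf fun _ => c :=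
  ⟨by fun_prop, fun _ _ => ⟨‖c‖, fun _ _ => le_rfl⟩⟩

lemma decayHol_rho : DecayHol rho := by
  simpa using (isHInf_const 1).decayHol

lemma IsHInf.mul {f g : ℂ → ℂ} (hf : IsHInf f) (hg : IsHInf g) : IsHInf fun l => f l * g l := by
  refine ⟨hf.1.mul hg.1, fun w hw => ?_⟩
  obtain ⟨C, hC⟩ := hf.2 w hw
  obtain ⟨D, hD⟩ := hg.2 w hw
  refine ⟨C * D, fun z hz => ?_⟩
  rw [norm_mul]
  exact mul_le_mul (hC z hz) (hD z hz) (norm_nonneg _) ((norm_nonneg _).trans (hC z hz))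

lemma IsHInf.add {f g : ℂ → ℂ} (hf : IsHInf f) (hg : IsHInf g) : IsHInf fun l => f l + g l := by
  refine ⟨hf.1.add hg.1, fun w hw => ?_⟩
  obtain ⟨C, hC⟩ := hf.2 w hw
  obtain ⟨D, hD⟩ := hg.2 w hw
  exact ⟨C + D, fun z hz => (norm_add_le _ _).trans (add_le_add (hC z hz) (hD z hz))⟩

/-! ### Identification, injectivity and dense range of `ρ(A)` -/

section

variable {X : Type*} [NormedAddCommGroup X] [NormedSpace ℂ X] {A : X →ₗ.[ℂ] X}

/-- `(1 + A)⁻¹`. -/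
def oneRes (A : X →ₗ.[ℂ] X) : X →L[ℂ] X := -resolv A (-1)

lemma IsZeroSectorial.neg_notMem (hA : IsZeroSectorial A) {t : ℝ} (ht : 0 < t) :
    (-(t : ℂ)) ∉ opSpectrum A := by
  apply hA.notMem_spectrum
  simp [abs_of_pos ht]
  linarith

lemma IsZeroSectorial.isResolventAt_neg_one (hA : IsZeroSectorial A) :
    IsResolventAt A (-1) (resolv A (-1)) := by
  apply isResolventAt_resolv
  have := hA.neg_notMem one_pos
  rwa [Complex.ofReal_one] at this

lemma IsZeroSectorial.oneRes_left (hA : IsZeroSectorial A) (x : A.domain) :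
    oneRes A (x + A x) = x := by
  have := hA.isResolventAt_neg_one.2 x
  calc oneRes A (x + A x) = resolv A (-1) ((-1 : ℂ) • (x : X) - A x) := by
        rw [show ((-1 : ℂ) • (x : X) - A x) = -(x + A x) by module, map_neg]
        rfl
    _ = _ := this

lemma IsZeroSectorial.oneRes_right (hA : IsZeroSectorial A) (y : X) :
    ∃ h : oneRes A y ∈ A.domain, oneRes A y + A ⟨oneRes A y, h⟩ = y := by
  obtain ⟨h, e⟩ := hA.isResolventAt_neg_one.1 (-y)
  have h1 : resolv A (-1) (-y) = oneRes A y := by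
    rw [map_neg]
    rfl
  simp only [h1] at h e
  refine ⟨h, ?_⟩
  have : (-1 : ℂ) • oneRes A y - A ⟨oneRes A y, h⟩ = -(oneRes A y + A ⟨oneRes A y, h⟩) := by module
  rw [this] at e
  exact neg_injective e

/-- The operators `t(t + A)⁻¹` are uniformly bounded, tend to `0` on the range of `A` as `t → 0`,
and fix every vector of the kernel. The range being dense, the kernel is trivial. -/
lemma IsZeroSectorial.eq_zero_of_apply_eq_zero (hA : IsZeroSectorial A) (x : A.domain)
    (hx : A x = 0) : (x : X) = 0 := by
  obtain ⟨C, hC0, hC⟩ := hA.exists_bound (θ := Real.pi / 2)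
    ⟨by linarith [Real.pi_pos], by linarith [Real.pi_pos]⟩
  have hbd (t : ℝ) (ht : 0 < t) : ‖(-(t : ℂ)) • resolv A (-(t : ℂ))‖ ≤ C := by
    apply hC
    · simp [ht.ne']
    · simp [ht.le]
  have hfix (t : ℝ) (ht : 0 < t) : ((-(t : ℂ)) • resolv A (-(t : ℂ))) (x : X) = x := by
    have := (isResolventAt_resolv (hA.neg_notMem ht)).2 x
    rwa [hx, sub_zero, map_smul] at this
  have hrange (y : A.domain) (t : ℝ) (ht : 0 < t) :
      ‖((-(t : ℂ)) • resolv A (-(t : ℂ))) (A y)‖ ≤ t * ((1 + C) * ‖(y : X)‖) := by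
    have h1 := (isResolventAt_resolv (hA.neg_notMem ht)).2 y
    rw [map_sub, map_smul] at h1
    have h2 : ((-(t : ℂ)) • resolv A (-(t : ℂ))) (A y) =
        (-(t : ℂ)) • (((-(t : ℂ)) • resolv A (-(t : ℂ))) (y : X) - y) := by
      change (-(t : ℂ)) • resolv A (-(t : ℂ)) (A y) =
        (-(t : ℂ)) • ((-(t : ℂ)) • resolv A (-(t : ℂ)) (y : X) - y)
      rw [sub_eq_iff_eq_add.1 h1, add_sub_cancel_left]
    rw [h2, norm_smul, norm_neg, Complex.norm_real, Real.norm_of_nonneg ht.le]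
    gcongr
    refine (norm_sub_le _ _).trans ?_
    have := (((-(t : ℂ)) • resolv A (-(t : ℂ))).le_opNorm (y : X)).trans
      (mul_le_mul_of_nonneg_right (hbd t ht) (norm_nonneg _))
    linarith
  rw [← norm_le_zero_iff]
  apply le_of_forall_pos_le_add
  intro ε hε
  have hdense := (hA (Real.pi / 2) ⟨by linarith [Real.pi_pos], by linarith [Real.pi_pos]⟩).dense_range
  obtain ⟨-, hy, y, rfl⟩ := Metric.dense_iff.1 hdense (x : X) (ε / (2 * (C + 1))) (by positivity)
  rw [Metric.mem_ball, dist_comm, dist_eq_norm] at hy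
  set t := ε / (2 * ((1 + C) * ‖(y : X)‖ + 1)) with ht
  have ht0 : 0 < t := by positivity
  have h1 : (x : X) = ((-(t : ℂ)) • resolv A (-(t : ℂ))) ((x : X) - A y) +
      ((-(t : ℂ)) • resolv A (-(t : ℂ))) (A y) := by
    rw [← map_add, sub_add_cancel, hfix t ht0]
  have h2 : ‖((-(t : ℂ)) • resolv A (-(t : ℂ))) ((x : X) - A y)‖ ≤ ε / 2 := by
    calc _ ≤ C * (ε / (2 * (C + 1))) :=
          (ContinuousLinearMap.le_opNorm _ _).trans (mul_le_mul (hbd t ht0) hy.le (norm_nonneg _) hC0)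
      _ ≤ (C + 1) * (ε / (2 * (C + 1))) := by gcongr; linarith
      _ = _ := by field_simp
  have h3 : ‖((-(t : ℂ)) • resolv A (-(t : ℂ))) (A y)‖ ≤ ε / 2 := by
    refine (hrange y t ht0).trans ?_
    calc t * ((1 + C) * ‖(y : X)‖) ≤ t * ((1 + C) * ‖(y : X)‖ + 1) := by gcongr; linarith
      _ = _ := by rw [ht]; field_simp
  rw [h1]
  refine (norm_add_le _ _).trans ?_
  linarith

/-- The operator factors as `(1 + A)⁻¹(1 - (1 + A)⁻¹)`, and a vector killed by the second factor
lies in the kernel of `A`. -/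
lemma IsZeroSectorial.oneRes_sub_mul_injective (hA : IsZeroSectorial A) {x : X}
    (hx : (oneRes A - oneRes A * oneRes A) x = 0) : x = 0 := by
  have hinj (y : X) (hy : oneRes A y = 0) : y = 0 := by
    obtain ⟨h, e⟩ := hA.oneRes_right y
    rw [← e]
    have : (⟨oneRes A y, h⟩ : A.domain) = 0 := Subtype.ext hy
    rw [this, A.map_zero, hy, add_zero]
  have h1 : x - oneRes A x = 0 := by
    apply hinj
    rw [map_sub]
    exact hx
  have h2 : oneRes A x = x := (sub_eq_zero.1 h1).symm
  obtain ⟨h, e⟩ := hA.oneRes_right x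
  have h3 : A ⟨oneRes A x, h⟩ = 0 := by
    rw [eq_sub_of_add_eq' e, h2, sub_self]
  have := hA.eq_zero_of_apply_eq_zero _ h3
  rw [← h2]
  exact this

/-- In the same factorization the ranges of the factors contain the domain and the range of `A`: the
second sends `x + Ax` to `Ax`. -/
lemma IsZeroSectorial.oneRes_sub_mul_denseRange (hA : IsZeroSectorial A) :
    DenseRange (oneRes A - oneRes A * oneRes A) := by
  have hS := hA (Real.pi / 2) ⟨by linarith [Real.pi_pos], by linarith [Real.pi_pos]⟩
  have h1 : DenseRange (oneRes A) := hS.dense_domain.mono fun x hx => ⟨x + A ⟨x, hx⟩,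
    hA.oneRes_left ⟨x, hx⟩⟩
  have h2 : DenseRange (fun x : X => x - oneRes A x) := by
    refine hS.dense_range.mono ?_
    rintro - ⟨x, rfl⟩
    refine ⟨x + A x, ?_⟩
    simp only
    rw [hA.oneRes_left]
    abel
  have h3 : ((oneRes A - oneRes A * oneRes A : X →L[ℂ] X) : X → X) = oneRes A ∘ fun x => x - oneRes A x := by
    ext x
    simp only [Function.comp, map_sub]
    rfl
  change DenseRange ((oneRes A - oneRes A * oneRes A : X →L[ℂ] X) : X → X)
  rw [h3]
  exact h1.comp h2 (oneRes A).continuous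

/-- The integrand left after subtracting the polar part of `rho l • resolv A l` at `-1`. -/
def polarRemainder (A : X →ₗ.[ℂ] X) (l : ℂ) : X →L[ℂ] X :=
  l • (resolv A l * oneRes A * oneRes A) - (l / (l - 1)) • (oneRes A - oneRes A * oneRes A) -
    ((2 : ℂ) • (oneRes A * oneRes A) - oneRes A)

/-- The resolvent identity between `l` and `-1`, used twice: an expansion at `-1` to the order of
the double pole of `ρ`. -/
lemma IsZeroSectorial.resolv_eq (hA : IsZeroSectorial A) {l : ℂ} (hl : l.re < ‖l‖) :
    resolv A l = (1 + l) ^ 2 • (resolv A l * oneRes A * oneRes A) -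
      (1 + l) • (oneRes A * oneRes A) - oneRes A := by
  have h1 := (isResolventAt_resolv (hA.notMem_spectrum hl)).sub_eq
    (isResolventAt_resolv (hA.neg_notMem one_pos))
  rw [Complex.ofReal_one] at h1
  have h2 : resolv A l = (1 + l) • (resolv A l * oneRes A) - oneRes A := by
    rw [oneRes, mul_neg, smul_neg, ← neg_smul, neg_add', ← h1]
    abel
  calc resolv A l = (1 + l) • (resolv A l * oneRes A) - oneRes A := h2
    _ = (1 + l) • (((1 + l) • (resolv A l * oneRes A) - oneRes A) * oneRes A) - oneRes A := by
        rw [← h2]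
        exact h2
    _ = _ := by rw [sub_mul, smul_mul_assoc]; module

/-- The double pole of `ρ(l)R(l)` at `-1` is removed by two scalar functions times fixed operators.
Their contour integrals are known, so no residue at `-1` is computed. -/
lemma IsZeroSectorial.polarRemainder_eq (hA : IsZeroSectorial A) {l : ℂ} (hl : l.re < ‖l‖)
    (hl' : 1 + l ≠ 0) : polarRemainder A l = rho l • resolv A l -
      (4 * (rho l / (l - 1))) • (oneRes A - oneRes A * oneRes A) -
      (1 / (1 + l) ^ 2) • ((2 : ℂ) • (oneRes A * oneRes A) - oneRes A) := by
  have h1 : l - 1 ≠ 0 := by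
    rw [sub_ne_zero]
    rintro rfl
    simp at hl
  rw [polarRemainder]
  have h2 := hA.resolv_eq hl
  set Q := resolv A l * oneRes A * oneRes A
  rw [h2, rho]
  generalize oneRes A * oneRes A = B2
  match_scalars <;> field_simp <;> ring

lemma IsZeroSectorial.differentiableAt_polarRemainder (hA : IsZeroSectorial A) {l : ℂ}
    (hl : l.re < ‖l‖) : DifferentiableAt ℂ (polarRemainder A) l := by
  have h1 : l - 1 ≠ 0 := by
    rw [sub_ne_zero]
    rintro rfl
    simp at hl
  have h2 := hA.differentiableAt_resolv hl
  have h3 : DifferentiableAt ℂ (fun l : ℂ => l / (l - 1)) l :=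
    DifferentiableAt.div (by fun_prop) (by fun_prop) h1
  unfold polarRemainder
  exact ((differentiableAt_id.smul ((h2.mul_const _).mul_const _)).sub
    (h3.smul_const _)).sub_const _

lemma cos_le_of_mem_Icc {σ θ : ℝ} (hσ : 0 < σ) (hθ : θ ∈ Icc σ (2 * Real.pi - σ)) :
    Real.cos θ ≤ Real.cos σ := by
  rcases le_total θ Real.pi with h | h
  · exact Real.cos_le_cos_of_nonneg_of_le_pi hσ.le h hθ.1
  · rw [← Real.cos_two_pi_sub θ]
    exact Real.cos_le_cos_of_nonneg_of_le_pi hσ.le (by linarith) (by linarith [hθ.2])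

lemma norm_div_one_add_sq_le {c : ℂ → ℝ} {M : ℝ} (hM : 0 ≤ M) {z : ℂ} (hc : c z ≤ M)
    (h : ‖z‖ ≤ 1 / 2 ∨ 2 ≤ ‖z‖) : ‖1 / (1 + z) ^ 2‖ * c z ≤ 9 * M / (1 + ‖z‖ ^ 2) := by
  have h1 := norm_one_add_ge h
  have h0 := norm_nonneg z
  have h2 : (1 + ‖z‖ ^ 2) / 9 ≤ ‖1 + z‖ ^ 2 := by
    have : ((1 + ‖z‖) / 3) ^ 2 ≤ ‖1 + z‖ ^ 2 := by gcongr
    nlinarith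
  have h3 : 0 < ‖1 + z‖ ^ 2 := lt_of_lt_of_le (by positivity) h2
  rw [norm_div, norm_one, norm_pow]
  calc 1 / ‖1 + z‖ ^ 2 * c z ≤ 1 / ‖1 + z‖ ^ 2 * M := by gcongr
    _ ≤ 1 / ((1 + ‖z‖ ^ 2) / 9) * M := by gcongr
    _ = _ := by field_simp

variable [CompleteSpace X]

/-- The remainder is holomorphic off `[0, ∞)`, including at `-1`, so the ray of angle `σ` can be
rotated through the negative axis to angle `2π - σ`, which is the ray of angle `-σ`. Near `0` the
defining form of the remainder is estimated, near `∞` the form with the factor `(1 + z)⁻²`. -/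
lemma IsZeroSectorial.cint_polarRemainder (hA : IsZeroSectorial A) {σ : ℝ}
    (hσ : σ ∈ Ioo 0 Real.pi) : cint σ (polarRemainder A) = 0 := by
  obtain ⟨C, hC0, hC⟩ := hA.exists_bound hσ
  have hre (r : ℝ) (hr : 0 < r) (θ : ℝ) (hθ : θ ∈ Icc σ (2 * Real.pi - σ)) :
      ((r : ℂ) * Complex.exp (θ * Complex.I)).re ≤
        ‖(r : ℂ) * Complex.exp (θ * Complex.I)‖ * Real.cos σ := by
    rw [re_ofReal_mul_exp, norm_ofReal_mul_exp hr]
    gcongr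
    exact cos_le_of_mem_Icc hσ.1 hθ
  have hcσ : Real.cos σ < 1 := cos_lt_one_of_abs (abs_pos.2 hσ.1.ne') (by
    rw [abs_of_pos hσ.1]; exact hσ.2)
  have hre' (r : ℝ) (hr : 0 < r) (θ : ℝ) (hθ : θ ∈ Icc σ (2 * Real.pi - σ)) :
      ((r : ℂ) * Complex.exp (θ * Complex.I)).re <
        ‖(r : ℂ) * Complex.exp (θ * Complex.I)‖ := by
    refine (hre r hr θ hθ).trans_lt ?_
    rw [norm_ofReal_mul_exp hr]
    nlinarith
  set D := oneRes A - oneRes A * oneRes A with hD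
  set c0 := (2 : ℂ) • (oneRes A * oneRes A) - oneRes A with hc0
  set M := C + 8 * ‖D‖ + ‖c0‖ with hM
  have hM0 : 0 ≤ M := by positivity
  have hsmall (z : ℂ) (h0 : z ≠ 0) (hz : z.re ≤ ‖z‖ * Real.cos σ) (h : ‖z‖ ≤ 1 / 2) :
      ‖polarRemainder A z‖ ≤ 2 * (C * ‖oneRes A‖ * ‖oneRes A‖ + ‖D‖ + ‖c0‖) / (1 + ‖z‖ ^ 2) := by
    have e1 : ‖z • (resolv A z * oneRes A * oneRes A)‖ ≤ C * ‖oneRes A‖ * ‖oneRes A‖ := by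
      rw [← smul_mul_assoc, ← smul_mul_assoc]
      refine (norm_mul_le _ _).trans ?_
      gcongr
      refine (norm_mul_le _ _).trans ?_
      gcongr
      exact hC z h0 hz
    have e2 : ‖(z / (z - 1)) • D‖ ≤ ‖D‖ := by
      have h4 : 1 / 2 ≤ ‖z - 1‖ := by
        have := norm_sub_norm_le (1 : ℂ) z
        rw [norm_one, norm_sub_rev] at this
        linarith
      rw [norm_smul, norm_div]
      have : ‖z‖ / ‖z - 1‖ ≤ 1 := by
        rw [div_le_one (by linarith)]
        linarith
      nlinarith [norm_nonneg D]
    have e3 : ‖polarRemainder A z‖ ≤ C * ‖oneRes A‖ * ‖oneRes A‖ + ‖D‖ + ‖c0‖ :=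
      (norm_sub_le _ _).trans (add_le_add ((norm_sub_le _ _).trans (add_le_add e1 e2)) le_rfl)
    rw [le_div_iff₀ (by positivity)]
    have : 0 ≤ C * ‖oneRes A‖ * ‖oneRes A‖ + ‖D‖ + ‖c0‖ := by positivity
    have h5 : 1 + ‖z‖ ^ 2 ≤ 2 := by nlinarith [norm_nonneg z]
    calc _ ≤ (C * ‖oneRes A‖ * ‖oneRes A‖ + ‖D‖ + ‖c0‖) * 2 := by gcongr
      _ = _ := by ring
  have hlarge (z : ℂ) (h0 : z.re < ‖z‖) (hz : z.re ≤ ‖z‖ * Real.cos σ) (h : 2 ≤ ‖z‖) :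
      ‖polarRemainder A z‖ ≤ 9 * M / (1 + ‖z‖ ^ 2) := by
    have hz0 : z ≠ 0 := norm_pos_iff.1 (by linarith)
    have h1 : 1 + z ≠ 0 := norm_pos_iff.1 (lt_of_lt_of_le (by positivity) (norm_one_add_ge (Or.inr h)))
    have h4 : ‖z‖ / 2 ≤ ‖z - 1‖ := by
      have := norm_sub_norm_le z 1
      rw [norm_one] at this
      linarith
    have e : polarRemainder A z = (1 / (1 + z) ^ 2) •
        (z • resolv A z - (4 * (z / (z - 1))) • D - c0) := by
      rw [hA.polarRemainder_eq h0 h1, rho]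
      match_scalars <;> field_simp
    rw [e, norm_smul]
    refine norm_div_one_add_sq_le (c := fun z => ‖z • resolv A z - (4 * (z / (z - 1))) • D - c0‖)
      hM0 ?_ (Or.inr h)
    refine (norm_sub_le _ _).trans (add_le_add ((norm_sub_le _ _).trans
      (add_le_add (hC z hz0 hz) ?_)) le_rfl)
    rw [norm_smul]
    gcongr
    rw [norm_mul, norm_div, Complex.norm_ofNat]
    have : ‖z‖ / ‖z - 1‖ ≤ 2 := by
      rw [div_le_iff₀ (by linarith)]
      linarith
    linarith
  have hray : ray σ (polarRemainder A) = ray (2 * Real.pi - σ) (polarRemainder A) := by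
    refine ray_eq_ray (by linarith [hσ.2]) (fun r hr θ hθ =>
      hA.differentiableAt_polarRemainder (hre' r hr θ hθ))
      (C := max (2 * (C * ‖oneRes A‖ * ‖oneRes A‖ + ‖D‖ + ‖c0‖)) (9 * M)) (ε := 1 / 2) (K := 2)
      (by norm_num) (fun r hr θ hθ h => ?_)
    have hn := norm_ofReal_mul_exp hr θ
    rcases h with h | h
    · have := hsmall _ (ofReal_mul_exp_ne_zero hr θ) (hre r hr θ hθ) (by rwa [hn])
      rw [hn] at this
      exact this.trans (by gcongr; exact le_max_left _ _)
    · have := hlarge _ (hre' r hr θ hθ) (hre r hr θ hθ) (by rwa [hn])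
      rw [hn] at this
      exact this.trans (by gcongr; exact le_max_right _ _)
  have hexp : Complex.exp (((2 * Real.pi - σ : ℝ) : ℂ) * Complex.I) =
      Complex.exp (((-σ : ℝ) : ℂ) * Complex.I) := by
    rw [Complex.exp_eq_exp_iff_exists_int]
    exact ⟨1, by push_cast; ring⟩
  rw [cint, hray, sub_eq_zero, ray, ray, hexp]

lemma cint_one_div_one_add_sq {σ : ℝ} (hσ : σ ∈ Ioo 0 Real.pi) :
    cint σ (fun l => 1 / (1 + l) ^ 2) = 0 := by
  rw [cint, sub_eq_zero]
  refine ray_eq_ray (by linarith [hσ.1]) (fun r hr θ hθ => ?_) (C := 9 * 1) (ε := 1 / 2) (K := 2)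
    (by norm_num) (fun r hr θ hθ h => ?_)
  · have h1 := one_add_ne_zero_of_mem_slitPlane (sector_subset_slitPlane le_rfl
      (ofReal_mul_exp_mem_sector hr ((abs_le_of_mem_Icc hθ).trans_lt hσ.2) le_rfl))
    exact DifferentiableAt.div (by fun_prop) (by fun_prop) (pow_ne_zero 2 h1)
  · have := norm_div_one_add_sq_le (c := fun _ => 1) (M := 1) (by norm_num)
      (z := r * Complex.exp (θ * Complex.I)) le_rfl (by rwa [norm_ofReal_mul_exp hr])
    rwa [norm_ofReal_mul_exp hr, mul_one] at this

lemma integrableOn_one_div_one_add_sq {θ : ℝ} (hθ : |θ| < Real.pi) :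
    IntegrableOn (fun r : ℝ => 1 / (1 + (r : ℂ) * Complex.exp (θ * Complex.I)) ^ 2) (Ioi 0) := by
  refine integrableOn_of_bound_outside (C := 9 * 1) (ε := 1 / 2) (K := 2)
    (continuousOn_comp_ray (G := fun z => 1 / (1 + z) ^ 2) fun r hr => ?_) (by norm_num)
    fun r hr h => ?_
  · have h1 := one_add_ne_zero_of_mem_slitPlane (sector_subset_slitPlane le_rfl
      (ofReal_mul_exp_mem_sector hr hθ le_rfl))
    exact ContinuousAt.div (by fun_prop) (by fun_prop) (pow_ne_zero 2 h1)
  · have := norm_div_one_add_sq_le (c := fun _ => 1) (M := 1) (by norm_num)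
      (z := r * Complex.exp (θ * Complex.I)) le_rfl (by rwa [norm_ofReal_mul_exp hr])
    rwa [norm_ofReal_mul_exp hr, mul_one] at this

/-- `ρ(A) = (1 + A)⁻¹ - (1 + A)⁻²`. -/
theorem IsZeroSectorial.cauchyOp_rho (hA : IsZeroSectorial A) {σ : ℝ}
    (hσ : σ ∈ Ioo 0 Real.pi) : cauchyOp A σ rho = oneRes A - oneRes A * oneRes A := by
  have hP := hA.cint_polarRemainder hσ
  have h1 : cint σ (fun l => rho l / (l - 1)) = 2 * Real.pi * Complex.I * rho 1 :=
    decayHol_rho.cint_div_sub hσ one_ne_zero (by simpa using hσ.1)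
  have h2 := cint_one_div_one_add_sq hσ
  set D := oneRes A - oneRes A * oneRes A with hD
  set c0 := (2 : ℂ) • (oneRes A * oneRes A) - oneRes A with hc0
  have hray (θ : ℝ) (hθ : |θ| = σ) : ray θ (polarRemainder A) =
      ray θ (fun l => rho l • resolv A l) - ray θ (fun l => (4 * (rho l / (l - 1))) • D) -
        ray θ (fun l => (1 / (1 + l) ^ 2) • c0) := by
    have hθ0 : 0 < |θ| := hθ.symm ▸ hσ.1
    have hθ' : |θ| < Real.pi := hθ.symm ▸ hσ.2
    have hne (r : ℝ) (hr : r > 0) : (r : ℂ) * Complex.exp (θ * Complex.I) ≠ 1 := by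
      intro h'
      have := arg_ofReal_mul_exp hr hθ'
      rw [h', Complex.arg_one] at this
      rw [← this, abs_zero] at hθ0
      exact lt_irrefl _ hθ0
    have i1 := decayHol_rho.integrableOn_smul_resolv hA hθ0 hθ'
    have i2 := decayHol_rho.integrableOn_div_sub hθ' one_ne_zero hne
    have i2' : IntegrableOn (fun r : ℝ => (4 * (rho (r * Complex.exp (θ * Complex.I)) /
      (r * Complex.exp (θ * Complex.I) - 1))) • D) (Ioi 0) := (i2.const_mul 4).smul_const D
    have i3 : IntegrableOn (fun r : ℝ => (1 / (1 + (r : ℂ) * Complex.exp (θ * Complex.I)) ^ 2) • c0)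
      (Ioi 0) := (integrableOn_one_div_one_add_sq hθ').smul_const c0
    rw [← ray_sub_of_integrable i1 (G := fun l => (4 * (rho l / (l - 1))) • D) i2',
      ← ray_sub_of_integrable (F := fun l => rho l • resolv A l - (4 * (rho l / (l - 1))) • D)
        (G := fun l => (1 / (1 + l) ^ 2) • c0) (Integrable.sub i1 i2') i3]
    refine setIntegral_congr_fun measurableSet_Ioi fun r hr => ?_
    simp only
    rw [hA.polarRemainder_eq (re_lt_norm_ray hr hθ0 hθ') (one_add_ne_zero_of_mem_slitPlane
      (sector_subset_slitPlane le_rfl (ofReal_mul_exp_mem_sector hr hθ' le_rfl)))]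
  have e1 : |σ| = σ := abs_of_pos hσ.1
  have e2 : |-σ| = σ := by rw [abs_neg, e1]
  have key : cint σ (fun l => rho l • resolv A l) =
      cint σ (fun l => (4 * (rho l / (l - 1))) • D) + cint σ (fun l => (1 / (1 + l) ^ 2) • c0) := by
    rw [cint, hray _ e1, hray _ e2] at hP
    simp only [cint]
    rw [← sub_eq_zero]
    rw [← hP]
    abel
  rw [cauchyOp_eq_cint, key, cint_smul_const, cint_smul_const, h2, zero_smul, add_zero]
  -- The pole at `1` lies inside the sector, and the factor `4` compensates `ρ(1) = 1/4`, leaving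
  -- exactly `D`.
  have h4 : cint σ (fun l => 4 * (rho l / (l - 1))) = 4 * (2 * Real.pi * Complex.I * rho 1) := by
    rw [← h1, ← smul_eq_mul, ← cint_const_smul]
    rfl
  have h5 : rho 1 = 1 / 4 := by norm_num [rho]
  rw [h4, h5, smul_smul]
  have := Complex.two_pi_I_ne_zero
  rw [show (2 * (Real.pi : ℂ) * Complex.I)⁻¹ * (4 * (2 * Real.pi * Complex.I * (1 / 4))) = 1 by
    field_simp, one_smul]

lemma IsZeroSectorial.cauchyOp_rho_injective (hA : IsZeroSectorial A) {σ : ℝ}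
    (hσ : σ ∈ Ioo 0 Real.pi) : Function.Injective (cauchyOp A σ rho) := by
  rw [hA.cauchyOp_rho hσ, injective_iff_map_eq_zero]
  exact fun x hx => hA.oneRes_sub_mul_injective hx

lemma IsZeroSectorial.cauchyOp_rho_denseRange (hA : IsZeroSectorial A) {σ : ℝ}
    (hσ : σ ∈ Ioo 0 Real.pi) : DenseRange (cauchyOp A σ rho) := by
  rw [hA.cauchyOp_rho hσ]
  exact hA.oneRes_sub_mul_denseRange

end

/-! ### Algebra of the extended holomorphic calculus -/

section HolOp

variable {X : Type*} [NormedAddCommGroup X] [NormedSpace ℂ X] {A : X →ₗ.[ℂ] X}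

lemma ray_add_of_integrable {E : Type*} [NormedAddCommGroup E] [NormedSpace ℂ E] {F G : ℂ → E}
    {θ : ℝ}
    (hF : IntegrableOn (fun r : ℝ => F (r * Complex.exp (θ * Complex.I))) (Ioi 0))
    (hG : IntegrableOn (fun r : ℝ => G (r * Complex.exp (θ * Complex.I))) (Ioi 0)) :
    ray θ (fun z => F z + G z) = ray θ F + ray θ G := by
  simp only [ray, smul_add]
  exact integral_add (Integrable.smul _ hF) (Integrable.smul _ hG)

lemma DecayHol.cauchyOp_add {f g : ℂ → ℂ} (hf : DecayHol f) (hg : DecayHol g)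
    (hA : IsZeroSectorial A) {σ : ℝ} (hσ : σ ∈ Ioo 0 Real.pi) :
    cauchyOp A σ (fun l => f l + g l) = cauchyOp A σ f + cauchyOp A σ g := by
  have e1 : |σ| = σ := abs_of_pos hσ.1
  have e2 : |-σ| = σ := by rw [abs_neg, e1]
  simp only [cauchyOp_eq_cint, cint, add_smul]
  have p1 : 0 < |σ| := by rw [e1]; exact hσ.1
  have p2 : |σ| < Real.pi := by rw [e1]; exact hσ.2
  have q1 : 0 < |-σ| := by rw [e2]; exact hσ.1
  have q2 : |-σ| < Real.pi := by rw [e2]; exact hσ.2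
  rw [ray_add_of_integrable (F := fun l => f l • resolv A l) (G := fun l => g l • resolv A l)
    (hf.integrableOn_smul_resolv hA q1 q2) (hg.integrableOn_smul_resolv hA q1 q2),
    ray_add_of_integrable (F := fun l => f l • resolv A l) (G := fun l => g l • resolv A l)
    (hf.integrableOn_smul_resolv hA p1 p2) (hg.integrableOn_smul_resolv hA p1 p2), ← smul_add]
  congr 1
  abel

lemma cauchyOp_const_mul (c : ℂ) (f : ℂ → ℂ) (σ : ℝ) :
    cauchyOp A σ (fun l => c * f l) = c • cauchyOp A σ f := by
  simp only [cauchyOp_eq_cint, mul_smul]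
  rw [cint_const_smul, smul_comm]

lemma IsHolOp.mul_eq {f : ℂ → ℂ} {T : X →L[ℂ] X} (h : IsHolOp A f T) {σ : ℝ}
    (hσ : σ ∈ Ioo 0 Real.pi) :
    cauchyOp A σ rho * T = cauchyOp A σ (fun l => rho l * f l) := by
  ext x
  exact h σ hσ x

lemma isHolOp_of_mul_eq {f : ℂ → ℂ} {T : X →L[ℂ] X} (h : ∀ σ ∈ Ioo 0 Real.pi,
    cauchyOp A σ rho * T = cauchyOp A σ (fun l => rho l * f l)) : IsHolOp A f T :=
  fun σ hσ x => DFunLike.congr_fun (h σ hσ) x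

lemma IsHolOp.add {f g : ℂ → ℂ} {S T : X →L[ℂ] X} (hS : IsHolOp A f S) (hT : IsHolOp A g T)
    (hf : IsHInf f) (hg : IsHInf g) (hA : IsZeroSectorial A) :
    IsHolOp A (fun l => f l + g l) (S + T) := by
  refine isHolOp_of_mul_eq fun σ hσ => ?_
  simp only [mul_add (rho _)]
  rw [mul_add, hS.mul_eq hσ, hT.mul_eq hσ, hf.decayHol.cauchyOp_add hg.decayHol hA hσ]

lemma IsHolOp.smul {f : ℂ → ℂ} {S : X →L[ℂ] X} (hS : IsHolOp A f S) (c : ℂ) :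
    IsHolOp A (fun l => c * f l) (c • S) := by
  refine isHolOp_of_mul_eq fun σ hσ => ?_
  simp only [mul_left_comm (rho _) c]
  rw [cauchyOp_const_mul, mul_smul_comm, hS.mul_eq hσ]

lemma tendsto_cauchyOp_rho_mul (hA : IsZeroSectorial A) {σ : ℝ} (hσ : σ ∈ Ioo 0 Real.pi)
    {f : ℕ → ℂ → ℂ} (hf : ∀ n, IsHInf (f n)) {M : ℝ}
    (hM : ∀ n, ∀ r > (0 : ℝ), ∀ θ : ℝ, |θ| = σ → ‖f n (r * Complex.exp (θ * Complex.I))‖ ≤ M)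
    (hlim : ∀ z : ℂ, Tendsto (fun n => f n z) atTop (𝓝 1)) :
    Tendsto (fun n => cauchyOp A σ (fun l => rho l * f n l)) atTop (𝓝 (cauchyOp A σ rho)) := by
  have e1 : |σ| = σ := abs_of_pos hσ.1
  have e2 : |-σ| = σ := by rw [abs_neg, e1]
  have hray (θ : ℝ) (hθ : |θ| = σ) :
      Tendsto (fun n => ray θ (fun l => (rho l * f n l) • resolv A l)) atTop
        (𝓝 (ray θ fun l => rho l • resolv A l)) := by
    have h0 : 0 < |θ| := hθ.symm ▸ hσ.1
    have hpi : |θ| < Real.pi := hθ.symm ▸ hσ.2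
    have hI := decayHol_rho.integrableOn_smul_resolv hA h0 hpi
    refine tendsto_integral_of_dominated_convergence
      (fun r => M * ‖rho (r * Complex.exp (θ * Complex.I)) •
        resolv A (r * Complex.exp (θ * Complex.I))‖) (fun n => ?_) (hI.norm.const_mul M)
      (fun n => ?_) (Eventually.of_forall fun r => ?_)
    · exact (((hf n).decayHol.integrableOn_smul_resolv hA h0 hpi).smul
        (Complex.exp (θ * Complex.I))).aestronglyMeasurable
    · filter_upwards [ae_restrict_mem measurableSet_Ioi] with r hr
      have := hM n r hr θ hθ
      rw [norm_smul, Complex.norm_exp_ofReal_mul_I, one_mul, norm_smul, norm_mul, norm_smul,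
        mul_comm (‖rho _‖), mul_assoc]
      gcongr
    · have h1 := ((hlim (r * Complex.exp (θ * Complex.I))).const_mul
        (rho (r * Complex.exp (θ * Complex.I)))).smul_const
          (resolv A (r * Complex.exp (θ * Complex.I)))
      rw [mul_one] at h1
      exact h1.const_smul _
  simp only [cauchyOp_eq_cint, cint]
  exact ((hray _ e2).sub (hray _ e1)).const_smul _

variable [CompleteSpace X]

lemma IsZeroSectorial.rho_mul_cancel (hA : IsZeroSectorial A) {σ : ℝ} (hσ : σ ∈ Ioo 0 Real.pi)
    {S T : X →L[ℂ] X} (h : cauchyOp A σ rho * S = cauchyOp A σ rho * T) : S = T := by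
  ext x
  exact hA.cauchyOp_rho_injective hσ (DFunLike.congr_fun h x)

lemma IsHolOp.unique {f : ℂ → ℂ} {S T : X →L[ℂ] X} (hS : IsHolOp A f S) (hT : IsHolOp A f T)
    (hA : IsZeroSectorial A) : S = T := by
  have h1 : (1 : ℝ) ∈ Ioo 0 Real.pi := ⟨one_pos, by linarith [Real.pi_gt_three]⟩
  exact hA.rho_mul_cancel h1 ((hS.mul_eq h1).trans (hT.mul_eq h1).symm)

/-- Compared after multiplication by the injective `ρ(A)` on the contour of angle `σ/2`, both sides
become the Cauchy integral of `ρ² f`. The second angle provides the nested contours that the product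
formula requires. -/
lemma IsHolOp.commute {f : ℂ → ℂ} {S : X →L[ℂ] X} (hS : IsHolOp A f S) (hf : IsHInf f)
    (hA : IsZeroSectorial A) {σ : ℝ} (hσ : σ ∈ Ioo 0 Real.pi) :
    S * cauchyOp A σ rho = cauchyOp A σ rho * S := by
  have h1 : σ / 2 ∈ Ioo 0 σ := ⟨by linarith [hσ.1], by linarith [hσ.1]⟩
  have h1' : σ / 2 ∈ Ioo 0 Real.pi := ⟨h1.1, h1.2.trans hσ.2⟩
  apply hA.rho_mul_cancel h1'
  rw [← mul_assoc, hS.mul_eq h1', hf.decayHol.cauchyOp_mul decayHol_rho hA h1 hσ.2, hS.mul_eq hσ,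
    decayHol_rho.cauchyOp_mul hf.decayHol hA h1 hσ.2]
  congr 1
  ext l
  ring

lemma IsHolOp.mul {f g : ℂ → ℂ} {S T : X →L[ℂ] X} (hS : IsHolOp A f S) (hT : IsHolOp A g T)
    (hf : IsHInf f) (hg : IsHInf g) (hA : IsZeroSectorial A) :
    IsHolOp A (fun l => f l * g l) (S * T) := by
  refine isHolOp_of_mul_eq fun σ hσ => ?_
  have h1 : σ / 2 ∈ Ioo 0 σ := ⟨by linarith [hσ.1], by linarith [hσ.1]⟩
  have h1' : σ / 2 ∈ Ioo 0 Real.pi := ⟨h1.1, h1.2.trans hσ.2⟩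
  apply hA.rho_mul_cancel h1'
  rw [decayHol_rho.cauchyOp_mul (hf.mul hg).decayHol hA h1 hσ.2, ← mul_assoc (cauchyOp A σ rho) S,
    ← hS.commute hf hA hσ, mul_assoc S, hT.mul_eq hσ, ← mul_assoc, hS.mul_eq h1',
    hf.decayHol.cauchyOp_mul hg.decayHol hA h1 hσ.2]
  congr 1
  ext l
  ring

end HolOp

/-! ### Holomorphic functions with compactly supported Fourier density -/

section Band

/-- The holomorphic function with Mellin–Fourier density `F`. -/
def bandFun (F : ℝ → ℂ) (l : ℂ) : ℂ :=
  ∫ ξ : ℝ, F ξ * Complex.exp (2 * Real.pi * ξ * Complex.I * Complex.log l)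

lemma norm_exp_band (ξ : ℝ) (z : ℂ) :
    ‖Complex.exp (2 * Real.pi * ξ * Complex.I * z)‖ = Real.exp (-(2 * Real.pi * ξ * z.im)) := by
  rw [Complex.norm_exp]
  congr 1
  simp

lemma norm_exp_band_le {ξ R : ℝ} (h : |ξ| ≤ R) (z : ℂ) :
    ‖Complex.exp (2 * Real.pi * ξ * Complex.I * z)‖ ≤ Real.exp (2 * Real.pi * R * |z.im|) := by
  rw [norm_exp_band]
  gcongr
  have h1 : -(ξ * z.im) ≤ R * |z.im| := by
    calc -(ξ * z.im) ≤ |ξ * z.im| := neg_le_abs _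
      _ = |ξ| * |z.im| := abs_mul _ _
      _ ≤ _ := by gcongr
  nlinarith [Real.pi_pos]

lemma aestronglyMeasurable_band {F : ℝ → ℂ} (hF : Integrable F) (z : ℂ) :
    AEStronglyMeasurable (fun ξ : ℝ => F ξ * Complex.exp (2 * Real.pi * ξ * Complex.I * z)) := by
  refine hF.aestronglyMeasurable.mul (Continuous.aestronglyMeasurable ?_)
  fun_prop

lemma integrable_band {F : ℝ → ℂ} (hF : Integrable F) {R : ℝ}
    (hR : ∀ ξ, R < |ξ| → F ξ = 0) (z : ℂ) :
    Integrable (fun ξ : ℝ => F ξ * Complex.exp (2 * Real.pi * ξ * Complex.I * z)) := by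
  refine (hF.norm.mul_const (Real.exp (2 * Real.pi * R * |z.im|))).mono'
    (aestronglyMeasurable_band hF z) (Eventually.of_forall fun ξ => ?_)
  rw [norm_mul]
  by_cases h : R < |ξ|
  · simp [hR ξ h]
  · gcongr
    exact norm_exp_band_le (not_lt.1 h) z

lemma differentiable_band {F : ℝ → ℂ} (hF : Integrable F) {R : ℝ}
    (hR : ∀ ξ, R < |ξ| → F ξ = 0) :
    Differentiable ℂ fun z => ∫ ξ : ℝ, F ξ * Complex.exp (2 * Real.pi * ξ * Complex.I * z) := by
  intro z0
  refine (hasDerivAt_integral_of_dominated_loc_of_deriv_le (s := Metric.ball z0 1)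
    (F' := fun z ξ => F ξ * (Complex.exp (2 * Real.pi * ξ * Complex.I * z) *
      (2 * Real.pi * ξ * Complex.I)))
    (bound := fun ξ => ‖F ξ‖ * (Real.exp (2 * Real.pi * |R| * (‖z0‖ + 1)) * (2 * Real.pi * |R|)))
    (Metric.ball_mem_nhds z0 one_pos)
    (Eventually.of_forall fun z => aestronglyMeasurable_band hF z) (integrable_band hF hR z0) ?_
    (Eventually.of_forall fun ξ z hz => ?_) (hF.norm.mul_const _)
    (Eventually.of_forall fun ξ z _ => ?_)).2.differentiableAt
  · refine hF.aestronglyMeasurable.mul (Continuous.aestronglyMeasurable ?_)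
    fun_prop
  · rw [norm_mul, norm_mul]
    by_cases h : R < |ξ|
    · simp [hR ξ h]
    · have h1 : |ξ| ≤ |R| := (not_lt.1 h).trans (le_abs_self R)
      have h2 : |z.im| ≤ ‖z0‖ + 1 := by
        rw [Metric.mem_ball, dist_eq_norm] at hz
        have := norm_sub_norm_le z z0
        linarith [Complex.abs_im_le_norm z]
      gcongr
      · refine (norm_exp_band_le h1 z).trans ?_
        gcongr
      · simp [abs_of_pos Real.pi_pos]
        gcongr
  · have h1 : HasDerivAt (fun z : ℂ => 2 * Real.pi * ξ * Complex.I * z)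
        (2 * Real.pi * ξ * Complex.I) z := by
      simpa using (hasDerivAt_id z).const_mul (2 * Real.pi * ξ * Complex.I)
    exact h1.cexp.const_mul _

/-- As a function of `log l` the integral is entire, and since `|arg l| ≤ π` the compact support of
`F` bounds the exponential uniformly. -/
lemma isHInf_bandFun {F : ℝ → ℂ} (hF : Integrable F) {R : ℝ}
    (hR : ∀ ξ, R < |ξ| → F ξ = 0) : IsHInf (bandFun F) := by
  constructor
  · intro z hz
    exact ((differentiable_band hF hR (Complex.log z)).comp z
      (Complex.differentiableAt_log hz)).differentiableWithinAt
  · intro w hw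
    refine ⟨∫ ξ, ‖F ξ‖ * Real.exp (2 * Real.pi * |R| * Real.pi), fun z hz => ?_⟩
    refine norm_integral_le_of_norm_le (hF.norm.mul_const _) (Eventually.of_forall fun ξ => ?_)
    rw [norm_mul]
    by_cases h : R < |ξ|
    · simp [hR ξ h]
    · gcongr
      refine (norm_exp_band_le ((not_lt.1 h).trans (le_abs_self R)) _).trans ?_
      gcongr
      rw [Complex.log_im]
      exact Complex.abs_arg_le_pi z

lemma bandFun_exp (F : ℝ → ℂ) (u : ℝ) : bandFun F (Real.exp u : ℝ) = 𝓕⁻ F u := by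
  rw [bandFun, Real.fourierInv_eq', ← Complex.ofReal_log (Real.exp_pos u).le, Real.log_exp]
  congr 1
  ext ξ
  rw [smul_eq_mul, mul_comm (F ξ)]
  congr 2
  simp
  ring

/-- The normalized indicator of `(0, 1/(n+1))`. -/
def approxDelta (n : ℕ) : ℝ → ℂ := (Ioc (0 : ℝ) (1 / (n + 1))).indicator fun _ => ((n : ℂ) + 1)

lemma memLp_approxDelta (n : ℕ) (p : ℝ≥0∞) : MemLp (approxDelta n) p volume :=
  memLp_indicator_const p measurableSet_Ioc _ (Or.inr (by simp))

lemma approxDelta_eq_zero (n : ℕ) {ξ : ℝ} (h : 1 < |ξ|) : approxDelta n ξ = 0 := by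
  refine indicator_of_notMem (fun hξ => ?_) _
  rw [abs_of_pos hξ.1] at h
  have : 1 / ((n : ℝ) + 1) ≤ 1 := by
    rw [div_le_one (by positivity)]
    linarith [n.cast_nonneg (α := ℝ)]
  linarith [hξ.2]

lemma isHInf_bandFun_approxDelta (n : ℕ) : IsHInf (bandFun (approxDelta n)) :=
  isHInf_bandFun (memLp_one_iff_integrable.1 (memLp_approxDelta n 1))
    fun _ => approxDelta_eq_zero n

lemma bandFun_approxDelta (n : ℕ) (z : ℂ) : bandFun (approxDelta n) z =
    ∫ ξ in Ioc (0 : ℝ) (1 / (n + 1)), ((n : ℂ) + 1) *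
      Complex.exp (2 * Real.pi * ξ * Complex.I * Complex.log z) := by
  rw [bandFun, ← integral_indicator measurableSet_Ioc]
  congr 1
  ext ξ
  by_cases h : ξ ∈ Ioc (0 : ℝ) (1 / (n + 1))
  · rw [approxDelta, indicator_of_mem h, indicator_of_mem h]
  · rw [approxDelta, indicator_of_notMem h, indicator_of_notMem h, zero_mul]

lemma volume_real_Ioc_inv (n : ℕ) : volume.real (Ioc (0 : ℝ) (1 / (n + 1))) = 1 / (n + 1) := by
  rw [Real.volume_real_Ioc_of_le (by positivity), sub_zero]

lemma norm_natCast_add_one (n : ℕ) : ‖(n : ℂ) + 1‖ = n + 1 := by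
  have : (n : ℂ) + 1 = ((n + 1 : ℕ) : ℂ) := by push_cast; ring
  rw [this, Complex.norm_natCast]
  push_cast
  ring

lemma norm_bandFun_approxDelta_le (n : ℕ) (z : ℂ) :
    ‖bandFun (approxDelta n) z‖ ≤ Real.exp (2 * Real.pi * 1 * Real.pi) := by
  rw [bandFun_approxDelta]
  refine (norm_setIntegral_le_of_norm_le_const (C := (n + 1) * Real.exp (2 * Real.pi * 1 * Real.pi))
    (by simp) fun ξ hξ => ?_).trans ?_
  · rw [norm_mul, norm_natCast_add_one]
    gcongr
    have h1 : |ξ| ≤ 1 := by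
      by_contra h
      have := approxDelta_eq_zero n (not_le.1 h)
      rw [approxDelta, indicator_of_mem hξ] at this
      exact Nat.cast_add_one_ne_zero n this
    refine (norm_exp_band_le h1 _).trans ?_
    gcongr
    rw [Complex.log_im]
    exact Complex.abs_arg_le_pi z
  · rw [volume_real_Ioc_inv]
    field_simp
    exact le_rfl

/-- The constant `1` is not in `𝓦^α_2`. These uniformly bounded functions of `𝓦^α_2` replace it and
make it possible to recover `ρ(A)` from the Sobolev calculus. -/
lemma tendsto_bandFun_approxDelta (z : ℂ) :
    Tendsto (fun n => bandFun (approxDelta n) z) atTop (𝓝 1) := by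
  rw [Metric.tendsto_atTop]
  intro ε hε
  have hc : ContinuousAt (fun ξ : ℝ => Complex.exp (2 * Real.pi * ξ * Complex.I * Complex.log z)) 0 := by
    fun_prop
  obtain ⟨δ, hδ, h⟩ := Metric.continuousAt_iff.1 hc (ε / 2) (by linarith)
  obtain ⟨N, hN⟩ := exists_nat_one_div_lt hδ
  refine ⟨N, fun n hn => ?_⟩
  have hnδ : 1 / ((n : ℝ) + 1) < δ := by
    refine lt_of_le_of_lt ?_ hN
    gcongr
  have h1 : (∫ ξ in Ioc (0 : ℝ) (1 / (n + 1)), ((n : ℂ) + 1)) = 1 := by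
    rw [setIntegral_const, volume_real_Ioc_inv, Complex.real_smul]
    push_cast
    have := Nat.cast_add_one_ne_zero (R := ℂ) n
    field_simp
  have hint : IntegrableOn (fun ξ : ℝ => ((n : ℂ) + 1) *
      Complex.exp (2 * Real.pi * ξ * Complex.I * Complex.log z)) (Ioc (0 : ℝ) (1 / (n + 1))) := by
    apply Continuous.integrableOn_Ioc
    fun_prop
  rw [bandFun_approxDelta, dist_eq_norm]
  have h3 (c : ℂ) : c - 1 = c - ∫ ξ in Ioc (0 : ℝ) (1 / (n + 1)), ((n : ℂ) + 1) := by rw [h1]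
  rw [h3, ← integral_sub hint (by simp)]
  refine (norm_setIntegral_le_of_norm_le_const (C := (n + 1) * (ε / 2))
    (by simp) fun ξ hξ => ?_).trans_lt ?_
  · have h2 := h (x := ξ) (by
      rw [Real.dist_eq, sub_zero, abs_of_pos hξ.1]
      exact hξ.2.trans_lt hnδ)
    simp only [Complex.ofReal_zero, mul_zero, zero_mul, Complex.exp_zero, dist_eq_norm] at h2
    rw [← mul_sub_one, norm_mul, norm_natCast_add_one]
    gcongr
  · rw [volume_real_Ioc_inv]
    field_simp
    linarith

end Band

open scoped SchwartzMap

/-! ### The Fourier transform on `L²` -/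

section FourierL2

lemma fourierL2_of_memLp {f : ℝ → ℂ} (hf : MemLp f 2 volume) :
    fourierL2 f = ((𝓕 (hf.toLp f) : Lp ℂ 2 (volume : Measure ℝ)) : ℝ → ℂ) := by
  rw [fourierL2, dif_pos hf]

lemma memLp_fourierL2 {f : ℝ → ℂ} (hf : MemLp f 2 volume) : MemLp (fourierL2 f) 2 volume := by
  rw [fourierL2_of_memLp hf]
  exact Lp.memLp _

lemma fourierL2_congr {f g : ℝ → ℂ} (h : f =ᵐ[volume] g) : fourierL2 f = fourierL2 g := by
  by_cases hf : MemLp f 2 volume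
  · have hg : MemLp g 2 volume := (memLp_congr_ae h).1 hf
    rw [fourierL2_of_memLp hf, fourierL2_of_memLp hg, MemLp.toLp_congr hf hg h]
  · have hg : ¬ MemLp g 2 volume := fun hg => hf ((memLp_congr_ae h).2 hg)
    rw [fourierL2, dif_neg hf, fourierL2, dif_neg hg]

lemma fourierL2_add {f g : ℝ → ℂ} (hf : MemLp f 2 volume) (hg : MemLp g 2 volume) :
    fourierL2 (fun u => f u + g u) =ᵐ[volume] fun ξ => fourierL2 f ξ + fourierL2 g ξ := by
  change fourierL2 (f + g) =ᵐ[volume] _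
  rw [fourierL2_of_memLp hf, fourierL2_of_memLp hg, fourierL2_of_memLp (hf.add hg),
    MemLp.toLp_add hf hg, FourierAdd.fourier_add]
  exact Lp.coeFn_add _ _

lemma fourierL2_const_mul {f : ℝ → ℂ} (hf : MemLp f 2 volume) (c : ℂ) :
    fourierL2 (fun u => c * f u) =ᵐ[volume] fun ξ => c * fourierL2 f ξ := by
  rw [fourierL2_of_memLp hf, fourierL2_of_memLp (hf.const_mul c)]
  have : (hf.const_smul c).toLp (c • f) = c • hf.toLp f := MemLp.toLp_const_smul c hf
  change ((𝓕 ((hf.const_smul c).toLp (c • f)) : Lp ℂ 2 (volume : Measure ℝ)) : ℝ → ℂ) =ᵐ[volume] _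
  rw [this, FourierSMul.fourier_smul]
  exact Lp.coeFn_smul _ _

lemma ae_eq_of_fourierL2_ae_eq {f g : ℝ → ℂ} (hf : MemLp f 2 volume) (hg : MemLp g 2 volume)
    (h : fourierL2 f =ᵐ[volume] fourierL2 g) : f =ᵐ[volume] g := by
  rw [fourierL2_of_memLp hf, fourierL2_of_memLp hg] at h
  have h1 := Lp.ext h
  have h2 := (Lp.fourierTransformₗᵢ ℝ ℂ).injective h1
  exact (MemLp.toLp_eq_toLp_iff hf hg).1 h2

/-- The multiplication formula for the `L²` Fourier transform. -/
lemma integral_fourierL2_mul {f : ℝ → ℂ} (hf : MemLp f 2 volume) (g : 𝓢(ℝ, ℂ)) :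
    ∫ ξ, g ξ * fourierL2 f ξ = ∫ u, (𝓕 g) u * f u := by
  have h := DFunLike.congr_fun (Lp.fourier_toTemperedDistribution_eq (hf.toLp f)) g
  rw [TemperedDistribution.fourier_apply, Lp.toTemperedDistribution_apply,
    Lp.toTemperedDistribution_apply] at h
  rw [fourierL2_of_memLp hf]
  simp only [smul_eq_mul] at h
  rw [← h]
  refine integral_congr_ae ?_
  filter_upwards [hf.coeFn_toLp] with u hu
  rw [hu]

lemma ae_eq_of_forall_schwartz {f g : ℝ → ℂ} (hf : LocallyIntegrable f) (hg : LocallyIntegrable g)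
    (h : ∀ η : 𝓢(ℝ, ℂ), ∫ u, η u * f u = ∫ u, η u * g u) : f =ᵐ[volume] g := by
  refine ae_eq_of_integral_contDiff_smul_eq hf hg fun η hη hc => ?_
  have hc' : HasCompactSupport fun u => (η u : ℂ) := hc.comp_left (g := Complex.ofReal) rfl
  have hη' : ContDiff ℝ (⊤ : ℕ∞) fun u => (η u : ℂ) := Complex.ofRealCLM.contDiff.comp hη
  exact h (hc'.toSchwartzMap hη')

lemma MemLp.locallyIntegrable_two {f : ℝ → ℂ} (hf : MemLp f 2 volume) : LocallyIntegrable f :=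
  hf.locallyIntegrable (by norm_num)

lemma continuous_fourierInv {F : ℝ → ℂ} (hF : Integrable F) : Continuous (𝓕⁻ F) := by
  have : Continuous (𝓕 F) := VectorFourier.fourierIntegral_continuous Real.continuous_fourierChar
    (L := innerₗ ℝ) continuous_inner hF
  rw [show (𝓕⁻ F) = fun u => 𝓕 F (-u) from funext fun u => Real.fourierInv_eq_fourier_neg F u]
  exact this.comp continuous_neg

lemma integral_mul_fourierInv {F : ℝ → ℂ} (hF : Integrable F) (g : 𝓢(ℝ, ℂ)) :
    ∫ u, g u * (𝓕⁻ F) u = ∫ ξ, (𝓕⁻ g) ξ * F ξ := by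
  have h1 : ∀ (F g : ℝ → ℂ), Integrable F → Integrable g →
      ∫ u, g u * (𝓕 F) u = ∫ ξ, (𝓕 g) ξ * F ξ := by
    intro F g hF hg
    have := VectorFourier.integral_fourierIntegral_smul_eq_flip (L := innerₗ ℝ)
      Real.continuous_fourierChar continuous_inner hg hF
    simp only [flip_innerₗ, smul_eq_mul] at this
    exact this.symm
  have h2 := h1 F (fun u => g (-u)) hF g.integrable.comp_neg
  rw [← integral_neg_eq_self] at h2
  simp only [neg_neg] at h2
  calc ∫ u, g u * (𝓕⁻ F) u = ∫ u, g u * (𝓕 F) (-u) := by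
        simp only [Real.fourierInv_eq_fourier_neg]
    _ = _ := h2
    _ = _ := by
        rw [SchwartzMap.fourierInv_coe, Real.fourierInv_eq_fourier_comp_neg]

/-- For `F ∈ L¹ ∩ L²`, the inverse Fourier integral of `F` lies in `L²` and `F` is its `L²` Fourier
transform. -/
lemma fourierInv_memLp {F : ℝ → ℂ} (hF : Integrable F) (hF2 : MemLp F 2 volume) :
    MemLp (𝓕⁻ F) 2 volume ∧ fourierL2 (𝓕⁻ F) =ᵐ[volume] F := by
  set G : Lp ℂ 2 (volume : Measure ℝ) := 𝓕⁻ (hF2.toLp F) with hG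
  have hGF : 𝓕 G = hF2.toLp F := FourierTransform.fourier_fourierInv_eq _
  have hGae : (G : ℝ → ℂ) =ᵐ[volume] 𝓕⁻ F := by
    refine ae_eq_of_forall_schwartz (MemLp.locallyIntegrable_two (Lp.memLp G))
      (continuous_fourierInv hF).locallyIntegrable fun g => ?_
    have h := DFunLike.congr_fun (Lp.fourierInv_toTemperedDistribution_eq (hF2.toLp F)) g
    rw [TemperedDistribution.fourierInv_apply, Lp.toTemperedDistribution_apply,
      Lp.toTemperedDistribution_apply] at h
    simp only [smul_eq_mul] at h
    rw [hG, ← h, integral_mul_fourierInv hF]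
    refine integral_congr_ae ?_
    filter_upwards [hF2.coeFn_toLp] with u hu
    rw [hu]
  refine ⟨(memLp_congr_ae hGae).1 (Lp.memLp G), ?_⟩
  rw [← fourierL2_congr hGae, fourierL2_of_memLp (Lp.memLp G), Lp.toLp_coeFn, hGF]
  exact hF2.coeFn_toLp

lemma fourierL2_schwartz (g : 𝓢(ℝ, ℂ)) : fourierL2 g =ᵐ[volume] ((𝓕 g : 𝓢(ℝ, ℂ)) : ℝ → ℂ) := by
  rw [fourierL2_of_memLp (g.memLp 2)]
  have : (g.memLp 2 volume).toLp g = g.toLp 2 volume := rfl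
  rw [this, SchwartzMap.toLp_fourier_eq]
  exact SchwartzMap.coeFn_toLp (𝓕 g) 2 volume

/-- Duality with Schwartz functions identifies an `L²` Fourier transform when no integral formula is
available; translation and reflection are moved onto the test function in this way. -/
lemma ae_eq_fourierL2 {f G : ℝ → ℂ} (hf : MemLp f 2 volume) (hG : MemLp G 2 volume)
    (h : ∀ g : 𝓢(ℝ, ℂ), ∫ ξ, g ξ * G ξ = ∫ u, (𝓕 g) u * f u) : fourierL2 f =ᵐ[volume] G :=
  ae_eq_of_forall_schwartz (MemLp.locallyIntegrable_two (memLp_fourierL2 hf))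
    (MemLp.locallyIntegrable_two hG)
    fun g => (integral_fourierL2_mul hf g).trans (h g).symm

/-- The unimodular character `ξ ↦ e^{2πisξ}`. -/
def char (s ξ : ℝ) : ℂ := Complex.exp (2 * Real.pi * s * ξ * Complex.I)

lemma norm_char (s ξ : ℝ) : ‖char s ξ‖ = 1 := by
  rw [char, show (2 * Real.pi * s * ξ * Complex.I : ℂ) = ((2 * Real.pi * s * ξ : ℝ) : ℂ) * Complex.I by
    push_cast; ring]
  exact Complex.norm_exp_ofReal_mul_I _

lemma continuous_char_right (s : ℝ) : Continuous (char s) := by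
  unfold char
  fun_prop

lemma MemLp.char_mul {F : ℝ → ℂ} {p : ℝ≥0∞} (hF : MemLp F p volume) (s : ℝ) :
    MemLp (fun ξ => char s ξ * F ξ) p volume := by
  refine hF.of_le ((continuous_char_right s).aestronglyMeasurable.mul hF.aestronglyMeasurable)
    (Eventually.of_forall fun ξ => ?_)
  rw [norm_mul, norm_char, one_mul]

lemma fourierInv_eq_char (F : ℝ → ℂ) (u : ℝ) : (𝓕⁻ F) u = ∫ ξ, char u ξ * F ξ := by
  rw [Real.fourierInv_eq']
  congr 1
  ext ξ
  rw [smul_eq_mul, char]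
  congr 2
  simp
  ring

lemma char_add (s t ξ : ℝ) : char (s + t) ξ = char s ξ * char t ξ := by
  rw [char, char, char, ← Complex.exp_add]
  congr 1
  push_cast
  ring

lemma char_comm (s t : ℝ) : char s t = char t s := by
  rw [char, char]
  congr 1
  ring

lemma MemLp.comp_add_right' {f : ℝ → ℂ} {p : ℝ≥0∞} (hf : MemLp f p volume) (s : ℝ) :
    MemLp (fun u => f (u + s)) p volume :=
  hf.comp_measurePreserving (measurePreserving_add_right volume s)

lemma fourierL2_comp_add {f : ℝ → ℂ} (hf : MemLp f 2 volume) (s : ℝ) :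
    fourierL2 (fun u => f (u + s)) =ᵐ[volume] fun ξ => char s ξ * fourierL2 f ξ := by
  refine ae_eq_fourierL2 (MemLp.comp_add_right' hf s) (MemLp.char_mul (memLp_fourierL2 hf) s)
    fun g => ?_
  set h : 𝓢(ℝ, ℂ) := SchwartzMap.compSubConstCLM ℂ s (𝓕 g) with hh
  have hval (u : ℝ) : h u = (𝓕 g) (u - s) := rfl
  have h1 : ∫ u, (𝓕 g) u * f (u + s) = ∫ u, h u * f u := by
    refine (integral_sub_right_eq_self (μ := volume) (fun u => (𝓕 g) u * f (u + s)) s).symm.trans ?_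
    simp only [sub_add_cancel, hval]
  have h2 : 𝓕 (𝓕⁻ h) = h := FourierTransform.fourier_fourierInv_eq h
  have h3 (ξ : ℝ) : (𝓕⁻ h) ξ = char s ξ * g ξ := by
    have e1 : (𝓕⁻ h) ξ = (𝓕⁻ (h : ℝ → ℂ)) ξ := by rw [SchwartzMap.fourierInv_coe]
    have e2 : g ξ = (𝓕⁻ ((𝓕 g : 𝓢(ℝ, ℂ)) : ℝ → ℂ)) ξ := by
      rw [← SchwartzMap.fourierInv_coe, FourierTransform.fourierInv_fourier_eq g]
    rw [e1, e2, fourierInv_eq_char, fourierInv_eq_char, ← integral_const_mul,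
      ← integral_add_right_eq_self _ s]
    congr 1
    ext u
    rw [hval, add_sub_cancel_right, char_comm ξ, char_add, char_comm u, char_comm s]
    ring
  rw [h1, ← h2, ← integral_fourierL2_mul hf]
  congr 1
  ext ξ
  rw [h3]
  ring

lemma fourierL2_comp_neg {f : ℝ → ℂ} (hf : MemLp f 2 volume) :
    fourierL2 (fun u => f (-u)) =ᵐ[volume] fun ξ => fourierL2 f (-ξ) := by
  have hneg {g : ℝ → ℂ} (hg : MemLp g 2 volume) : MemLp (fun u => g (-u)) 2 volume :=
    hg.comp_measurePreserving (Measure.measurePreserving_neg volume)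
  refine ae_eq_fourierL2 (hneg hf) (hneg (memLp_fourierL2 hf)) fun g => ?_
  set h : 𝓢(ℝ, ℂ) := SchwartzMap.compCLMOfContinuousLinearEquiv ℂ (ContinuousLinearEquiv.neg ℝ) g
    with hh
  have hval (u : ℝ) : h u = g (-u) := rfl
  have h1 (u : ℝ) : (𝓕 h) u = (𝓕 g) (-u) := by
    rw [SchwartzMap.fourier_coe, SchwartzMap.fourier_coe]
    have : (h : ℝ → ℂ) = fun x => g (-x) := funext hval
    rw [this, ← Real.fourierInv_eq_fourier_comp_neg, Real.fourierInv_eq_fourier_neg]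
  have h2 := integral_fourierL2_mul hf h
  rw [← integral_neg_eq_self] at h2
  simp only [hval, neg_neg] at h2
  rw [h2, ← integral_neg_eq_self]
  congr 1
  ext u
  rw [h1, neg_neg]

end FourierL2

open scoped SchwartzMap Convolution

/-! ### The Sobolev space as a weighted `L²` space, and its algebra property -/

section Sobolev

/-- Young's inequality `‖a ⋆ b‖₂ ≤ ‖a‖₂ ‖b‖₁`, in terms of lower integrals. -/
lemma lintegral_lintegral_sub_sq_le {a b : ℝ → ℝ≥0∞} (ha : Measurable a) (hb : Measurable b) :
    ∫⁻ ξ, (∫⁻ η, b η * a (ξ - η)) ^ (2 : ℝ) ≤ (∫⁻ η, b η) ^ (2 : ℝ) * ∫⁻ ξ, a ξ ^ (2 : ℝ) := by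
  -- Cauchy–Schwarz for the measure `b dη`, with the second function equal to `1`; Tonelli then
  -- finishes.
  have hpt (ξ : ℝ) : (∫⁻ η, b η * a (ξ - η)) ^ (2 : ℝ) ≤
      (∫⁻ η, b η) * ∫⁻ η, b η * a (ξ - η) ^ (2 : ℝ) := by
    have ham : Measurable fun η => a (ξ - η) := ha.comp (measurable_const.sub measurable_id)
    have h := ENNReal.lintegral_mul_le_Lp_mul_Lq (volume.withDensity b)
      (p := 2) (q := 2) Real.HolderConjugate.two_two ham.aemeasurable
      (aemeasurable_const (b := (1 : ℝ≥0∞)))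
    simp only [Pi.mul_apply, mul_one, ENNReal.one_rpow, lintegral_const, one_mul] at h
    rw [lintegral_withDensity_eq_lintegral_mul _ hb ham,
      lintegral_withDensity_eq_lintegral_mul _ hb (ham.pow_const _),
      withDensity_apply _ MeasurableSet.univ, Measure.restrict_univ] at h
    calc (∫⁻ η, b η * a (ξ - η)) ^ (2 : ℝ) ≤ _ := ENNReal.rpow_le_rpow h (by norm_num)
      _ = _ := by
        rw [ENNReal.mul_rpow_of_nonneg _ _ (by norm_num), ← ENNReal.rpow_mul, ← ENNReal.rpow_mul]
        norm_num
        rw [mul_comm]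
  refine (lintegral_mono hpt).trans ?_
  have hm : Measurable fun p : ℝ × ℝ => b p.2 * a (p.1 - p.2) ^ (2 : ℝ) :=
    (hb.comp measurable_snd).mul ((ha.comp (measurable_fst.sub measurable_snd)).pow_const _)
  rw [lintegral_const_mul _ hm.lintegral_prod_right', lintegral_lintegral_swap hm.aemeasurable]
  have : ∀ η, ∫⁻ ξ, b η * a (ξ - η) ^ (2 : ℝ) = b η * ∫⁻ ξ, a ξ ^ (2 : ℝ) := by
    intro η
    have hm' : Measurable fun ξ => a (ξ - η) ^ (2 : ℝ) :=
      (ha.comp (measurable_id.sub_const η)).pow_const _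
    rw [lintegral_const_mul _ hm',
      lintegral_sub_right_eq_self (fun ξ => a ξ ^ (2 : ℝ))]
  simp only [this]
  rw [lintegral_mul_const _ hb, ← mul_assoc, ENNReal.rpow_two, sq]

/-- The Sobolev weight. -/
def wt (α ξ : ℝ) : ℝ := (1 + 2 * Real.pi * |ξ|) ^ α

lemma one_le_wt_base (ξ : ℝ) : 1 ≤ 1 + 2 * Real.pi * |ξ| := by
  have := Real.pi_pos
  have : 0 ≤ 2 * Real.pi * |ξ| := by positivity
  linarith

lemma wt_pos (α ξ : ℝ) : 0 < wt α ξ :=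
  Real.rpow_pos_of_pos (zero_lt_one.trans_le (one_le_wt_base ξ)) _

lemma one_le_wt {α : ℝ} (hα : 0 ≤ α) (ξ : ℝ) : 1 ≤ wt α ξ := Real.one_le_rpow (one_le_wt_base ξ) hα

lemma continuous_wt (α : ℝ) : Continuous (wt α) := by
  unfold wt
  refine Continuous.rpow_const (by fun_prop) fun ξ => Or.inl ?_
  exact (zero_lt_one.trans_le (one_le_wt_base ξ)).ne'

lemma wt_ne_zero (α ξ : ℝ) : (wt α ξ : ℂ) ≠ 0 := by exact_mod_cast (wt_pos α ξ).ne'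

/-- Only the larger of the two frequencies matters. The sum on the right lets the weight fall on one
factor of a product at a time. -/
lemma wt_add_le {α : ℝ} (hα : 0 ≤ α) (ξ η : ℝ) : wt α (ξ + η) ≤ 2 ^ α * (wt α ξ + wt α η) := by
  have key : ∀ ξ η : ℝ, |ξ| ≤ |η| → wt α (ξ + η) ≤ 2 ^ α * wt α η := by
    intro ξ η h
    rw [wt, wt, ← Real.mul_rpow (by norm_num) (zero_le_one.trans (one_le_wt_base η))]
    refine Real.rpow_le_rpow (zero_le_one.trans (one_le_wt_base _)) ?_ hα
    have h1 : |ξ + η| ≤ 2 * |η| := (abs_add_le ξ η).trans (by linarith)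
    have h2 : 2 * Real.pi * |ξ + η| ≤ 2 * Real.pi * (2 * |η|) :=
      mul_le_mul_of_nonneg_left h1 (by positivity)
    linarith
  have h2 : (0 : ℝ) < 2 ^ α := by positivity
  rcases le_total |ξ| |η| with h | h
  · refine (key ξ η h).trans (mul_le_mul_of_nonneg_left ?_ h2.le)
    linarith [wt_pos α ξ]
  · rw [add_comm ξ η]
    refine (key η ξ h).trans (mul_le_mul_of_nonneg_left ?_ h2.le)
    linarith [wt_pos α η]

/-- Here `α > 1/2` enters: the square of the inverse weight decays like `|ξ|^{-2α}` with `2α > 1`.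
Consequently Fourier transforms of `W^α_2` functions are integrable and the functions have
continuous representatives. -/
lemma memLp_wt_inv {α : ℝ} (hα : 1 / 2 < α) :
    MemLp (fun ξ => ((wt α ξ : ℂ))⁻¹) 2 volume := by
  have hc : Continuous fun ξ => ((wt α ξ : ℂ))⁻¹ :=
    (Complex.continuous_ofReal.comp (continuous_wt α)).inv₀ (wt_ne_zero α)
  rw [memLp_two_iff_integrable_sq_norm hc.aestronglyMeasurable]
  have h := integrable_one_add_norm (E := ℝ) (μ := volume) (r := 2 * α) (by simp; linarith)
  refine h.mono' (hc.norm.pow 2).aestronglyMeasurable (Eventually.of_forall fun ξ => ?_)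
  rw [norm_pow, norm_norm, norm_inv, Complex.norm_real, Real.norm_of_nonneg (wt_pos α ξ).le,
    inv_pow, Real.norm_eq_abs, Real.rpow_neg (by positivity)]
  refine inv_anti₀ (by positivity) ?_
  rw [wt, ← Real.rpow_natCast, ← Real.rpow_mul (zero_le_one.trans (one_le_wt_base ξ)), mul_comm α]
  refine Real.rpow_le_rpow (by positivity) ?_ (by linarith)
  have : 1 * |ξ| ≤ 2 * Real.pi * |ξ| :=
    mul_le_mul_of_nonneg_right (by linarith [Real.pi_gt_three]) (abs_nonneg _)
  linarith

/-- Division by the Sobolev weight. -/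
def divWt (α : ℝ) (F : ℝ → ℂ) : ℝ → ℂ := fun ξ => (wt α ξ : ℂ)⁻¹ * F ξ

lemma integrable_divWt {α : ℝ} (hα : 1 / 2 < α) {F : ℝ → ℂ} (hF : MemLp F 2 volume) :
    Integrable (divWt α F) :=
  (memLp_wt_inv hα).integrable_mul hF

lemma lintegral_divWt_le {α : ℝ} (hα : 1 / 2 < α) {F : ℝ → ℂ} (hF : MemLp F 2 volume) :
    ∫⁻ ξ, ‖divWt α F ξ‖ₑ ≤ eLpNorm (fun ξ => ((wt α ξ : ℂ))⁻¹) 2 volume * eLpNorm F 2 volume := by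
  have h := eLpNorm_smul_le_mul_eLpNorm (p := 2) (q := 2) (r := 1) hF.aestronglyMeasurable
    (memLp_wt_inv hα).aestronglyMeasurable
  rwa [eLpNorm_one_eq_lintegral_enorm] at h

lemma memLp_divWt {α : ℝ} (hα : 0 ≤ α) {F : ℝ → ℂ} (hF : MemLp F 2 volume) :
    MemLp (divWt α F) 2 volume := by
  have hc : Continuous fun ξ => ((wt α ξ : ℂ))⁻¹ :=
    (Complex.continuous_ofReal.comp (continuous_wt α)).inv₀ (wt_ne_zero α)
  refine hF.of_le (hc.aestronglyMeasurable.mul hF.aestronglyMeasurable)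
    (Eventually.of_forall fun ξ => ?_)
  rw [divWt, norm_mul, norm_inv, Complex.norm_real, Real.norm_of_nonneg (wt_pos α ξ).le]
  exact mul_le_of_le_one_left (norm_nonneg _) (inv_le_one_of_one_le₀ (one_le_wt hα ξ))

lemma wt_mul_divWt (α : ℝ) (F : ℝ → ℂ) (ξ : ℝ) : (wt α ξ : ℂ) * divWt α F ξ = F ξ := by
  rw [divWt, mul_inv_cancel_left₀ (wt_ne_zero α ξ)]

lemma MemSob.memLp_wt_mul {α : ℝ} {f : ℝ → ℂ} (hf : MemSob α f) :
    MemLp (fun ξ => (wt α ξ : ℂ) * fourierL2 f ξ) 2 volume :=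
  ⟨(Complex.continuous_ofReal.comp (continuous_wt α)).aestronglyMeasurable.mul
    (memLp_fourierL2 hf.1).aestronglyMeasurable, hf.2⟩

lemma memSob_of_fourierL2 {α : ℝ} {f F : ℝ → ℂ} (hf : MemLp f 2 volume)
    (h : (fun ξ => (wt α ξ : ℂ) * fourierL2 f ξ) =ᵐ[volume] F) (hF : MemLp F 2 volume) :
    MemSob α f := by
  refine ⟨hf, ?_⟩
  change eLpNorm (fun ξ => (wt α ξ : ℂ) * fourierL2 f ξ) 2 volume < ∞
  rw [eLpNorm_congr_ae h]
  exact hF.2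

lemma MemSob.congr {α : ℝ} {f g : ℝ → ℂ} (hf : MemSob α f) (h : f =ᵐ[volume] g) : MemSob α g := by
  refine ⟨(memLp_congr_ae h).1 hf.1, ?_⟩
  have := hf.2
  unfold sobNorm at this ⊢
  rwa [← fourierL2_congr h]

lemma MemSob.add {α : ℝ} {f g : ℝ → ℂ} (hf : MemSob α f) (hg : MemSob α g) :
    MemSob α (fun u => f u + g u) := by
  refine memSob_of_fourierL2 (hf.1.add hg.1) ?_ (hf.memLp_wt_mul.add hg.memLp_wt_mul)
  filter_upwards [fourierL2_add hf.1 hg.1] with ξ h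
  rw [h, Pi.add_apply, mul_add]

lemma MemSob.const_mul {α : ℝ} {f : ℝ → ℂ} (hf : MemSob α f) (c : ℂ) :
    MemSob α (fun u => c * f u) := by
  refine memSob_of_fourierL2 (hf.1.const_mul c) ?_ (hf.memLp_wt_mul.const_mul c)
  filter_upwards [fourierL2_const_mul hf.1 c] with ξ h
  rw [h, mul_left_comm]

open Classical in
/-- The weighted Fourier transform, an isometry of `W^α_2` onto `L²`. -/
def coef (α : ℝ) (f : ℝ → ℂ) : Lp ℂ 2 (volume : Measure ℝ) :=
  if h : MemSob α f then h.memLp_wt_mul.toLp _ else 0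

lemma MemSob.coef_ae {α : ℝ} {f : ℝ → ℂ} (hf : MemSob α f) :
    (coef α f : ℝ → ℂ) =ᵐ[volume] fun ξ => (wt α ξ : ℂ) * fourierL2 f ξ := by
  rw [coef, dif_pos hf]
  exact hf.memLp_wt_mul.coeFn_toLp

lemma MemSob.enorm_coef {α : ℝ} {f : ℝ → ℂ} (hf : MemSob α f) : ‖coef α f‖ₑ = sobNorm α f := by
  rw [coef, dif_pos hf, Lp.enorm_toLp]
  rfl

lemma coef_congr {α : ℝ} {f g : ℝ → ℂ} (h : f =ᵐ[volume] g) : coef α f = coef α g := by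
  by_cases hf : MemSob α f
  · have hg := hf.congr h
    refine Lp.ext ?_
    filter_upwards [hf.coef_ae, hg.coef_ae] with ξ h1 h2
    rw [h1, h2, fourierL2_congr h]
  · have hg : ¬ MemSob α g := fun hg => hf (hg.congr h.symm)
    rw [coef, dif_neg hf, coef, dif_neg hg]

lemma coef_add {α : ℝ} {f g : ℝ → ℂ} (hf : MemSob α f) (hg : MemSob α g) :
    coef α (fun u => f u + g u) = coef α f + coef α g := by
  refine Lp.ext ?_
  filter_upwards [hf.coef_ae, hg.coef_ae, (hf.add hg).coef_ae, fourierL2_add hf.1 hg.1,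
    Lp.coeFn_add (coef α f) (coef α g)] with ξ h1 h2 h3 h4 h5
  rw [h5, Pi.add_apply, h1, h2, h3, h4, mul_add]

lemma coef_const_mul {α : ℝ} {f : ℝ → ℂ} (hf : MemSob α f) (c : ℂ) :
    coef α (fun u => c * f u) = c • coef α f := by
  refine Lp.ext ?_
  filter_upwards [hf.coef_ae, (hf.const_mul c).coef_ae, fourierL2_const_mul hf.1 c,
    Lp.coeFn_smul c (coef α f)] with ξ h1 h2 h3 h4
  rw [h4, Pi.smul_apply, h1, h2, h3, smul_eq_mul, mul_left_comm]

/-- The function with weighted Fourier transform `F`. -/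
def synth (α : ℝ) (F : Lp ℂ 2 (volume : Measure ℝ)) : ℝ → ℂ := 𝓕⁻ (divWt α F)

lemma memLp_synth {α : ℝ} (hα : 1 / 2 < α) (F : Lp ℂ 2 (volume : Measure ℝ)) :
    MemLp (synth α F) 2 volume ∧ fourierL2 (synth α F) =ᵐ[volume] divWt α F :=
  fourierInv_memLp (integrable_divWt hα (Lp.memLp F)) (memLp_divWt (by linarith) (Lp.memLp F))

lemma memSob_synth {α : ℝ} (hα : 1 / 2 < α) (F : Lp ℂ 2 (volume : Measure ℝ)) :
    MemSob α (synth α F) := by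
  refine memSob_of_fourierL2 (memLp_synth hα F).1 ?_ (Lp.memLp F)
  filter_upwards [(memLp_synth hα F).2] with ξ h
  rw [h, wt_mul_divWt]

lemma coef_synth {α : ℝ} (hα : 1 / 2 < α) (F : Lp ℂ 2 (volume : Measure ℝ)) :
    coef α (synth α F) = F := by
  refine Lp.ext ?_
  filter_upwards [(memSob_synth hα F).coef_ae, (memLp_synth hα F).2] with ξ h1 h2
  rw [h1, h2, wt_mul_divWt]

lemma synth_coef {α : ℝ} (hα : 1 / 2 < α) {f : ℝ → ℂ} (hf : MemSob α f) :
    synth α (coef α f) =ᵐ[volume] f := by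
  refine ae_eq_of_fourierL2_ae_eq (memLp_synth hα _).1 hf.1 ?_
  filter_upwards [(memLp_synth hα (coef α f)).2, hf.coef_ae] with ξ h1 h2
  rw [h1, divWt, h2, inv_mul_cancel_left₀ (wt_ne_zero α ξ)]

lemma continuous_synth {α : ℝ} (hα : 1 / 2 < α) (F : Lp ℂ 2 (volume : Measure ℝ)) :
    Continuous (synth α F) :=
  continuous_fourierInv (integrable_divWt hα (Lp.memLp F))

/-- Point evaluation of `synth`, as a bounded functional. -/
def evalCLM {α : ℝ} (hα : 1 / 2 < α) (u : ℝ) : Lp ℂ 2 (volume : Measure ℝ) →L[ℂ] ℂ :=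
  innerSL ℂ ((MemLp.char_mul (memLp_wt_inv hα) (-u)).toLp _)

lemma conj_char (s ξ : ℝ) : (starRingEnd ℂ) (char s ξ) = char (-s) ξ := by
  rw [char, char, ← Complex.exp_conj]
  congr 1
  simp only [map_mul, Complex.conj_ofReal, Complex.conj_I, Complex.ofReal_neg, map_ofNat]
  ring

lemma evalCLM_apply {α : ℝ} (hα : 1 / 2 < α) (u : ℝ) (F : Lp ℂ 2 (volume : Measure ℝ)) :
    evalCLM hα u F = synth α F u := by
  rw [evalCLM, innerSL_apply_apply, L2.inner_def, synth, fourierInv_eq_char]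
  refine integral_congr_ae ?_
  filter_upwards [(MemLp.char_mul (memLp_wt_inv hα) (-u)).coeFn_toLp] with ξ h
  rw [h, RCLike.inner_apply, map_mul, conj_char, neg_neg, map_inv₀, Complex.conj_ofReal, divWt]
  ring

/-- The Fourier transform of a product is a convolution. By `wt_add_le` the weight falls on either
factor, which is then in `L²`, while the other factor is in `L¹` with norm at most `K` times its
Sobolev norm, so Young's inequality applies. The two terms account for the factor `2` beside `2^α`.
-/
lemma exists_memSob_mul {α : ℝ} (hα : 1 / 2 < α) : ∃ C : ℝ≥0, ∀ f g : ℝ → ℂ, MemSob α f →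
    MemSob α g → MemSob α (fun u => f u * g u) ∧
      sobNorm α (fun u => f u * g u) ≤ C * sobNorm α f * sobNorm α g := by
  set K := eLpNorm (fun ξ => ((wt α ξ : ℂ))⁻¹) 2 volume with hK
  have hKtop : K < ∞ := (memLp_wt_inv hα).2
  have hα0 : 0 ≤ α := by linarith
  refine ⟨((2 : ℝ) ^ α * 2).toNNReal * K.toNNReal, fun f g hf hg => ?_⟩
  set F := coef α f with hF
  set G := coef α g with hG
  set a := divWt α F with ha
  set b := divWt α G with hb
  have hai : Integrable a := integrable_divWt hα (Lp.memLp F)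
  have hbi : Integrable b := integrable_divWt hα (Lp.memLp G)
  have hwm : Measurable fun ξ => (wt α ξ : ℂ) :=
    (Complex.continuous_ofReal.comp (continuous_wt α)).measurable
  have hFm : Measurable F := (Lp.stronglyMeasurable F).measurable
  have hGm : Measurable G := (Lp.stronglyMeasurable G).measurable
  have ham : Measurable a := hwm.inv.mul hFm
  have hbm : Measurable b := hwm.inv.mul hGm
  set c : ℝ → ℂ := a ⋆[ContinuousLinearMap.mul ℂ ℂ] b with hc
  have hci : Integrable c := hai.integrable_convolution _ hbi
  have hcinv (u : ℝ) : (𝓕⁻ c) u = (𝓕⁻ a) u * (𝓕⁻ b) u := by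
    rw [Real.fourierInv_eq_fourier_neg, Real.fourierInv_eq_fourier_neg,
      Real.fourierInv_eq_fourier_neg, hc, Real.fourier_mul_convolution_eq hai hbi]
  have hbound (ξ : ℝ) : ‖(wt α ξ : ℂ) * c ξ‖ₑ ≤ ENNReal.ofReal (2 ^ α) *
      ((∫⁻ η, ‖a η‖ₑ * ‖G (ξ - η)‖ₑ) + ∫⁻ η, ‖b η‖ₑ * ‖F (ξ - η)‖ₑ) := by
    have e1 : ∫⁻ η, ‖b η‖ₑ * ‖F (ξ - η)‖ₑ = ∫⁻ η, ‖b (ξ - η)‖ₑ * ‖F η‖ₑ := by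
      rw [← lintegral_sub_left_eq_self _ ξ]
      simp only [sub_sub_cancel]
    have hm1 : Measurable fun η => ‖a η‖ₑ * ‖G (ξ - η)‖ₑ :=
      ham.enorm.mul (hGm.comp (measurable_const.sub measurable_id)).enorm
    have hm2 : Measurable fun η => ‖b (ξ - η)‖ₑ * ‖F η‖ₑ :=
      (hbm.comp (measurable_const.sub measurable_id)).enorm.mul hFm.enorm
    have hm12 : Measurable fun η => ‖a η‖ₑ * ‖G (ξ - η)‖ₑ + ‖b (ξ - η)‖ₑ * ‖F η‖ₑ := hm1.add hm2
    rw [e1, ← lintegral_add_left hm1, ← lintegral_const_mul _ hm12, enorm_mul, hc,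
      convolution_def]
    refine (mul_le_mul_right (enorm_integral_le_lintegral_enorm _) _).trans ?_
    rw [← lintegral_const_mul _ (by
      simp only [ContinuousLinearMap.mul_apply']
      exact (ham.mul (hbm.comp (measurable_const.sub measurable_id))).enorm)]
    refine lintegral_mono fun η => ?_
    simp only [ContinuousLinearMap.mul_apply']
    have hw := wt_add_le hα0 η (ξ - η)
    rw [add_sub_cancel] at hw
    have e2 : ‖(wt α η : ℂ)‖ₑ * ‖a η‖ₑ = ‖F η‖ₑ := by
      rw [← enorm_mul, ha, wt_mul_divWt]
    have e3 : ‖(wt α (ξ - η) : ℂ)‖ₑ * ‖b (ξ - η)‖ₑ = ‖G (ξ - η)‖ₑ := by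
      rw [← enorm_mul, hb, wt_mul_divWt]
    have e4 (ξ : ℝ) : ‖(wt α ξ : ℂ)‖ₑ = ENNReal.ofReal (wt α ξ) := by
      rw [← ofReal_norm, Complex.norm_real, Real.norm_of_nonneg (wt_pos α ξ).le]
    calc ‖(wt α ξ : ℂ)‖ₑ * ‖a η * b (ξ - η)‖ₑ
        ≤ (ENNReal.ofReal (2 ^ α) * (‖(wt α η : ℂ)‖ₑ + ‖(wt α (ξ - η) : ℂ)‖ₑ)) *
          ‖a η * b (ξ - η)‖ₑ := by
          refine mul_le_mul_left ?_ _
          rw [e4, e4, e4, ← ENNReal.ofReal_add (wt_pos _ _).le (wt_pos _ _).le,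
            ← ENNReal.ofReal_mul (by positivity)]
          exact ENNReal.ofReal_le_ofReal hw
      _ = _ := by
          rw [enorm_mul, ← e2, ← e3]
          ring
  have hyoung {p q : ℝ → ℂ} (hp : Measurable p) (hq : Measurable q) :
      eLpNorm (fun ξ => ∫⁻ η, ‖p η‖ₑ * ‖q (ξ - η)‖ₑ) 2 volume ≤
        (∫⁻ η, ‖p η‖ₑ) * eLpNorm q 2 volume := by
    have := ENNReal.rpow_le_rpow (lintegral_lintegral_sub_sq_le hq.enorm hp.enorm)
      (z := 1 / 2) (by norm_num)
    rw [ENNReal.mul_rpow_of_nonneg _ _ (by norm_num), ← ENNReal.rpow_mul] at this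
    rw [eLpNorm_eq_lintegral_rpow_enorm_toReal (by norm_num) (by norm_num),
      eLpNorm_eq_lintegral_rpow_enorm_toReal (by norm_num) (by norm_num)]
    simpa using this
  have hcm : AEStronglyMeasurable c volume := hci.aestronglyMeasurable
  have hm3 {p q : ℝ → ℂ} (hp : Measurable p) (hq : Measurable q) :
      Measurable fun ξ => ∫⁻ η, ‖p η‖ₑ * ‖q (ξ - η)‖ₑ :=
    Measurable.lintegral_prod_right' (f := fun z : ℝ × ℝ => ‖p z.2‖ₑ * ‖q (z.1 - z.2)‖ₑ)
      ((hp.comp measurable_snd).enorm.mul (hq.comp (measurable_fst.sub measurable_snd)).enorm)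
  have hF2 : eLpNorm F 2 volume = sobNorm α f := by rw [← hf.enorm_coef, Lp.enorm_def]
  have hG2 : eLpNorm G 2 volume = sobNorm α g := by rw [← hg.enorm_coef, Lp.enorm_def]
  have hwc : eLpNorm (fun ξ => (wt α ξ : ℂ) * c ξ) 2 volume ≤
      (((2 : ℝ) ^ α * 2).toNNReal * K.toNNReal : ℝ≥0) * sobNorm α f * sobNorm α g := by
    calc eLpNorm (fun ξ => (wt α ξ : ℂ) * c ξ) 2 volume
        ≤ eLpNorm (fun ξ => (ENNReal.ofReal (2 ^ α) : ℝ≥0∞) *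
          ((∫⁻ η, ‖a η‖ₑ * ‖G (ξ - η)‖ₑ) + ∫⁻ η, ‖b η‖ₑ * ‖F (ξ - η)‖ₑ)) 2 volume := by
          refine eLpNorm_mono_enorm fun ξ => ?_
          simpa using hbound ξ
      _ ≤ ENNReal.ofReal (2 ^ α) * eLpNorm (fun ξ =>
          (∫⁻ η, ‖a η‖ₑ * ‖G (ξ - η)‖ₑ) + ∫⁻ η, ‖b η‖ₑ * ‖F (ξ - η)‖ₑ) 2 volume := by
          rw [eLpNorm_eq_lintegral_rpow_enorm_toReal (by norm_num) (by norm_num),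
            eLpNorm_eq_lintegral_rpow_enorm_toReal (by norm_num) (by norm_num)]
          simp only [enorm_eq_self, ENNReal.toReal_ofNat]
          simp only [ENNReal.mul_rpow_of_nonneg _ _ (by norm_num : (0 : ℝ) ≤ 2)]
          have hm4 : Measurable fun ξ => ((∫⁻ η, ‖a η‖ₑ * ‖G (ξ - η)‖ₑ) +
              ∫⁻ η, ‖b η‖ₑ * ‖F (ξ - η)‖ₑ) ^ (2 : ℝ) :=
            ((hm3 ham hGm).add (hm3 hbm hFm)).pow_const _
          rw [lintegral_const_mul _ hm4,
            ENNReal.mul_rpow_of_nonneg _ _ (by norm_num), ← ENNReal.rpow_mul]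
          norm_num
      _ ≤ ENNReal.ofReal (2 ^ α) * (K * sobNorm α f * sobNorm α g +
          K * sobNorm α g * sobNorm α f) := by
          refine mul_le_mul_right ?_ _
          refine (eLpNorm_add_le (hm3 ham hGm).aestronglyMeasurable
            (hm3 hbm hFm).aestronglyMeasurable (by norm_num)).trans ?_
          refine add_le_add ?_ ?_
          · refine (hyoung ham hGm).trans ?_
            rw [hG2, ← hF2]
            exact mul_le_mul_left (lintegral_divWt_le hα (Lp.memLp F)) _
          · refine (hyoung hbm hFm).trans ?_
            rw [hF2, ← hG2]
            exact mul_le_mul_left (lintegral_divWt_le hα (Lp.memLp G)) _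
      _ = _ := by
          rw [ENNReal.coe_mul, ENNReal.coe_toNNReal hKtop.ne]
          change _ = ENNReal.ofReal (2 ^ α * 2) * K * sobNorm α f * sobNorm α g
          rw [ENNReal.ofReal_mul (by positivity)]
          simp only [ENNReal.ofReal_ofNat]
          ring
  have hwcm : AEStronglyMeasurable (fun ξ => (wt α ξ : ℂ) * c ξ) volume :=
    hwm.aestronglyMeasurable.mul hcm
  have hwcL : MemLp (fun ξ => (wt α ξ : ℂ) * c ξ) 2 volume := by
    refine ⟨hwcm, hwc.trans_lt ?_⟩
    exact ENNReal.mul_lt_top (ENNReal.mul_lt_top ENNReal.coe_lt_top hf.2) hg.2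
  have hc2 : MemLp c 2 volume := by
    refine hwcL.of_le hcm (Eventually.of_forall fun ξ => ?_)
    rw [norm_mul, Complex.norm_real, Real.norm_of_nonneg (wt_pos α ξ).le]
    exact le_mul_of_one_le_left (norm_nonneg _) (one_le_wt hα0 ξ)
  obtain ⟨h1, h2⟩ := fourierInv_memLp hci hc2
  have hfg : (𝓕⁻ c) =ᵐ[volume] fun u => f u * g u := by
    filter_upwards [synth_coef hα hf, synth_coef hα hg] with u e1 e2
    rw [hcinv, ← e1, ← e2]
    rfl
  have h3 : (fun ξ => (wt α ξ : ℂ) * fourierL2 (𝓕⁻ c) ξ) =ᵐ[volume]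
      fun ξ => (wt α ξ : ℂ) * c ξ := by
    filter_upwards [h2] with ξ e
    rw [e]
  refine ⟨(memSob_of_fourierL2 h1 h3 hwcL).congr hfg, ?_⟩
  unfold sobNorm
  rw [← fourierL2_congr hfg]
  exact (eLpNorm_congr_ae h3).trans_le hwc

lemma MemSob.mul {α : ℝ} (hα : 1 / 2 < α) {f g : ℝ → ℂ} (hf : MemSob α f) (hg : MemSob α g) :
    MemSob α (fun u => f u * g u) :=
  ((exists_memSob_mul hα).choose_spec f g hf hg).1

end Sobolev

open scoped SchwartzMap

/-! ### Translations, density of test functions, and the transported product -/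

section Density

/-- Smooth functions with compact support on the line. -/
def IsTest (η : ℝ → ℂ) : Prop := ContDiff ℝ (⊤ : ℕ∞) η ∧ HasCompactSupport η

lemma memSob_schwartz (α : ℝ) (g : 𝓢(ℝ, ℂ)) : MemSob α g := by
  obtain ⟨k, hk⟩ := exists_nat_ge α
  obtain ⟨C, hC⟩ : ∃ C : ℝ, ∀ ξ : ℝ, (1 + ‖ξ‖) ^ (k + 1) * ‖(𝓕 g) ξ‖ ≤ C := by
    have h := SchwartzMap.one_add_le_sup_seminorm_apply (𝕜 := ℝ) (m := (k + 1, 0)) (k := k + 1)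
      (n := 0) le_rfl le_rfl (𝓕 g)
    simp only [norm_iteratedFDeriv_zero] at h
    exact ⟨_, h⟩
  have hpi : (1 : ℝ) ≤ 2 * Real.pi := by linarith [Real.pi_gt_three]
  have hb (ξ : ℝ) : ‖(wt α ξ : ℂ) * (𝓕 g) ξ‖ ≤ ‖((2 * Real.pi) ^ k * C : ℝ) * (wt 1 ξ : ℂ)⁻¹ *
      (2 * Real.pi : ℝ)‖ := by
    have hC0 : 0 ≤ C := le_trans (by positivity) (hC 0)
    have h1 : wt α ξ ≤ (2 * Real.pi) ^ k * (1 + ‖ξ‖) ^ k := by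
      rw [← mul_pow, ← Real.rpow_natCast, wt]
      refine (Real.rpow_le_rpow_of_exponent_le (one_le_wt_base ξ) hk).trans ?_
      refine Real.rpow_le_rpow (zero_le_one.trans (one_le_wt_base ξ)) ?_ (Nat.cast_nonneg k)
      rw [Real.norm_eq_abs]
      linarith
    have h2 : wt 1 ξ ≤ 2 * Real.pi * (1 + ‖ξ‖) := by
      rw [wt, Real.rpow_one, Real.norm_eq_abs]
      linarith
    have h3 := hC ξ
    have h4 := wt_pos 1 ξ
    simp only [norm_mul, norm_inv, Complex.norm_real, Real.norm_of_nonneg h4.le,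
      Real.norm_of_nonneg (wt_pos α ξ).le]
    rw [Real.norm_of_nonneg hC0, Real.norm_of_nonneg zero_le_two,
      Real.norm_of_nonneg Real.pi_pos.le,
      Real.norm_of_nonneg (r := (2 * Real.pi) ^ k) (by positivity)]
    have h5 : (1 + ‖ξ‖) ^ k * ‖(𝓕 g) ξ‖ ≤ C * ((wt 1 ξ)⁻¹ * (2 * Real.pi)) := by
      have h6 : (1 + ‖ξ‖)⁻¹ ≤ (wt 1 ξ)⁻¹ * (2 * Real.pi) := by
        rw [inv_mul_eq_div, le_div_iff₀ h4, inv_mul_le_iff₀ (by positivity)]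
        linarith
      refine le_trans ?_ (mul_le_mul_of_nonneg_left h6 hC0)
      rw [← div_eq_mul_inv, le_div_iff₀ (by positivity)]
      calc _ = (1 + ‖ξ‖) ^ (k + 1) * ‖(𝓕 g) ξ‖ := by ring
        _ ≤ C := h3
    calc wt α ξ * ‖(𝓕 g) ξ‖ ≤ (2 * Real.pi) ^ k * (1 + ‖ξ‖) ^ k * ‖(𝓕 g) ξ‖ := by gcongr
      _ = (2 * Real.pi) ^ k * ((1 + ‖ξ‖) ^ k * ‖(𝓕 g) ξ‖) := by ring
      _ ≤ (2 * Real.pi) ^ k * (C * ((wt 1 ξ)⁻¹ * (2 * Real.pi))) := by gcongr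
      _ = _ := by ring
  have hm : MemLp (fun ξ => ((2 * Real.pi) ^ k * C : ℝ) * (wt 1 ξ : ℂ)⁻¹ *
      (2 * Real.pi : ℝ)) 2 volume := by
    have := ((memLp_wt_inv (α := 1) (by norm_num)).const_mul
      (((2 * Real.pi) ^ k * C : ℝ) : ℂ)).mul_const ((2 * Real.pi : ℝ) : ℂ)
    exact this
  have hL : MemLp (fun ξ => (wt α ξ : ℂ) * (𝓕 g) ξ) 2 volume :=
    hm.of_le ((Complex.continuous_ofReal.comp (continuous_wt α)).mul
      (𝓕 g).continuous).aestronglyMeasurable (Eventually.of_forall hb)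
  refine memSob_of_fourierL2 (g.memLp 2) ?_ hL
  filter_upwards [fourierL2_schwartz g] with ξ h
  rw [h]

lemma IsTest.memSob {η : ℝ → ℂ} (hη : IsTest η) (α : ℝ) : MemSob α η :=
  memSob_schwartz α (hη.2.toSchwartzMap hη.1)

/-- Multiplication by a character on `L²`. -/
def charMul (s : ℝ) (F : Lp ℂ 2 (volume : Measure ℝ)) : Lp ℂ 2 (volume : Measure ℝ) :=
  (MemLp.char_mul (Lp.memLp F) s).toLp _

lemma charMul_ae (s : ℝ) (F : Lp ℂ 2 (volume : Measure ℝ)) :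
    (charMul s F : ℝ → ℂ) =ᵐ[volume] fun ξ => char s ξ * F ξ :=
  MemLp.coeFn_toLp _

lemma MemSob.comp_add {α : ℝ} {f : ℝ → ℂ} (hf : MemSob α f) (s : ℝ) :
    MemSob α (fun u => f (u + s)) := by
  refine memSob_of_fourierL2 (MemLp.comp_add_right' hf.1 s) ?_ (MemLp.char_mul hf.memLp_wt_mul s)
  filter_upwards [fourierL2_comp_add hf.1 s] with ξ h
  rw [h, mul_left_comm]

lemma coef_comp_add {α : ℝ} {f : ℝ → ℂ} (hf : MemSob α f) (s : ℝ) :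
    coef α (fun u => f (u + s)) = charMul s (coef α f) := by
  refine Lp.ext ?_
  filter_upwards [hf.coef_ae, (hf.comp_add s).coef_ae, fourierL2_comp_add hf.1 s,
    charMul_ae s (coef α f)] with ξ h1 h2 h3 h4
  rw [h2, h3, h4, h1, mul_left_comm]

lemma continuous_charMul (F : Lp ℂ 2 (volume : Measure ℝ)) : Continuous fun s => charMul s F := by
  refine continuous_iff_continuousAt.2 fun s₀ => ?_
  rw [ContinuousAt, Lp.tendsto_Lp_iff_tendsto_eLpNorm']
  have hae (s : ℝ) : eLpNorm ((charMul s F : ℝ → ℂ) - (charMul s₀ F : ℝ → ℂ)) 2 volume =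
      (∫⁻ ξ, ‖(char s ξ - char s₀ ξ) * F ξ‖ₑ ^ (2 : ℝ)) ^ (1 / 2 : ℝ) := by
    rw [eLpNorm_eq_lintegral_rpow_enorm_toReal (by norm_num) (by norm_num)]
    simp only [ENNReal.toReal_ofNat]
    congr 1
    refine lintegral_congr_ae ?_
    filter_upwards [charMul_ae s F, charMul_ae s₀ F] with ξ h1 h2
    rw [Pi.sub_apply, h1, h2, sub_mul]
  simp only [hae]
  have hFm : Measurable F := (Lp.stronglyMeasurable F).measurable
  have hlim : Tendsto (fun s => ∫⁻ ξ, ‖(char s ξ - char s₀ ξ) * F ξ‖ₑ ^ (2 : ℝ)) (𝓝 s₀)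
      (𝓝 (∫⁻ _ : ℝ, 0)) := by
    refine tendsto_lintegral_filter_of_dominated_convergence
      (fun ξ => (2 * ‖F ξ‖ₑ) ^ (2 : ℝ)) (Eventually.of_forall fun s => ?_)
      (Eventually.of_forall fun s => Eventually.of_forall fun ξ => ?_) ?_
      (Eventually.of_forall fun ξ => ?_)
    · exact ((((continuous_char_right s).measurable.sub
        (continuous_char_right s₀).measurable).mul hFm).enorm).pow_const _
    · refine ENNReal.rpow_le_rpow ?_ (by norm_num)
      rw [enorm_mul]
      refine mul_le_mul_left ?_ _
      refine (enorm_sub_le).trans ?_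
      rw [← ofReal_norm, ← ofReal_norm, norm_char, norm_char]
      norm_num
    · simp only [ENNReal.mul_rpow_of_nonneg _ _ (by norm_num : (0 : ℝ) ≤ 2)]
      rw [lintegral_const_mul _ (hFm.enorm.pow_const _)]
      refine ENNReal.mul_ne_top (by norm_num) ?_
      have := lintegral_rpow_enorm_lt_top_of_eLpNorm_lt_top (p := 2) (by norm_num) (by norm_num)
        (Lp.memLp F).2
      simpa using this.ne
    · have hc : Continuous fun s => ‖(char s ξ - char s₀ ξ) * F ξ‖ₑ ^ (2 : ℝ) := by
        have : Continuous fun s => char s ξ := by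
          unfold char
          fun_prop
        exact (ENNReal.continuous_rpow_const).comp
          ((this.sub continuous_const).mul continuous_const).enorm
      have := hc.tendsto s₀
      simpa using this
  have := (ENNReal.continuous_rpow_const (y := 1 / 2)).tendsto _ |>.comp hlim
  simpa [Function.comp_def] using this

lemma ae_eq_zero_of_fourierInv_eq_zero {p : ℝ → ℂ} (hp : Integrable p) (h : ∀ s, (𝓕⁻ p) s = 0) :
    p =ᵐ[volume] 0 := by
  refine ae_eq_of_forall_schwartz hp.locallyIntegrable (locallyIntegrable_zero) fun η => ?_
  have h1 := integral_mul_fourierInv hp (𝓕 η)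
  rw [FourierTransform.fourierInv_fourier_eq] at h1
  rw [← h1]
  simp [h]

lemma exists_isTest_fourier_zero_ne : ∃ η : 𝓢(ℝ, ℂ), IsTest η ∧ (𝓕 η) 0 ≠ 0 := by
  let b : ContDiffBump (0 : ℝ) := ⟨1, 2, by norm_num, by norm_num⟩
  have hc : HasCompactSupport fun u => (b u : ℂ) :=
    b.hasCompactSupport.comp_left (g := Complex.ofReal) rfl
  have hs : ContDiff ℝ (⊤ : ℕ∞) fun u => (b u : ℂ) := Complex.ofRealCLM.contDiff.comp b.contDiff
  refine ⟨hc.toSchwartzMap hs, ⟨hs, hc⟩, ?_⟩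
  rw [SchwartzMap.fourier_coe, Real.fourier_eq']
  simp only [inner_zero_right, mul_zero, Complex.ofReal_zero, zero_mul, Complex.exp_zero, one_smul]
  change ∫ u, (b u : ℂ) ≠ 0
  have h : ∫ u, (b u : ℂ) = ((∫ u, b u : ℝ) : ℂ) := integral_ofReal
  rw [h]
  exact_mod_cast (b.integral_pos (μ := volume)).ne'

/-- If `K` is orthogonal to `coef α η` for all translates of `η`, the inverse Fourier transform of
`conj(coef α η) · K` vanishes, so `K = 0` a.e. where `η̂ ≠ 0`. Modulated test functions bring a
neighbourhood of each frequency into that set. -/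
lemma dense_span_coef_isTest {α : ℝ} :
    Dense (Submodule.span ℂ {F | ∃ η, IsTest η ∧ F = coef α η} : Set (Lp ℂ 2 (volume : Measure ℝ))) := by
  rw [Submodule.dense_iff_topologicalClosure_eq_top, Submodule.topologicalClosure_eq_top_iff,
    Submodule.eq_bot_iff]
  intro K hK
  have horth (η : ℝ → ℂ) (hη : IsTest η) : inner ℂ (coef α η) K = 0 :=
    Submodule.inner_right_of_mem_orthogonal 
      (Submodule.subset_span (s := {F | ∃ η, IsTest η ∧ F = coef α η}) ⟨η, hη, rfl⟩) hK
  have hzero (η : 𝓢(ℝ, ℂ)) (hη : IsTest η) : ∀ᵐ ξ, (𝓕 η) ξ ≠ 0 → K ξ = 0 := by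
    have hS := hη.memSob α
    have hint : Integrable fun ξ => (starRingEnd ℂ) (coef α η ξ) * K ξ := by
      have := L2.integrable_inner (𝕜 := ℂ) (coef α η) K
      simpa only [RCLike.inner_apply, mul_comm] using this
    have h0 : ∀ s, (𝓕⁻ fun ξ => (starRingEnd ℂ) (coef α η ξ) * K ξ) s = 0 := by
      intro s
      have ht : IsTest fun u => η (u + -s) :=
        ⟨hη.1.comp (contDiff_id.add contDiff_const),
          hη.2.comp_homeomorph (Homeomorph.addRight (-s))⟩
      rw [fourierInv_eq_char, ← horth _ ht, coef_comp_add hS, L2.inner_def]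
      refine integral_congr_ae ?_
      filter_upwards [charMul_ae (-s) (coef α η)] with ξ h
      rw [h, RCLike.inner_apply, map_mul, conj_char, neg_neg]
      ring
    filter_upwards [ae_eq_zero_of_fourierInv_eq_zero hint h0, hS.coef_ae,
      fourierL2_schwartz η] with ξ h1 h2 h3 h4
    rw [h2, h3, Pi.zero_apply, mul_eq_zero] at h1
    refine h1.resolve_left ?_
    rw [map_eq_zero]
    exact mul_ne_zero (wt_ne_zero α ξ) h4
  obtain ⟨η, hη, hη0⟩ := exists_isTest_fourier_zero_ne
  have hnull : volume {ξ : ℝ | K ξ ≠ 0} = 0 := by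
    refine measure_null_of_locally_null _ fun t _ => ?_
    -- Multiplication by `char t` shifts `η̂` by `t`, so that it is nonzero near `t`.
    have hmod : IsTest fun u => char t u * η u := by
      refine ⟨ContDiff.mul ?_ hη.1, hη.2.mul_left⟩
      unfold char
      have : ContDiff ℝ (⊤ : ℕ∞) fun u : ℝ => (u : ℂ) := Complex.ofRealCLM.contDiff
      exact ((contDiff_const.mul this).mul contDiff_const).cexp
    have hF (ξ : ℝ) : (𝓕 (hmod.2.toSchwartzMap hmod.1)) ξ = (𝓕 η) (ξ - t) := by
      rw [SchwartzMap.fourier_coe, SchwartzMap.fourier_coe, Real.fourier_eq', Real.fourier_eq']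
      congr 1
      ext u
      change _ • (char t u * η u) = _
      rw [char, smul_eq_mul, smul_eq_mul, ← mul_assoc, ← Complex.exp_add]
      congr 2
      simp
      ring
    have hz := hzero (hmod.2.toSchwartzMap hmod.1) hmod
    have hcont : Continuous fun ξ => (𝓕 η) (ξ - t) :=
      (𝓕 η).continuous.comp (continuous_id.sub continuous_const)
    have hopen : {ξ | (𝓕 η) (ξ - t) ≠ 0} ∈ 𝓝 t := by
      refine (isOpen_ne_fun hcont continuous_const).mem_nhds ?_
      simpa using hη0
    refine ⟨{ξ | K ξ ≠ 0} ∩ {ξ | (𝓕 η) (ξ - t) ≠ 0},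
      inter_mem self_mem_nhdsWithin (mem_nhdsWithin_of_mem_nhds hopen), ?_⟩
    refine measure_mono_null ?_ (ae_iff.1 hz)
    rintro ξ ⟨h1, h2⟩
    simp only [mem_ofPred_eq, Classical.not_imp]
    exact ⟨by rw [hF]; exact h2, h1⟩
  refine Lp.ext ?_
  have : ∀ᵐ ξ, K ξ = 0 := ae_iff.2 hnull
  filter_upwards [this, Lp.coeFn_zero ℂ 2 (volume : Measure ℝ)] with ξ h1 h2
  rw [h1, h2, Pi.zero_apply]

lemma clm_ext_of_isTest {α : ℝ} {E : Type*} [AddCommMonoid E] [Module ℂ E] [TopologicalSpace E]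
    [T2Space E] {S T : Lp ℂ 2 (volume : Measure ℝ) →L[ℂ] E}
    (h : ∀ η, IsTest η → S (coef α η) = T (coef α η)) : S = T := by
  refine ContinuousLinearMap.ext_on (dense_span_coef_isTest (α := α)) ?_
  rintro F ⟨η, hη, rfl⟩
  exact h η hη

lemma synth_add {α : ℝ} (hα : 1 / 2 < α) (F G : Lp ℂ 2 (volume : Measure ℝ)) (u : ℝ) :
    synth α (F + G) u = synth α F u + synth α G u := by
  simp only [← evalCLM_apply hα, map_add]

lemma synth_smul {α : ℝ} (hα : 1 / 2 < α) (c : ℂ) (F : Lp ℂ 2 (volume : Measure ℝ)) (u : ℝ) :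
    synth α (c • F) u = c * synth α F u := by
  simp only [← evalCLM_apply hα, map_smul, smul_eq_mul]

/-- Transporting the product to `L²` makes it a continuous bilinear map, so that multiplicativity
extends by density and products pass through Bochner integrals. -/
lemma exists_mulH {α : ℝ} (hα : 1 / 2 < α) :
    ∃ m : Lp ℂ 2 (volume : Measure ℝ) →L[ℂ] Lp ℂ 2 (volume : Measure ℝ) →L[ℂ]
      Lp ℂ 2 (volume : Measure ℝ), ∀ f g, MemSob α f → MemSob α g →
        m (coef α f) (coef α g) = coef α (fun u => f u * g u) := by
  obtain ⟨C, hC⟩ := exists_memSob_mul hα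
  have hs := memSob_synth hα
  have hm (F G : Lp ℂ 2 (volume : Measure ℝ)) := (hC _ _ (hs F) (hs G)).1
  let m₀ : Lp ℂ 2 (volume : Measure ℝ) →ₗ[ℂ] Lp ℂ 2 (volume : Measure ℝ) →ₗ[ℂ]
      Lp ℂ 2 (volume : Measure ℝ) := LinearMap.mk₂ ℂ (fun F G => coef α fun u => synth α F u * synth α G u)
    (fun F F' G => by
      rw [← coef_add (hm F G) (hm F' G)]
      congr 1; ext u; rw [synth_add hα]; ring)
    (fun c F G => by
      rw [← coef_const_mul (hm F G)]
      congr 1; ext u; rw [synth_smul hα]; ring)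
    (fun F G G' => by
      rw [← coef_add (hm F G) (hm F G')]
      congr 1; ext u; rw [synth_add hα]; ring)
    (fun c F G => by
      rw [← coef_const_mul (hm F G)]
      congr 1; ext u; rw [synth_smul hα]; ring)
  have hbd (F G : Lp ℂ 2 (volume : Measure ℝ)) : ‖m₀ F G‖ ≤ C * ‖F‖ * ‖G‖ := by
    have h := (hC _ _ (hs F) (hs G)).2
    rw [← (hm F G).enorm_coef, ← (hs F).enorm_coef, ← (hs G).enorm_coef, coef_synth hα,
      coef_synth hα] at h
    have h' : ‖m₀ F G‖₊ ≤ C * ‖F‖₊ * ‖G‖₊ := by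
      simp only [enorm_eq_nnnorm] at h
      exact_mod_cast h
    exact_mod_cast h'
  refine ⟨m₀.mkContinuous₂ C hbd, fun f g hf hg => ?_⟩
  rw [LinearMap.mkContinuous₂_apply]
  refine coef_congr ?_
  filter_upwards [synth_coef hα hf, synth_coef hα hg] with u h1 h2
  rw [h1, h2]

/-- The product of `W^α_2`, transported to weighted Fourier transforms. -/
def mulH {α : ℝ} (hα : 1 / 2 < α) : Lp ℂ 2 (volume : Measure ℝ) →L[ℂ]
    Lp ℂ 2 (volume : Measure ℝ) →L[ℂ] Lp ℂ 2 (volume : Measure ℝ) := (exists_mulH hα).choose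

lemma mulH_coef {α : ℝ} (hα : 1 / 2 < α) {f g : ℝ → ℂ} (hf : MemSob α f) (hg : MemSob α g) :
    mulH hα (coef α f) (coef α g) = coef α (fun u => f u * g u) :=
  (exists_mulH hα).choose_spec f g hf hg

end Density

/-! ### The Sobolev calculus as a bounded map on `L²` -/

section CalculusMap

lemma memSob_fourierInv {α : ℝ} {F G : ℝ → ℂ} (hF : Integrable F) (hF2 : MemLp F 2 volume)
    (hG : MemLp G 2 volume) (hFG : ∀ ξ, (wt α ξ : ℂ) * F ξ = G ξ) :
    MemSob α (𝓕⁻ F) ∧ coef α (𝓕⁻ F) = hG.toLp G := by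
  obtain ⟨h1, h2⟩ := fourierInv_memLp hF hF2
  have h3 : (fun ξ => (wt α ξ : ℂ) * fourierL2 (𝓕⁻ F) ξ) =ᵐ[volume] G := by
    filter_upwards [h2] with ξ e
    rw [e, hFG]
  have hS := memSob_of_fourierL2 h1 h3 hG
  exact ⟨hS, Lp.ext ((hS.coef_ae.trans h3).trans hG.coeFn_toLp.symm)⟩

lemma pull_bandFun (F : ℝ → ℂ) : (pull fun s => bandFun F s) = 𝓕⁻ F :=
  funext fun u => bandFun_exp F u

lemma memSob_bandFun_approxDelta (α : ℝ) (n : ℕ) :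
    MemSob α (pull fun s => bandFun (approxDelta n) s) := by
  rw [pull_bandFun]
  obtain ⟨C, hC⟩ := (isCompact_Icc (a := (-1 : ℝ)) (b := 1)).exists_bound_of_continuousOn
    (continuous_wt α).continuousOn
  have hL : MemLp (fun ξ => (wt α ξ : ℂ) * approxDelta n ξ) 2 volume := by
    refine ((memLp_approxDelta n 2).const_mul (C : ℂ)).of_le
      ((Complex.continuous_ofReal.comp (continuous_wt α)).aestronglyMeasurable.mul
        (memLp_approxDelta n 2).aestronglyMeasurable) (Eventually.of_forall fun ξ => ?_)
    by_cases h : 1 < |ξ|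
    · rw [approxDelta_eq_zero n h, mul_zero, norm_zero]
      exact norm_nonneg _
    · rw [norm_mul, norm_mul, Complex.norm_real, Complex.norm_real]
      exact mul_le_mul_of_nonneg_right ((hC ξ (abs_le.1 (not_lt.1 h))).trans (le_abs_self C))
        (norm_nonneg _)
  exact (memSob_fourierInv (memLp_one_iff_integrable.1 (memLp_approxDelta n 1))
    (memLp_approxDelta n 2) hL fun ξ => rfl).1

/-- The functions which are bounded and holomorphic on all sectors and lie in `𝓦^α_2`. -/
def holAlg (α : ℝ) : Submodule ℂ (ℂ → ℂ) where
  carrier := {g | IsHInf g ∧ MemSob α (pull fun s => g s)}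
  add_mem' := fun hf hg => ⟨hf.1.add hg.1, hf.2.add hg.2⟩
  zero_mem' := by
    refine ⟨isHInf_const 0, ?_⟩
    have := (memSob_bandFun_approxDelta α 0).const_mul 0
    simp only [zero_mul] at this
    exact this
  smul_mem' := fun c _ hf => ⟨(isHInf_const c).mul hf.1, hf.2.const_mul c⟩

/-- `coef` on `holAlg`. -/
def coefLin (α : ℝ) : holAlg α →ₗ[ℂ] Lp ℂ 2 (volume : Measure ℝ) where
  toFun g := coef α (pull fun s => (g : ℂ → ℂ) s)
  map_add' f g := coef_add f.2.2 g.2.2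
  map_smul' c g := coef_const_mul g.2.2 c

/-- Continuous compactly supported functions are dense in `L²`. Divided by the weight they keep
compact support, and so are densities of functions `bandFun` that are holomorphic on all sectors. -/
lemma denseRange_coefLin (α : ℝ) : DenseRange (coefLin α) := by
  refine Metric.denseRange_iff.2 fun F ε hε => ?_
  obtain ⟨g, hgc, hgF, hg, hg2⟩ := (Lp.memLp F).exists_hasCompactSupport_eLpNorm_sub_le
    (by norm_num) (ε := ENNReal.ofReal (ε / 2)) (by simpa using hε)
  set G : ℝ → ℂ := divWt α g with hG
  have hGc : Continuous G := ((Complex.continuous_ofReal.comp (continuous_wt α)).inv₀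
    (wt_ne_zero α)).mul hg
  have hGs : HasCompactSupport G := hgc.mul_left
  have hGi : Integrable G := hGc.integrable_of_hasCompactSupport hGs
  obtain ⟨h1, h2⟩ := memSob_fourierInv hGi (hGc.memLp_of_hasCompactSupport hGs) hg2
    (wt_mul_divWt α g)
  obtain ⟨R, hR⟩ := hGs.isBounded.subset_closedBall 0
  have hR' (ξ : ℝ) (h : R < |ξ|) : G ξ = 0 := by
    by_contra h0
    have := hR (subset_tsupport _ h0)
    rw [mem_closedBall_zero_iff, Real.norm_eq_abs] at this
    linarith
  refine ⟨⟨bandFun G, isHInf_bandFun hGi hR', by rwa [pull_bandFun]⟩, ?_⟩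
  have h3 : coefLin α ⟨bandFun G, isHInf_bandFun hGi hR', by rwa [pull_bandFun]⟩ = hg2.toLp g := by
    rw [← h2]
    exact congrArg (coef α) (pull_bandFun G)
  rw [h3, Lp.dist_def]
  have h4 : eLpNorm ((F : ℝ → ℂ) - (hg2.toLp g : ℝ → ℂ)) 2 volume =
      eLpNorm ((F : ℝ → ℂ) - g) 2 volume :=
    eLpNorm_congr_ae (EventuallyEq.rfl.sub hg2.coeFn_toLp)
  rw [h4]
  refine (ENNReal.toReal_le_of_le_ofReal (by linarith) hgF).trans_lt (by linarith)

variable {X : Type*} [NormedAddCommGroup X] [NormedSpace ℂ X]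
  {A : X →ₗ.[ℂ] X} {α : ℝ}

/-- `Φ` represents the Sobolev calculus of `A` on weighted Fourier transforms. -/
def IsCalc (A : X →ₗ.[ℂ] X) (α : ℝ)
    (Φ : Lp ℂ 2 (volume : Measure ℝ) →L[ℂ] (X →L[ℂ] X)) : Prop :=
  ∀ g : ℂ → ℂ, IsHInf g → MemSob α (pull fun s => g s) →
    IsHolOp A g (Φ (coef α (pull fun s => g s)))

variable {Φ : Lp ℂ 2 (volume : Measure ℝ) →L[ℂ] (X →L[ℂ] X)}

lemma IsCalc.tendsto_rho (hΦ : IsCalc A α Φ) (hA : IsZeroSectorial A) :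
    Tendsto (fun n => cauchyOp A 1 rho * Φ (coef α (pull fun s => bandFun (approxDelta n) s))) atTop
      (𝓝 (cauchyOp A 1 rho)) := by
  have h1 : (1 : ℝ) ∈ Ioo 0 Real.pi := ⟨one_pos, by linarith [Real.pi_gt_three]⟩
  refine Tendsto.congr (fun n => ?_) (tendsto_cauchyOp_rho_mul hA h1 isHInf_bandFun_approxDelta
    (fun n r _ θ _ => norm_bandFun_approxDelta_le n _) tendsto_bandFun_approxDelta)
  exact ((hΦ _ (isHInf_bandFun_approxDelta n) (memSob_bandFun_approxDelta α n)).mul_eq h1).symm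

variable [CompleteSpace X]

/-- Uniqueness of `f(A)`, that is, injectivity of `ρ(A)`, makes the chosen operators linear in `f`;
the norm estimate extends them from the dense range of `coefLin`. -/
lemma exists_isCalc (hA : IsZeroSectorial A) (h : HasSobolevCalculus A α) :
    ∃ Φ, IsCalc A α Φ := by
  obtain ⟨C, hC⟩ := h
  have hex (g : holAlg α) := hC g g.2.1 g.2.2
  choose T hT hTC using hex
  let T₀ : holAlg α →ₗ[ℂ] (X →L[ℂ] X) :=
    { toFun := T
      map_add' := fun f g =>
        (hT (f + g)).unique ((hT f).add (hT g) f.2.1 g.2.1 hA) hA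
      map_smul' := fun c g => (hT (c • g)).unique ((hT g).smul c) hA }
  have hb (g : holAlg α) : ‖T₀ g‖ ≤ C * ‖coefLin α g‖ := by
    have h1 := hTC g
    rw [← g.2.2.enorm_coef] at h1
    simp only [enorm_eq_nnnorm] at h1
    exact_mod_cast h1
  refine ⟨T₀.extendOfNorm (coefLin α), fun g hg hgS => ?_⟩
  have := LinearMap.extendOfNorm_eq (denseRange_coefLin α) ⟨C, hb⟩ ⟨g, hg, hgS⟩
  have h2 : T₀.extendOfNorm (coefLin α) (coef α (pull fun s => g s)) = T ⟨g, hg, hgS⟩ := this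
  rw [h2]
  exact hT ⟨g, hg, hgS⟩

lemma MemSob.sub {f g : ℝ → ℂ} (hf : MemSob α f) (hg : MemSob α g) :
    MemSob α (fun u => f u - g u) ∧ coef α (fun u => f u - g u) = coef α f - coef α g := by
  have e : (fun u => f u - g u) = fun u => f u + (-1) * g u := by ext u; ring
  rw [e]
  refine ⟨hf.add (hg.const_mul _), ?_⟩
  rw [coef_add hf (hg.const_mul _), coef_const_mul hg]
  module

/-- The sequential extension of the calculus is thus single valued and everywhere defined, and the
set that is `R`-bounded by hypothesis is the image of the unit ball under `Φ`. -/
lemma IsCalc.isSobOp_iff (hΦ : IsCalc A α Φ) (hA : IsZeroSectorial A) {f : ℝ → ℂ}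
    {T : X →L[ℂ] X} : IsSobOp A α f T ↔ MemSob α (pull f) ∧ T = Φ (coef α (pull f)) := by
  have key (g : ℕ → ℂ → ℂ) (hf : MemSob α (pull f)) (hg : ∀ n, MemSob α (pull fun s => g n s)) :
      Tendsto (fun n => sobNorm α (pull fun s => g n s - f s)) atTop (𝓝 0) ↔
        Tendsto (fun n => coef α (pull fun s => g n s)) atTop (𝓝 (coef α (pull f))) := by
    have h (n : ℕ) : sobNorm α (pull fun s => g n s - f s) =
        ‖coef α (pull fun s => g n s) - coef α (pull f)‖ₑ := by
      have := (hg n).sub hf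
      rw [← this.2, this.1.enorm_coef]
      rfl
    simp only [h]
    rw [tendsto_iff_edist_tendsto_0]
    simp only [edist_eq_enorm_sub]
  constructor
  · rintro ⟨hf, g, S, hg, hlim, hS⟩
    refine ⟨hf, tendsto_nhds_unique hS ?_⟩
    have h1 (n : ℕ) : S n = Φ (coef α (pull fun s => g n s)) :=
      (hg n).2.2.unique (hΦ _ (hg n).1 (hg n).2.1) hA
    rw [funext h1]
    exact (Φ.continuous.tendsto _).comp ((key g hf fun n => (hg n).2.1).1 hlim)
  · rintro ⟨hf, rfl⟩
    obtain ⟨G, hG, hlim⟩ := mem_closure_iff_seq_limit.1 (denseRange_coefLin α (coef α (pull f)))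
    choose g hg using hG
    have h1 (n : ℕ) : G n = coef α (pull fun s => (g n : ℂ → ℂ) s) := (hg n).symm
    rw [funext h1] at hlim
    exact ⟨hf, fun n => g n, fun n => Φ (coef α (pull fun s => (g n : ℂ → ℂ) s)),
      fun n => ⟨(g n).2.1, (g n).2.2, hΦ _ (g n).2.1 (g n).2.2⟩,
      (key (fun n => g n) hf fun n => (g n).2.2).2 hlim, (Φ.continuous.tendsto _).comp hlim⟩

lemma IsCalc.sobOp_eq (hΦ : IsCalc A α Φ) (hA : IsZeroSectorial A) {f : ℝ → ℂ}
    (hf : MemSob α (pull f)) : sobOp A α f = Φ (coef α (pull f)) := by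
  have h : ∃ T, IsSobOp A α f T := ⟨_, (hΦ.isSobOp_iff hA).2 ⟨hf, rfl⟩⟩
  rw [sobOp, dif_pos h]
  exact ((hΦ.isSobOp_iff hA).1 h.choose_spec).2

lemma IsCalc.map_mulH (hΦ : IsCalc A α Φ) (hA : IsZeroSectorial A) (hα : 1 / 2 < α)
    (F G : Lp ℂ 2 (volume : Measure ℝ)) : Φ (mulH hα F G) = Φ F * Φ G := by
  refine (denseRange_coefLin α).induction_on₂
    (p := fun F G => Φ (mulH hα F G) = Φ F * Φ G) ?_ (fun f g => ?_) F G
  · refine isClosed_eq ?_ ?_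
    · exact Φ.continuous.comp ((mulH hα).continuous₂)
    · exact (Φ.continuous.comp continuous_fst).mul (Φ.continuous.comp continuous_snd)
  · have h1 := mulH_coef hα f.2.2 g.2.2
    have h2 := (hΦ f f.2.1 f.2.2).mul (hΦ g g.2.1 g.2.2) f.2.1 g.2.1 hA
    have h3 := hΦ (fun l => (f : ℂ → ℂ) l * (g : ℂ → ℂ) l) (f.2.1.mul g.2.1)
      (f.2.2.mul hα g.2.2)
    change Φ (mulH hα (coef α (pull fun s => (f : ℂ → ℂ) s))
      (coef α (pull fun s => (g : ℂ → ℂ) s))) = _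
    rw [h1]
    exact h3.unique h2 hA

lemma IsCalc.map_coef_mul (hΦ : IsCalc A α Φ) (hA : IsZeroSectorial A) (hα : 1 / 2 < α)
    {f g : ℝ → ℂ} (hf : MemSob α f) (hg : MemSob α g) :
    Φ (coef α fun u => f u * g u) = Φ (coef α f) * Φ (coef α g) := by
  rw [← mulH_coef hα hf hg, hΦ.map_mulH hA]

/-- By density `Φ F x = 0` for every `F`; along the approximations of `1` this forces `ρ(A)x = 0`,
and `ρ(A)` is injective. -/
lemma IsCalc.eq_zero_of_forall (hΦ : IsCalc A α Φ) (hA : IsZeroSectorial A) {x : X}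
    (hx : ∀ η, IsTest η → Φ (coef α η) x = 0) : x = 0 := by
  have h1 : (1 : ℝ) ∈ Ioo 0 Real.pi := ⟨one_pos, by linarith [Real.pi_gt_three]⟩
  have h2 : (ContinuousLinearMap.apply ℂ X x).comp Φ = 0 :=
    clm_ext_of_isTest (α := α) fun η hη => by simpa using hx η hη
  have h3 (F : Lp ℂ 2 (volume : Measure ℝ)) : Φ F x = 0 := DFunLike.congr_fun h2 F
  have h4 := ((ContinuousLinearMap.apply ℂ X x).continuous.tendsto _).comp (hΦ.tendsto_rho hA)
  have h5 : cauchyOp A 1 rho x = 0 := by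
    refine tendsto_nhds_unique h4 ?_
    simp [Function.comp_def, h3]
  exact hA.cauchyOp_rho_injective h1 (h5.trans (map_zero _).symm)

/-- The closure of `V` contains every `Φ F x`, hence in the limit the range of `ρ(A)`, which is
dense. -/
lemma IsCalc.dense_of_forall_mem (hΦ : IsCalc A α Φ) (hA : IsZeroSectorial A) {V : Submodule ℂ X}
    (hV : ∀ η, IsTest η → ∀ x, Φ (coef α η) x ∈ V) : Dense (V : Set X) := by
  have h1 : (1 : ℝ) ∈ Ioo 0 Real.pi := ⟨one_pos, by linarith [Real.pi_gt_three]⟩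
  have h2 (x : X) (F : Lp ℂ 2 (volume : Measure ℝ)) : Φ F x ∈ V.topologicalClosure := by
    have hc : IsClosed {F | Φ F x ∈ V.topologicalClosure} :=
      V.isClosed_topologicalClosure.preimage
        ((ContinuousLinearMap.apply ℂ X x).comp Φ).continuous
    refine hc.closure_subset_iff.2 ?_ (dense_span_coef_isTest (α := α) F)
    intro F hF
    refine Submodule.span_le (p := V.topologicalClosure.comap
      ((ContinuousLinearMap.apply ℂ X x).comp Φ : Lp ℂ 2 (volume : Measure ℝ) →ₗ[ℂ] X)) |>.2 ?_ hF
    rintro _ ⟨η, hη, rfl⟩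
    exact V.le_topologicalClosure (hV η hη x)
  have h3 (x : X) : cauchyOp A 1 rho x ∈ V.topologicalClosure := by
    have h4 := ((ContinuousLinearMap.apply ℂ X x).continuous.tendsto _).comp (hΦ.tendsto_rho hA)
    refine V.isClosed_topologicalClosure.mem_of_tendsto h4 (Eventually.of_forall fun n => ?_)
    -- Commuting with `ρ(A)` places the approximating vectors in the range of some `Φ F`, where the
    -- previous claim applies.
    have h5 := (hΦ _ (isHInf_bandFun_approxDelta n) (memSob_bandFun_approxDelta α n)).commute
      (isHInf_bandFun_approxDelta n) hA h1
    have h6 : (cauchyOp A 1 rho * Φ (coef α (pull fun s => bandFun (approxDelta n) s))) x ∈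
        V.topologicalClosure := by
      rw [← h5]
      exact h2 _ _
    exact h6
  rw [Submodule.dense_iff_topologicalClosure_eq_top, eq_top_iff]
  intro x _
  exact (V.isClosed_topologicalClosure.closure_subset_iff (s := range (cauchyOp A 1 rho))).2
    (by rintro _ ⟨y, rfl⟩; exact h3 y) (hA.cauchyOp_rho_denseRange h1 x)

end CalculusMap

/-! ### The core `D_A` and the closed operators `f(A)` -/

section Core

variable {ψ : ℝ → ℂ}

lemma pull_dyad_eq_zero (hψ : IsDyadicPartition ψ) {n : ℤ} {u : ℝ}
    (h : Real.log 2 < |u - n * Real.log 2|) : pull (dyad ψ n) u = 0 := by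
  have h2 : (2 : ℝ) ^ (-n) * Real.exp u = Real.exp (u - n * Real.log 2) := by
    rw [Real.exp_sub, mul_comm (n : ℝ), Real.exp_mul, Real.exp_log two_pos, Real.rpow_intCast,
      zpow_neg, div_eq_inv_mul]
  rw [pull, dyad, h2]
  refine image_eq_zero_of_notMem_tsupport fun hm => ?_
  obtain ⟨h3, h4⟩ := hψ.tsupport_subset hm
  have h5 := Real.log_le_log (by norm_num) h3
  have h6 := Real.log_le_log (Real.exp_pos _) h4
  rw [Real.log_exp] at h5 h6
  rw [one_div, Real.log_inv] at h5
  exact absurd (abs_le.2 ⟨h5, h6⟩) (not_le.2 h)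

lemma isTest_pull_dyad (hψ : IsDyadicPartition ψ) (n : ℤ) : IsTest (pull (dyad ψ n)) := by
  refine ⟨hψ.contDiff.comp (contDiff_const.mul Real.contDiff_exp), ?_⟩
  refine HasCompactSupport.intro (isCompact_closedBall ((n : ℝ) * Real.log 2) (Real.log 2))
    fun u hu => pull_dyad_eq_zero hψ ?_
  rwa [Metric.mem_closedBall, not_le, Real.dist_eq] at hu

/-- In the logarithmic variable `ψ_n` lives on the interval of radius `log 2` about `n log 2`;
indices at distance three or more give disjoint intervals. -/
lemma pull_dyad_mul_eq_zero (hψ : IsDyadicPartition ψ) {m n : ℤ} (h : 3 ≤ |m - n|) (u : ℝ) :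
    pull (dyad ψ m) u * pull (dyad ψ n) u = 0 := by
  by_cases hm : Real.log 2 < |u - m * Real.log 2|
  · rw [pull_dyad_eq_zero hψ hm, zero_mul]
  · have h2 : 0 < Real.log 2 := Real.log_pos (by norm_num)
    rw [pull_dyad_eq_zero hψ (n := n), mul_zero]
    have h3 : (3 : ℝ) ≤ |(m : ℝ) - n| := by exact_mod_cast h
    have h4 : |((m : ℝ) - n) * Real.log 2| ≤ |u - m * Real.log 2| + |u - n * Real.log 2| := by
      rw [abs_sub_comm u (m * Real.log 2)]
      refine le_trans (le_of_eq ?_) (abs_add_le _ _)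
      congr 1
      ring
    rw [abs_mul, abs_of_pos h2] at h4
    nlinarith [not_lt.1 hm]

/-- The partial sums `∑_{|n| ≤ M} ψ_n` of the partition of unity. -/
def partSum (ψ : ℝ → ℂ) (M : ℕ) : ℝ → ℂ :=
  fun u => ∑ n ∈ Finset.Icc (-(M : ℤ)) M, pull (dyad ψ n) u

lemma isTest_zero : IsTest fun _ => 0 := ⟨contDiff_const, HasCompactSupport.zero⟩

lemma IsTest.finset_sum {ι : Type*} (s : Finset ι) {η : ι → ℝ → ℂ} (h : ∀ i, IsTest (η i)) :
    IsTest fun u => ∑ i ∈ s, η i u := by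
  classical
  induction s using Finset.induction_on with
  | empty => simpa using isTest_zero
  | insert i s hi ih =>
    simp only [Finset.sum_insert hi]
    exact ⟨(h i).1.add ih.1, (h i).2.add ih.2⟩

lemma isTest_partSum (hψ : IsDyadicPartition ψ) (M : ℕ) : IsTest (partSum ψ M) :=
  IsTest.finset_sum _ (isTest_pull_dyad hψ)

lemma exists_pull_dyad_eq_zero (hψ : IsDyadicPartition ψ) {η : ℝ → ℂ} (hη : HasCompactSupport η) :
    ∃ M : ℕ, ∀ n : ℤ, (M : ℤ) ≤ |n| → ∀ u, η u ≠ 0 → pull (dyad ψ n) u = 0 := by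
  have h2 : 0 < Real.log 2 := Real.log_pos (by norm_num)
  obtain ⟨R, hR⟩ := hη.isBounded.subset_closedBall 0
  obtain ⟨M, hM⟩ := exists_nat_gt ((R + Real.log 2) / Real.log 2)
  rw [div_lt_iff₀ h2] at hM
  refine ⟨M, fun n hn u hu => pull_dyad_eq_zero hψ ?_⟩
  have h3 := hR (subset_tsupport _ hu)
  rw [mem_closedBall_zero_iff, Real.norm_eq_abs] at h3
  have h4 : (M : ℝ) ≤ |(n : ℝ)| := by exact_mod_cast hn
  have h5 : |(n : ℝ) * Real.log 2| ≤ |u| + |u - n * Real.log 2| := by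
    rw [abs_sub_comm u]
    refine le_trans (le_of_eq ?_) (abs_add_le _ _)
    congr 1
    ring
  rw [abs_mul, abs_of_pos h2] at h5
  nlinarith

lemma sum_Icc_eq_of_forall {E : Type*} [AddCommMonoid E] {a : ℤ → E} {N M : ℕ} (hNM : N ≤ M)
    (h : ∀ n : ℤ, (N : ℤ) < |n| → a n = 0) :
    ∑ n ∈ Finset.Icc (-(M : ℤ)) M, a n = ∑ n ∈ Finset.Icc (-(N : ℤ)) N, a n := by
  refine (Finset.sum_subset (Finset.Icc_subset_Icc (by lia) (by lia)) fun n _ hn => h n ?_).symm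
  rw [Finset.mem_Icc, ← abs_le] at hn
  exact not_le.1 hn

lemma partSum_eq_one (hψ : IsDyadicPartition ψ) {M : ℕ} {u : ℝ}
    (h : ∀ n : ℤ, (M : ℤ) < |n| → pull (dyad ψ n) u = 0) : partSum ψ M u = 1 := by
  have h1 := hψ.hasSum (Real.exp u) (Real.exp_pos u)
  refine HasSum.unique (hasSum_sum_of_ne_finset_zero fun n hn => h n ?_) h1
  rw [Finset.mem_Icc, ← abs_le] at hn
  exact not_le.1 hn

lemma exists_mul_partSum_eq (hψ : IsDyadicPartition ψ) {η : ℝ → ℂ} (hη : HasCompactSupport η) :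
    ∃ M₀ : ℕ, ∀ M, M₀ ≤ M → ∀ u, η u * partSum ψ M u = η u := by
  obtain ⟨M₀, h⟩ := exists_pull_dyad_eq_zero hψ hη
  refine ⟨M₀, fun M hM u => ?_⟩
  by_cases hu : η u = 0
  · rw [hu, zero_mul]
  · rw [partSum_eq_one hψ fun n hn => h n (by lia) u hu, mul_one]

lemma pull_dyad_mul_partSum (hψ : IsDyadicPartition ψ) {N : ℕ} {n : ℤ} (hn : (N : ℤ) + 3 ≤ |n|)
    (u : ℝ) : pull (dyad ψ n) u * partSum ψ N u = 0 := by
  rw [partSum, Finset.mul_sum]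
  refine Finset.sum_eq_zero fun k hk => pull_dyad_mul_eq_zero hψ ?_ u
  rw [Finset.mem_Icc, ← abs_le] at hk
  have := abs_sub_abs_le_abs_sub n k
  lia

lemma partSum_mul_partSum (hψ : IsDyadicPartition ψ) {N M : ℕ} (hM : N + 3 ≤ M) (u : ℝ) :
    partSum ψ M u * partSum ψ N u = partSum ψ N u := by
  by_cases hu : partSum ψ N u = 0
  · rw [hu, mul_zero]
  · rw [partSum_eq_one hψ fun n hn => ?_, one_mul]
    exact (mul_eq_zero.1 (pull_dyad_mul_partSum hψ (N := N) (by lia) u)).resolve_right hu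

variable {X : Type*} [NormedAddCommGroup X] [NormedSpace ℂ X] [CompleteSpace X]
  {A : X →ₗ.[ℂ] X} {α : ℝ} {Φ : Lp ℂ 2 (volume : Measure ℝ) →L[ℂ] (X →L[ℂ] X)}

lemma coef_finset_sum {ι : Type*} (s : Finset ι) {η : ι → ℝ → ℂ} (h : ∀ i, MemSob α (η i)) :
    MemSob α (fun u => ∑ i ∈ s, η i u) ∧
      coef α (fun u => ∑ i ∈ s, η i u) = ∑ i ∈ s, coef α (η i) := by
  classical
  induction s using Finset.induction_on with
  | empty =>
    simp only [Finset.sum_empty]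
    have h0 := isTest_zero.memSob α
    refine ⟨h0, ?_⟩
    have := coef_const_mul h0 0
    simpa using this
  | insert i s hi ih =>
    simp only [Finset.sum_insert hi]
    exact ⟨(h i).add ih.1, by rw [coef_add (h i) ih.1, ih.2]⟩

lemma IsCalc.mem_core_iff (hΦ : IsCalc A α Φ) (hA : IsZeroSectorial A)
    (hψ : IsDyadicPartition ψ) {x : X} : x ∈ core A α ψ ↔
      ∃ N : ℕ, ∀ n : ℤ, (N : ℤ) ≤ |n| → Φ (coef α (pull (dyad ψ n))) x = 0 := by
  have h (n : ℤ) := hΦ.sobOp_eq hA ((isTest_pull_dyad hψ n).memSob α)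
  change (∃ N : ℕ, ∀ n : ℤ, (N : ℤ) ≤ |n| → sobOp A α (dyad ψ n) x = 0) ↔ _
  simp only [h]

lemma IsCalc.mem_core_of_isTest (hΦ : IsCalc A α Φ) (hA : IsZeroSectorial A) (hα : 1 / 2 < α)
    (hψ : IsDyadicPartition ψ) {η : ℝ → ℂ} (hη : IsTest η) (x : X) :
    Φ (coef α η) x ∈ core A α ψ := by
  obtain ⟨M, hM⟩ := exists_pull_dyad_eq_zero hψ hη.2
  refine (hΦ.mem_core_iff hA hψ).2 ⟨M, fun n hn => ?_⟩
  have h1 : (fun u => pull (dyad ψ n) u * η u) = fun u => (0 : ℂ) * η u := by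
    ext u
    by_cases hu : η u = 0
    · rw [hu, mul_zero, mul_zero]
    · rw [hM n hn u hu]
  have h2 := hΦ.map_coef_mul hA hα ((isTest_pull_dyad hψ n).memSob α) (hη.memSob α)
  rw [h1, coef_const_mul (hη.memSob α), zero_smul, map_zero] at h2
  exact (DFunLike.congr_fun h2 x).symm

lemma IsCalc.dense_core (hΦ : IsCalc A α Φ) (hA : IsZeroSectorial A) (hα : 1 / 2 < α)
    (hψ : IsDyadicPartition ψ) : Dense (core A α ψ : Set X) :=
  hΦ.dense_of_forall_mem hA fun _ hη x => hΦ.mem_core_of_isTest hA hα hψ hη x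

/-- Every test function is reproduced by a long partial sum, and beyond `N` the partial sums agree
on `x`. The difference of the two sides is therefore killed by all test functions. -/
lemma IsCalc.exists_partSum_apply (hΦ : IsCalc A α Φ) (hA : IsZeroSectorial A) (hα : 1 / 2 < α)
    (hψ : IsDyadicPartition ψ) {x : X} (hx : x ∈ core A α ψ) :
    ∃ N : ℕ, Φ (coef α (partSum ψ N)) x = x := by
  obtain ⟨N, hN⟩ := (hΦ.mem_core_iff hA hψ).1 hx
  have hsum (M : ℕ) : Φ (coef α (partSum ψ M)) x =
      ∑ n ∈ Finset.Icc (-(M : ℤ)) M, Φ (coef α (pull (dyad ψ n))) x := by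
    unfold partSum
    rw [(coef_finset_sum _ fun n => (isTest_pull_dyad hψ n).memSob α).2, map_sum,
      sum_apply]
  refine ⟨N, (sub_eq_zero.1 (hΦ.eq_zero_of_forall hA fun η hη => ?_)).symm⟩
  obtain ⟨M₀, hM₀⟩ := exists_mul_partSum_eq hψ hη.2
  have h1 := hM₀ (max M₀ N) (le_max_left _ _)
  have h2 : Φ (coef α (partSum ψ (max M₀ N))) x = Φ (coef α (partSum ψ N)) x := by
    rw [hsum, hsum, sum_Icc_eq_of_forall (le_max_right _ _) fun n hn => hN n hn.le]
  have h3 := hΦ.map_coef_mul hA hα (hη.memSob α) ((isTest_partSum hψ (max M₀ N)).memSob α)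
  rw [funext h1] at h3
  rw [map_sub, ← h2, sub_eq_zero]
  exact DFunLike.congr_fun h3 x

variable {f : ℝ → ℂ}

lemma MemSobLoc.memSob {g η : ℝ → ℂ} (hg : MemSobLoc α g) (hη : IsTest η) :
    MemSob α fun u => g u * η u := hg η hη.1 hη.2

/-- Inserting `x = Φ(partSum N) x` truncates `f`, since a partial sum with three or more further
indices equals `1` on the support of `partSum N`. -/
lemma IsCalc.loc_apply (hΦ : IsCalc A α Φ) (hA : IsZeroSectorial A) (hα : 1 / 2 < α)
    (hψ : IsDyadicPartition ψ) (hf : MemSobLoc α (pull f)) {x : X} {N : ℕ}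
    (hx : Φ (coef α (partSum ψ N)) x = x) :
    ∀ᶠ M : ℕ in atTop, ∑ n ∈ Finset.Icc (-(M : ℤ)) M, sobOp A α (fun s => f s * dyad ψ n s) x =
      Φ (coef α fun u => pull f u * partSum ψ N u) x := by
  filter_upwards [eventually_ge_atTop (N + 3)] with M hM
  have hS (n : ℤ) : MemSob α (fun u => pull f u * pull (dyad ψ n) u) :=
    hf.memSob (isTest_pull_dyad hψ n)
  have h1 (n : ℤ) : sobOp A α (fun s => f s * dyad ψ n s) =
      Φ (coef α fun u => pull f u * pull (dyad ψ n) u) := hΦ.sobOp_eq hA (hS n)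
  simp only [h1]
  rw [← sum_apply, ← map_sum, ← (coef_finset_sum _ hS).2]
  simp only [← Finset.mul_sum]
  have h2 := hΦ.map_coef_mul hA hα (hf.memSob (isTest_partSum hψ M))
    ((isTest_partSum hψ N).memSob α)
  have h3 : (fun u => pull f u * partSum ψ M u * partSum ψ N u) =
      fun u => pull f u * partSum ψ N u := by
    ext u
    rw [mul_assoc, partSum_mul_partSum hψ hM]
  rw [h3] at h2
  have h4 := DFunLike.congr_fun h2 x
  rw [mul_apply_eq_comp, hx] at h4
  exact h4.symm

lemma IsCalc.mem_locGraph (hΦ : IsCalc A α Φ) (hA : IsZeroSectorial A) (hα : 1 / 2 < α)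
    (hψ : IsDyadicPartition ψ) (hf : MemSobLoc α (pull f)) {x : X} (hxc : x ∈ core A α ψ) {N : ℕ}
    (hx : Φ (coef α (partSum ψ N)) x = x) :
    (x, Φ (coef α fun u => pull f u * partSum ψ N u) x) ∈ locGraph A α ψ f :=
  ⟨hxc, hΦ.loc_apply hA hα hψ hf hx⟩

/-- The relation `η(A)y = (fη)(A)x` involves bounded operators only, so it passes from the graph to
its closure. It determines `y` from `x` and yields closability. -/
lemma IsCalc.apply_snd_of_mem_closure (hΦ : IsCalc A α Φ) (hA : IsZeroSectorial A)
    (hα : 1 / 2 < α) (hψ : IsDyadicPartition ψ) (hf : MemSobLoc α (pull f)) {p : X × X}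
    (hp : p ∈ (locGraph A α ψ f).topologicalClosure) {η : ℝ → ℂ} (hη : IsTest η) :
    Φ (coef α η) p.2 = Φ (coef α fun u => pull f u * η u) p.1 := by
  have hc : IsClosed {p : X × X | Φ (coef α η) p.2 = Φ (coef α fun u => pull f u * η u) p.1} :=
    isClosed_eq (by fun_prop) (by fun_prop)
  refine hc.closure_subset_iff.2 ?_ hp
  rintro ⟨x, y⟩ ⟨hxc, hy⟩
  obtain ⟨N, hx⟩ := hΦ.exists_partSum_apply hA hα hψ hxc
  obtain ⟨M, hM1, hM2⟩ := (hy.and (hΦ.loc_apply hA hα hψ hf hx)).exists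
  have hyx : y = Φ (coef α fun u => pull f u * partSum ψ N u) x := hM1.symm.trans hM2
  have h1 := hΦ.map_coef_mul hA hα (hη.memSob α) (hf.memSob (isTest_partSum hψ N))
  have h2 := hΦ.map_coef_mul hA hα (hf.memSob hη) ((isTest_partSum hψ N).memSob α)
  have h3 : (fun u => η u * (pull f u * partSum ψ N u)) =
      fun u => pull f u * η u * partSum ψ N u := by
    ext u
    ring
  rw [h3, h2] at h1
  have h4 := DFunLike.congr_fun h1 x
  rw [mul_apply_eq_comp, mul_apply_eq_comp, hx] at h4
  change Φ (coef α η) y = Φ (coef α fun u => pull f u * η u) x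
  rw [hyx, h4]

lemma IsCalc.closure_snd_eq_zero (hΦ : IsCalc A α Φ) (hA : IsZeroSectorial A)
    (hα : 1 / 2 < α) (hψ : IsDyadicPartition ψ) (hf : MemSobLoc α (pull f)) {p : X × X}
    (hp : p ∈ (locGraph A α ψ f).topologicalClosure) (h0 : p.1 = 0) : p.2 = 0 :=
  hΦ.eq_zero_of_forall hA fun η hη => by
    rw [hΦ.apply_snd_of_mem_closure hA hα hψ hf hp hη, h0, map_zero]

/-- Both `toLinearPMap` and `closure` fall back on default values otherwise; this is what makes
`locOp` the intended operator. -/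
lemma IsCalc.isClosable_locGraph (hΦ : IsCalc A α Φ) (hA : IsZeroSectorial A)
    (hα : 1 / 2 < α) (hψ : IsDyadicPartition ψ) (hf : MemSobLoc α (pull f)) :
    (locGraph A α ψ f).toLinearPMap.graph = locGraph A α ψ f ∧
      (locGraph A α ψ f).toLinearPMap.IsClosable := by
  have h := fun p hp => hΦ.closure_snd_eq_zero hA hα hψ hf (p := p) hp
  have h1 : (locGraph A α ψ f).toLinearPMap.graph = locGraph A α ψ f :=
    Submodule.toLinearPMap_graph_eq _ fun p hp => h p (Submodule.le_topologicalClosure _ hp)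
  refine ⟨h1, (locGraph A α ψ f).topologicalClosure.toLinearPMap, ?_⟩
  rw [h1, Submodule.toLinearPMap_graph_eq _ h]

lemma IsCalc.isClosed_locOp (hΦ : IsCalc A α Φ) (hA : IsZeroSectorial A)
    (hα : 1 / 2 < α) (hψ : IsDyadicPartition ψ) (hf : MemSobLoc α (pull f)) :
    (locOp A α ψ f).IsClosed :=
  (hΦ.isClosable_locGraph hA hα hψ hf).2.closure_isClosed

lemma IsCalc.locOp_apply (hΦ : IsCalc A α Φ) (hA : IsZeroSectorial A)
    (hα : 1 / 2 < α) (hψ : IsDyadicPartition ψ) (hf : MemSobLoc α (pull f)) {x : X}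
    (hxc : x ∈ core A α ψ) {N : ℕ} (hx : Φ (coef α (partSum ψ N)) x = x) :
    ∃ h : x ∈ (locOp A α ψ f).domain,
      locOp A α ψ f ⟨x, h⟩ = Φ (coef α fun u => pull f u * partSum ψ N u) x := by
  have h1 := hΦ.mem_locGraph hA hα hψ hf hxc hx
  rw [← (hΦ.isClosable_locGraph hA hα hψ hf).1] at h1
  have h2 := LinearPMap.le_graph_of_le (LinearPMap.le_closure _) h1
  obtain ⟨y, hy1, hy2⟩ := LinearPMap.mem_graph_iff _ |>.1 h2
  subst hy1
  exact ⟨y.2, hy2⟩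

lemma IsCalc.core_le_domain (hΦ : IsCalc A α Φ) (hA : IsZeroSectorial A)
    (hα : 1 / 2 < α) (hψ : IsDyadicPartition ψ) (hf : MemSobLoc α (pull f)) :
    core A α ψ ≤ (locOp A α ψ f).domain := fun x hx => by
  obtain ⟨N, hN⟩ := hΦ.exists_partSum_apply hA hα hψ hx
  exact (hΦ.locOp_apply hA hα hψ hf hx hN).choose

end Core

open scoped SchwartzMap

/-! ### The measure `dt/t` as the image of Lebesgue measure under `exp` -/

section HaarPos

/-- The exponential map as a measurable equivalence of the line with the half-line. -/
def expEquiv : ℝ ≃ᵐ Ioi (0 : ℝ) := Real.expOrderIso.toHomeomorph.toMeasurableEquiv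

lemma measurePreserving_expEquiv : MeasurePreserving expEquiv volume haarPos := by
  refine ⟨expEquiv.measurable, ?_⟩
  ext s hs
  rw [Measure.map_apply expEquiv.measurable hs, haarPos, withDensity_apply _ hs,
    ← lintegral_indicator hs]
  have hv : MeasurableSet (Subtype.val '' s : Set ℝ) :=
    measurableSet_Ioi.subtype_image hs
  set F : ℝ → ℝ≥0∞ := (Subtype.val '' s : Set ℝ).indicator fun t => ENNReal.ofReal (1 / t) with hF
  have h1 : (s.indicator fun t : Ioi (0 : ℝ) => ENNReal.ofReal (1 / (t : ℝ))) =
      fun t : Ioi (0 : ℝ) => F t := by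
    ext t
    rw [hF]
    by_cases ht : t ∈ s
    · rw [indicator_of_mem ht, indicator_of_mem (mem_image_of_mem _ ht)]
    · rw [indicator_of_notMem ht, indicator_of_notMem]
      rintro ⟨t', ht', e⟩
      exact ht (Subtype.ext e ▸ ht')
  have h2 : ∫⁻ t in Ioi (0 : ℝ), F t = ∫⁻ u, ENNReal.ofReal |Real.exp u| * F (Real.exp u) := by
    rw [← exp_image_univ, lintegral_image_eq_lintegral_abs_deriv_mul MeasurableSet.univ
      (fun u _ => (Real.hasDerivAt_exp u).hasDerivWithinAt) Real.exp_injective.injOn,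
      Measure.restrict_univ]
  rw [h1, lintegral_subtype_comap measurableSet_Ioi, h2, ← lintegral_indicator_one (expEquiv.measurable hs)]
  refine lintegral_congr fun u => ?_
  rw [hF]
  by_cases hu : expEquiv u ∈ s
  · rw [indicator_of_mem (show u ∈ expEquiv ⁻¹' s from hu),
      indicator_of_mem (show Real.exp u ∈ (Subtype.val '' s : Set ℝ) from ⟨expEquiv u, hu, rfl⟩),
      ← ENNReal.ofReal_mul (abs_nonneg _),
      abs_of_pos (Real.exp_pos u), mul_one_div_cancel (Real.exp_pos u).ne']
    simp
  · rw [indicator_of_notMem (show u ∉ expEquiv ⁻¹' s from hu), indicator_of_notMem, mul_zero]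
    rintro ⟨t, ht, e⟩
    exact hu ((Subtype.ext e : t = expEquiv u) ▸ ht)

end HaarPos

/-! ### The Mellin condition as a bounded Fourier symbol -/

section Mellin

/-- This is `1 + |t| ≤ √2 √(1 + t²)` at `t = -2πξ`, raised to the power `α`. -/
lemma wt_le_sqrt_rpow {α : ℝ} (hα : 0 ≤ α) (ξ : ℝ) :
    wt α ξ ≤ √2 ^ α * √(1 + (-(2 * Real.pi) * ξ) ^ 2) ^ α := by
  rw [wt, ← Real.mul_rpow (Real.sqrt_nonneg _) (Real.sqrt_nonneg _),
    ← Real.sqrt_mul zero_le_two]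
  refine Real.rpow_le_rpow (zero_le_one.trans (one_le_wt_base ξ)) ?_ hα
  refine Real.le_sqrt_of_sq_le ?_
  have h : (-(2 * Real.pi) * ξ) ^ 2 = (2 * Real.pi * |ξ|) ^ 2 := by
    rw [mul_pow, mul_pow, sq_abs, neg_sq]
  rw [h]
  nlinarith [sq_nonneg (1 - 2 * Real.pi * |ξ|)]

lemma norm_wt_mul_fourierL2_le {α : ℝ} (hα : 0 ≤ α) {φ : ℝ → ℂ} (hφ : MemLp (pull φ) 2 volume)
    (hE : eLpNorm (fun t : ℝ => mellinL2 φ t * ((√(1 + t ^ 2) ^ α : ℝ) : ℂ)) ∞ volume < ∞) :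
    ∀ᵐ ξ, ‖(wt α ξ : ℂ) * fourierL2 (pull φ) ξ‖ ≤ √2 ^ α *
      (eLpNorm (fun t : ℝ => mellinL2 φ t * ((√(1 + t ^ 2) ^ α : ℝ) : ℂ)) ∞ volume).toReal := by
  set E := eLpNorm (fun t : ℝ => mellinL2 φ t * ((√(1 + t ^ 2) ^ α : ℝ) : ℂ)) ∞ volume with hEdef
  have h1 : ∀ᵐ t : ℝ, ‖mellinL2 φ t * ((√(1 + t ^ 2) ^ α : ℝ) : ℂ)‖ₑ ≤ E := by
    rw [hEdef, eLpNorm_exponent_top]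
    exact enorm_ae_le_eLpNormEssSup _ _
  have hne : (-(2 * Real.pi)) ≠ 0 := by
    have := Real.pi_pos
    exact neg_ne_zero.2 (by positivity)
  -- The dilation pulls null sets back to null sets, so the a.e. bound can be read at `t = -2πξ`.
  -- The sign reflects the kernels `e^{itu}` of the Mellin and `e^{-2πiξu}` of the Fourier
  -- transform.
  have hq : Measure.QuasiMeasurePreserving (fun ξ : ℝ => -(2 * Real.pi) * ξ) volume volume := by
    refine ⟨measurable_const_mul _, ?_⟩
    rw [Real.map_volume_mul_left hne]
    exact Measure.smul_absolutelyContinuous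
  have h2 := hq.ae h1
  have h3 := (Measure.measurePreserving_neg (volume : Measure ℝ)).quasiMeasurePreserving.ae
    (fourierL2_comp_neg hφ)
  filter_upwards [h2, h3] with ξ e2 e3
  have e4 : mellinL2 φ (-(2 * Real.pi) * ξ) = fourierL2 (pull φ) ξ := by
    have e5 : -(2 * Real.pi) * ξ / (2 * Real.pi) = -ξ := by
      have := Real.pi_ne_zero
      field_simp
    rw [mellinL2, e5]
    rw [neg_neg] at e3
    exact e3
  rw [e4] at e2
  have e6 : ‖fourierL2 (pull φ) ξ‖ * √(1 + (-(2 * Real.pi) * ξ) ^ 2) ^ α ≤ E.toReal := by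
    have := ENNReal.toReal_mono hE.ne e2
    rwa [toReal_enorm, norm_mul, Complex.norm_real, Real.norm_of_nonneg (by positivity)] at this
  rw [norm_mul, Complex.norm_real, Real.norm_of_nonneg (wt_pos α ξ).le]
  calc wt α ξ * ‖fourierL2 (pull φ) ξ‖
      ≤ √2 ^ α * √(1 + (-(2 * Real.pi) * ξ) ^ 2) ^ α * ‖fourierL2 (pull φ) ξ‖ :=
        mul_le_mul_of_nonneg_right (wt_le_sqrt_rpow hα ξ) (norm_nonneg _)
    _ = √2 ^ α * (‖fourierL2 (pull φ) ξ‖ * √(1 + (-(2 * Real.pi) * ξ) ^ 2) ^ α) := by ring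
    _ ≤ _ := mul_le_mul_of_nonneg_left e6 (by positivity)

/-- The Fourier multiplier `h ↦ m · 𝓕⁻ h` for a bounded symbol `m`. -/
lemma exists_symbolMul {m : ℝ → ℂ} (hm : AEStronglyMeasurable m volume) {M : ℝ}
    (hM : ∀ᵐ ξ, ‖m ξ‖ ≤ M) :
    ∃ B : Lp ℂ 2 (volume : Measure ℝ) →L[ℂ] Lp ℂ 2 (volume : Measure ℝ),
      (∀ h, (B h : ℝ → ℂ) =ᵐ[volume] fun ξ => m ξ * (𝓕⁻ h : Lp ℂ 2 (volume : Measure ℝ)) ξ) ∧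
        ∀ h, ‖B h‖ ≤ M * ‖h‖ := by
  have hM0 : 0 ≤ M := by
    obtain ⟨ξ, hξ⟩ := hM.exists
    exact (norm_nonneg _).trans hξ
  have hb (F : Lp ℂ 2 (volume : Measure ℝ)) : ∀ᵐ ξ, ‖m ξ * F ξ‖ ≤ M * ‖F ξ‖ := by
    filter_upwards [hM] with ξ h
    rw [norm_mul]
    exact mul_le_mul_of_nonneg_right h (norm_nonneg _)
  have hL (F : Lp ℂ 2 (volume : Measure ℝ)) : MemLp (fun ξ => m ξ * F ξ) 2 volume :=
    (Lp.memLp F).of_le_mul (hm.mul (Lp.aestronglyMeasurable F)) (hb F)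
  let B₀ : Lp ℂ 2 (volume : Measure ℝ) →ₗ[ℂ] Lp ℂ 2 (volume : Measure ℝ) :=
    { toFun := fun F => (hL F).toLp _
      map_add' := fun F G => by
        refine Lp.ext ?_
        filter_upwards [(hL (F + G)).coeFn_toLp, (hL F).coeFn_toLp, (hL G).coeFn_toLp,
          Lp.coeFn_add F G, Lp.coeFn_add ((hL F).toLp _) ((hL G).toLp _)] with ξ h1 h2 h3 h4 h5
        rw [h1, h5, Pi.add_apply, h2, h3, h4, Pi.add_apply, mul_add]
      map_smul' := fun c F => by
        refine Lp.ext ?_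
        filter_upwards [(hL (c • F)).coeFn_toLp, (hL F).coeFn_toLp, Lp.coeFn_smul c F,
          Lp.coeFn_smul c ((hL F).toLp _)] with ξ h1 h2 h3 h4
        rw [h1, RingHom.id_apply, h4, Pi.smul_apply, h2, h3, Pi.smul_apply, smul_eq_mul,
          smul_eq_mul, mul_left_comm] }
  have hB₀ (F : Lp ℂ 2 (volume : Measure ℝ)) : ‖B₀ F‖ ≤ M * ‖F‖ := by
    refine Lp.norm_le_mul_norm_of_ae_le_mul ?_
    filter_upwards [(hL F).coeFn_toLp, hb F] with ξ h1 h2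
    rw [← h1] at h2
    exact h2
  let ι := ((Lp.fourierTransformₗᵢ ℝ ℂ).symm.toContinuousLinearEquiv :
    Lp ℂ 2 (volume : Measure ℝ) →L[ℂ] Lp ℂ 2 (volume : Measure ℝ))
  have hι (h : Lp ℂ 2 (volume : Measure ℝ)) : ι h = 𝓕⁻ h := rfl
  have hιn (h : Lp ℂ 2 (volume : Measure ℝ)) : ‖ι h‖ = ‖h‖ :=
    (Lp.fourierTransformₗᵢ ℝ ℂ).symm.norm_map h
  refine ⟨(B₀.mkContinuous M hB₀).comp ι, fun h => ?_, fun h => ?_⟩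
  · rw [← hι]
    exact (hL (ι h)).coeFn_toLp
  · rw [← hιn h]
    exact hB₀ (ι h)

end Mellin

/-! ### Averages of translates -/

section Averages

variable {α : ℝ}

lemma exists_isTest_eq_one (R : ℝ) : ∃ χ : ℝ → ℂ, IsTest χ ∧ ∀ u, |u| ≤ R → χ u = 1 := by
  let b : ContDiffBump (0 : ℝ) := ⟨|R| + 1, |R| + 2, by positivity, by linarith⟩
  refine ⟨fun u => (b u : ℂ), ⟨Complex.ofRealCLM.contDiff.comp b.contDiff,
    b.hasCompactSupport.comp_left (g := Complex.ofReal) rfl⟩, fun u hu => ?_⟩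
  change (b u : ℂ) = 1
  rw [b.one_of_mem_closedBall, Complex.ofReal_one]
  rw [mem_closedBall_zero_iff, Real.norm_eq_abs]
  change |u| ≤ |R| + 1
  linarith [le_abs_self R]

lemma IsTest.comp_add {η : ℝ → ℂ} (hη : IsTest η) (s : ℝ) : IsTest fun u => η (u + s) :=
  ⟨hη.1.comp (contDiff_id.add contDiff_const), hη.2.comp_homeomorph (Homeomorph.addRight s)⟩

lemma MemSobLoc.comp_add {f : ℝ → ℂ} (hf : MemSobLoc α f) (s : ℝ) :
    MemSobLoc α fun u => f (u + s) := by
  intro η h1 h2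
  have h3 := (hf.memSob (IsTest.comp_add ⟨h1, h2⟩ (-s))).comp_add s
  simpa using h3

lemma IsTest.exists_bound {η : ℝ → ℂ} (hη : IsTest η) : ∃ R : ℝ, ∀ u, η u ≠ 0 → |u| ≤ R := by
  obtain ⟨R, hR⟩ := hη.2.isBounded.subset_closedBall 0
  refine ⟨R, fun u hu => ?_⟩
  have := hR (subset_tsupport _ hu)
  rwa [mem_closedBall_zero_iff, Real.norm_eq_abs] at this

lemma continuous_coef_comp_add_mul (hα : 1 / 2 < α) {f Ψ : ℝ → ℂ} (hf : MemSobLoc α f)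
    (hΨ : IsTest Ψ) : Continuous fun s => coef α fun u => f (u + s) * Ψ u := by
  refine continuous_iff_continuousAt.2 fun s₀ => ?_
  obtain ⟨R, hR⟩ := hΨ.exists_bound
  -- Since `f` is only locally Sobolev, it is cut off by `χ`. For `|s - s₀| < 1` the cutoff is `1`
  -- at every `u + s` with `Ψ u ≠ 0`, so it is invisible and translation becomes multiplication by a
  -- character.
  obtain ⟨χ, hχ, hχ1⟩ := exists_isTest_eq_one (R + |s₀| + 1)
  have h1 : Continuous fun s => mulH hα (charMul s (coef α fun u => f u * χ u)) (coef α Ψ) :=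
    ((mulH hα).continuous.comp (continuous_charMul _)).clm_apply continuous_const
  refine h1.continuousAt.congr ?_
  filter_upwards [Metric.ball_mem_nhds s₀ one_pos] with s hs
  rw [← coef_comp_add (hf.memSob hχ), mulH_coef hα ((hf.memSob hχ).comp_add s) (hΨ.memSob α)]
  congr 1
  ext u
  by_cases hu : Ψ u = 0
  · rw [hu, mul_zero, mul_zero]
  · rw [hχ1, mul_one]
    have h2 := hR u hu
    have h3 : |s - s₀| < 1 := by rwa [Metric.mem_ball, Real.dist_eq] at hs
    have h4 : |u + s| ≤ |u| + |s| := abs_add_le u s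
    have h5 : |s| ≤ |s - s₀| + |s₀| := by simpa using abs_add_le (s - s₀) s₀
    linarith

/-- Division by the weight leaves `f̂ · 𝓕⁻h`, and the multiplication formula for the translate of
`f` turns its inverse transform into the expected average. -/
lemma synth_symbolMul {f : ℝ → ℂ} (hf : MemLp f 2 volume) (h : 𝓢(ℝ, ℂ))
    {F : Lp ℂ 2 (volume : Measure ℝ)} (hF : (F : ℝ → ℂ) =ᵐ[volume] fun ξ =>
      (wt α ξ : ℂ) * fourierL2 f ξ * (𝓕⁻ (h.toLp 2 volume) : Lp ℂ 2 (volume : Measure ℝ)) ξ)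
    (u : ℝ) : synth α F u = ∫ s, h s * f (s + u) := by
  have h1 : (𝓕⁻ (h.toLp 2 volume) : Lp ℂ 2 (volume : Measure ℝ)) = (𝓕⁻ h).toLp 2 volume :=
    SchwartzMap.toLp_fourierInv_eq h
  have h2 := integral_fourierL2_mul (MemLp.comp_add_right' hf u) (𝓕⁻ h)
  rw [FourierTransform.fourier_fourierInv_eq] at h2
  rw [← h2, synth, fourierInv_eq_char]
  refine integral_congr_ae ?_
  filter_upwards [hF, fourierL2_comp_add hf u, SchwartzMap.coeFn_toLp (𝓕⁻ h) 2 volume]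
    with ξ e1 e2 e3
  rw [divWt, e1, h1, e3, e2, mul_assoc (wt α ξ : ℂ), inv_mul_cancel_left₀ (wt_ne_zero α ξ)]
  ring

/-- Point evaluations are bounded functionals on `L²` via `synth`, so they pass through the Bochner
integral and reduce the identity to one between scalar integrals for each `u`. -/
lemma integral_smul_coef_eq (hα : 1 / 2 < α) {f Ψ : ℝ → ℂ} (hf : MemLp f 2 volume)
    (hloc : MemSobLoc α f) (hΨ : IsTest Ψ) (h : 𝓢(ℝ, ℂ)) (hh : IsTest h)
    {F : Lp ℂ 2 (volume : Measure ℝ)} (hF : (F : ℝ → ℂ) =ᵐ[volume] fun ξ =>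
      (wt α ξ : ℂ) * fourierL2 f ξ * (𝓕⁻ (h.toLp 2 volume) : Lp ℂ 2 (volume : Measure ℝ)) ξ) :
    Integrable (fun s => h s • coef α fun u => f (u + s) * Ψ u) ∧
      ∫ s, h s • coef α (fun u => f (u + s) * Ψ u) = mulH hα F (coef α Ψ) := by
  have hG := continuous_coef_comp_add_mul hα hloc hΨ
  have hint : Integrable (fun s => h s • coef α fun u => f (u + s) * Ψ u) :=
    (hh.1.continuous.smul hG).integrable_of_hasCompactSupport hh.2.smul_right
  refine ⟨hint, ?_⟩
  obtain ⟨R₁, hR₁⟩ := hΨ.exists_bound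
  obtain ⟨R₂, hR₂⟩ := hh.exists_bound
  obtain ⟨χ, hχ, hχ1⟩ := exists_isTest_eq_one (R₁ + R₂)
  have hfχ := hloc.memSob hχ
  -- `f` is given only up to null sets; the continuous representative of `f χ` makes the comparison
  -- valid at every `u`.
  set f₁ := synth α (coef α fun u => f u * χ u) with hf₁
  have hf₁c : Continuous f₁ := continuous_synth hα _
  have hf₁ae : f₁ =ᵐ[volume] fun u => f u * χ u := synth_coef hα hfχ
  have hχ2 (u s : ℝ) (hu : Ψ u ≠ 0) (hs : h s ≠ 0) : χ (u + s) = 1 :=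
    hχ1 _ ((abs_add_le u s).trans (add_le_add (hR₁ u hu) (hR₂ s hs)))
  have hGs (s : ℝ) (hs : h s ≠ 0) (u : ℝ) :
      synth α (coef α fun u => f (u + s) * Ψ u) u = f₁ (u + s) * Ψ u := by
    have hS : MemSob α fun u => f (u + s) * Ψ u := (hloc.comp_add s).memSob hΨ
    refine congrFun ((Continuous.ae_eq_iff_eq volume (continuous_synth hα _)
      ((hf₁c.comp (continuous_id.add continuous_const)).mul hΨ.1.continuous)).1 ?_) u
    filter_upwards [synth_coef hα hS,
      (measurePreserving_add_right volume s).quasiMeasurePreserving.ae hf₁ae] with u e1 e2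
    rw [e1]
    change _ = f₁ (u + s) * Ψ u
    rw [e2]
    by_cases hu : Ψ u = 0
    · rw [hu, mul_zero, mul_zero]
    · rw [hχ2 u s hu hs, mul_one]
  rw [← coef_synth hα (∫ s, h s • coef α fun u => f (u + s) * Ψ u)]
  conv_rhs => rw [← coef_synth hα F, mulH_coef hα (memSob_synth hα F) (hΨ.memSob α)]
  congr 1
  ext u
  rw [synth_symbolMul hf h hF, ← integral_mul_const, ← evalCLM_apply hα,
    ← ContinuousLinearMap.integral_comp_comm _ hint]
  refine integral_congr_ae ?_
  filter_upwards [(measurePreserving_add_left volume u).quasiMeasurePreserving.ae hf₁ae] with s e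
  rw [map_smul, evalCLM_apply hα, smul_eq_mul]
  by_cases hs : h s = 0
  · rw [hs, zero_mul, zero_mul, zero_mul]
  · rw [hGs s hs, e]
    by_cases hu : Ψ u = 0
    · rw [hu, mul_zero, mul_zero, mul_zero]
    · rw [hχ2 u s hu hs, mul_one, add_comm s u, mul_assoc]

variable {X : Type*} [NormedAddCommGroup X] [NormedSpace ℂ X] [CompleteSpace X]
  {A : X →ₗ.[ℂ] X} {Φ : Lp ℂ 2 (volume : Measure ℝ) →L[ℂ] (X →L[ℂ] X)}

/-- The scalar averages of the orbit `s ↦ Φ (coef (f (· + s) Ψ)) x` are given by the Fourier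
multiplier with symbol `wt α · fourierL2 f`. -/
lemma IsCalc.integral_orbit (hΦ : IsCalc A α Φ) (hA : IsZeroSectorial A) (hα : 1 / 2 < α)
    {f Ψ : ℝ → ℂ} (hf : MemLp f 2 volume) (hloc : MemSobLoc α f) (hΨ : IsTest Ψ) {x : X}
    (hx : Φ (coef α Ψ) x = x)
    {B : Lp ℂ 2 (volume : Measure ℝ) →L[ℂ] Lp ℂ 2 (volume : Measure ℝ)}
    (hB : ∀ h, (B h : ℝ → ℂ) =ᵐ[volume] fun ξ => (wt α ξ : ℂ) * fourierL2 f ξ *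
      (𝓕⁻ h : Lp ℂ 2 (volume : Measure ℝ)) ξ) (x' : StrongDual ℂ X)
    (h : Lp ℂ 2 (volume : Measure ℝ)) :
    Integrable (fun s => h s * x' (Φ (coef α fun u => f (u + s) * Ψ u) x)) ∧
      ∫ s, h s * x' (Φ (coef α fun u => f (u + s) * Ψ u) x) = x' (Φ (B h) x) := by
  have hG := continuous_coef_comp_add_mul hα hloc hΨ
  let ev : Lp ℂ 2 (volume : Measure ℝ) →L[ℂ] ℂ :=
    x'.comp ((ContinuousLinearMap.apply ℂ X x).comp Φ)
  have hev (F : Lp ℂ 2 (volume : Measure ℝ)) : ev F = x' (Φ F x) := rfl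
  simp only [← hev]
  set κ : ℝ → ℂ := fun s => ev (coef α fun u => f (u + s) * Ψ u) with hκ
  have hκc : Continuous κ := ev.continuous.comp hG
  -- The Riesz representative of the bounded functional `h ↦ x'(Φ(B h) x)`. It must coincide with
  -- the orbit `κ`, which is not known in advance to lie in `L²`.
  set q : Lp ℂ 2 (volume : Measure ℝ) := (InnerProductSpace.toDual ℂ _).symm (ev.comp B) with hq
  have hqe (h : Lp ℂ 2 (volume : Measure ℝ)) :
      ev (B h) = ∫ s, h s * (starRingEnd ℂ) (q s) := by
    have h1 : inner ℂ q h = ev (B h) := InnerProductSpace.toDual_symm_apply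
    rw [← h1, L2.inner_def]
    simp only [RCLike.inner_apply]
  have hqL : MemLp (fun s => (starRingEnd ℂ) (q s)) 2 volume := (Lp.memLp q).star
  have htest (η : 𝓢(ℝ, ℂ)) (hη : IsTest η) : ∫ s, η s * κ s = ev (B (η.toLp 2 volume)) := by
    obtain ⟨i1, i2⟩ := integral_smul_coef_eq hα hf hloc hΨ η hη (hB (η.toLp 2 volume))
    have e1 := ev.integral_comp_comm i1
    simp only [map_smul, smul_eq_mul] at e1
    -- The cutoff `Ψ` disappears here: multiplicativity splits off `Φ(coef Ψ)`, which fixes `x`.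
    rw [e1, i2, hev, hev, hΦ.map_mulH hA, mul_apply_eq_comp, hx]
  have hκq : κ =ᵐ[volume] fun s => (starRingEnd ℂ) (q s) := by
    refine ae_eq_of_integral_contDiff_smul_eq hκc.locallyIntegrable
      (MemLp.locallyIntegrable_two hqL) fun g hg hgc => ?_
    have hc' : HasCompactSupport fun u => (g u : ℂ) := hgc.comp_left (g := Complex.ofReal) rfl
    have hg' : ContDiff ℝ (⊤ : ℕ∞) fun u => (g u : ℂ) := Complex.ofRealCLM.contDiff.comp hg
    have h1 := htest (hc'.toSchwartzMap hg') ⟨hg', hc'⟩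
    rw [hqe] at h1
    refine h1.trans (integral_congr_ae ?_)
    filter_upwards [SchwartzMap.coeFn_toLp (hc'.toSchwartzMap hg') 2 volume] with s e
    rw [e]
    rfl
  have hae : (fun s => h s * κ s) =ᵐ[volume] fun s => h s * (starRingEnd ℂ) (q s) := by
    filter_upwards [hκq] with s e
    rw [e]
  refine ⟨((Lp.memLp h).integrable_mul hqL).congr hae.symm, ?_⟩
  rw [integral_congr_ae hae, hqe]

end Averages

/-! ### Scaling of `R`-bounds -/

section RBound

variable {X : Type*} [NormedAddCommGroup X] [NormedSpace ℂ X]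

lemma radNorm_smul {n : ℕ} {c : ℝ} (hc : 0 ≤ c) (x : Fin n → X) :
    radNorm (fun k => (c : ℂ) • x k) = c * radNorm x := by
  unfold radNorm
  have h (ε : Fin n → Bool) : ‖∑ k, (if ε k then (1 : ℂ) else -1) • (c : ℂ) • x k‖ =
      c * ‖∑ k, (if ε k then (1 : ℂ) else -1) • x k‖ := by
    simp only [smul_comm _ (c : ℂ)]
    rw [← Finset.smul_sum, norm_smul, Complex.norm_real, Real.norm_of_nonneg hc]
  simp only [h]
  rw [← Finset.mul_sum]
  ring

lemma rBound_le_of_smul {τ τ' : Set (X →L[ℂ] X)} {M : ℝ≥0}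
    (h : ∀ T ∈ τ', ∃ S ∈ τ, T = ((M : ℝ) : ℂ) • S) {C : ℝ≥0}
    (hC : ∀ (n : ℕ) (T : Fin n → X →L[ℂ] X) (x : Fin n → X), (∀ k, T k ∈ τ) →
      radNorm (fun k => T k (x k)) ≤ C * radNorm x) : rBound τ' ≤ (M * C : ℝ≥0) := by
  refine iInf₂_le (M * C) fun n T x hT => ?_
  choose S hS hTS using fun k => h (T k) (hT k)
  have h1 : (fun k => T k (x k)) = fun k => ((M : ℝ) : ℂ) • S k (x k) := by
    ext k
    rw [hTS k]
    rfl
  rw [h1, radNorm_smul (c := (M : ℝ)) M.2 fun k => S k (x k), NNReal.coe_mul, mul_assoc]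
  exact mul_le_mul_of_nonneg_left (hC n S x hS) M.2

lemma exists_of_rBound_lt_top {τ : Set (X →L[ℂ] X)} (h : rBound τ < ∞) :
    ∃ C : ℝ≥0, ∀ (n : ℕ) (T : Fin n → X →L[ℂ] X) (x : Fin n → X), (∀ k, T k ∈ τ) →
      radNorm (fun k => T k (x k)) ≤ C * radNorm x := by
  rw [rBound, iInf_lt_iff] at h
  obtain ⟨C, hC⟩ := h
  rw [iInf_lt_iff] at hC
  exact ⟨C, hC.choose⟩

end RBound

end AvgR

end

/-! ### The averaged `R`-bound -/

theorem mainTheorem6 {X : Type*} [NormedAddCommGroup X] [NormedSpace ℂ X] [CompleteSpace X]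
    (A : X →ₗ.[ℂ] X) (hA : IsZeroSectorial A) (α : ℝ) (hα : 1 / 2 < α)
    (hR : HasRBoundedSobolevCalculus A α) :
    ∃ C : ℝ≥0, ∀ ψ : ℝ → ℂ, IsDyadicPartition ψ →
      ∀ φ : ℝ → ℂ, MemSobLoc α (pull φ) →
        MemLp (fun s : Ioi (0 : ℝ) => φ s) 2 haarPos →
        eLpNorm (fun t : ℝ => mellinL2 φ t * ((√(1 + t ^ 2) ^ α : ℝ) : ℂ)) ∞ volume < ∞ →
        IsRL2BoundedWith haarPos (core A α ψ)
          (fun t : Ioi (0 : ℝ) => locOp A α ψ (fun s => φ (t * s)))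
          (C * eLpNorm (fun t : ℝ => mellinL2 φ t * ((√(1 + t ^ 2) ^ α : ℝ) : ℂ)) ∞ volume) := by
  obtain ⟨Φ, hΦ⟩ := exists_isCalc hA hR.1
  obtain ⟨C, hC⟩ := exists_of_rBound_lt_top hR.2
  have hα0 : 0 ≤ α := by linarith
  -- The constant depends only on `α` and the `R`-bound `C` of the calculus; `√2 ^ α` compares the
  -- weights `1 + |t|` and `⟨t⟩`.
  refine ⟨(√2 ^ α).toNNReal * C, fun ψ hψ φ hφ hφ2 hE => ?_⟩
  set E := eLpNorm (fun t : ℝ => mellinL2 φ t * ((√(1 + t ^ 2) ^ α : ℝ) : ℂ)) ∞ volume with hEdef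
  have hmp := measurePreserving_expEquiv
  have hf2 : MemLp (pull φ) 2 volume := hφ2.comp_measurePreserving hmp
  set M : ℝ≥0 := (√2 ^ α).toNNReal * E.toNNReal with hM
  have hMreal : (M : ℝ) = √2 ^ α * E.toReal := by
    rw [hM, NNReal.coe_mul, Real.coe_toNNReal _ (by positivity)]
    rfl
  have hbound : ∀ᵐ ξ, ‖(wt α ξ : ℂ) * fourierL2 (pull φ) ξ‖ ≤ M := by
    rw [hMreal]
    exact norm_wt_mul_fourierL2_le hα0 hf2 hE
  have hwm : AEStronglyMeasurable (fun ξ => (wt α ξ : ℂ) * fourierL2 (pull φ) ξ) volume :=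
    (Complex.continuous_ofReal.comp (continuous_wt α)).aestronglyMeasurable.mul
      (memLp_fourierL2 hf2).aestronglyMeasurable
  obtain ⟨B, hB, hBM⟩ := exists_symbolMul hwm hbound
  have hpull (t : Ioi (0 : ℝ)) :
      pull (fun s => φ (t * s)) = fun u => pull φ (u + expEquiv.symm t) := by
    ext u
    have ht : Real.exp (expEquiv.symm t) = t := congrArg Subtype.val (expEquiv.apply_symm_apply t)
    rw [pull, pull, Real.exp_add, ht, mul_comm]
  have hloc (t : Ioi (0 : ℝ)) : MemSobLoc α (pull fun s => φ (t * s)) := by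
    rw [hpull]
    exact hφ.comp_add _
  have hdom (t : Ioi (0 : ℝ)) : core A α ψ ≤ (locOp A α ψ fun s => φ (t * s)).domain :=
    hΦ.core_le_domain hA hα hψ (hloc t)
  have hval (x : X) (hx : x ∈ core A α ψ) : ∃ Ψ : ℝ → ℂ, IsTest Ψ ∧ Φ (coef α Ψ) x = x ∧
      ∀ t : Ioi (0 : ℝ), locOp A α ψ (fun s => φ (t * s)) ⟨x, hdom t hx⟩ =
        Φ (coef α fun u => pull φ (u + expEquiv.symm t) * Ψ u) x := by
    obtain ⟨N, hN⟩ := hΦ.exists_partSum_apply hA hα hψ hx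
    refine ⟨partSum ψ N, isTest_partSum hψ N, hN, fun t => ?_⟩
    obtain ⟨_, h⟩ := hΦ.locOp_apply hA hα hψ (hloc t) hx hN
    rw [h, hpull]
  let pb (f : Lp ℂ 2 haarPos) : Lp ℂ 2 (volume : Measure ℝ) :=
    ((Lp.memLp f).comp_measurePreserving hmp).toLp _
  have hpb (f : Lp ℂ 2 haarPos) : (pb f : ℝ → ℂ) =ᵐ[volume] fun s => f (expEquiv s) :=
    MemLp.coeFn_toLp _
  have hpbn (f : Lp ℂ 2 haarPos) : ‖pb f‖ = ‖f‖ := by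
    rw [Lp.norm_toLp, Lp.norm_def, eLpNorm_comp_measurePreserving (Lp.aestronglyMeasurable f) hmp]
  have key (x : X) (hx : x ∈ core A α ψ) (x' : StrongDual ℂ X) (f : Lp ℂ 2 haarPos) :
      Integrable (fun t : Ioi (0 : ℝ) =>
        f t * x' (locOp A α ψ (fun s => φ (t * s)) ⟨x, hdom t hx⟩)) haarPos ∧
      ∫ t : Ioi (0 : ℝ), f t * x' (locOp A α ψ (fun s => φ (t * s)) ⟨x, hdom t hx⟩) ∂haarPos =
        x' (Φ (B (pb f)) x) := by
    obtain ⟨Ψ, hΨ, hΨx, hv⟩ := hval x hx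
    simp only [hv]
    obtain ⟨h1, h2⟩ := hΦ.integral_orbit hA hα hf2 hφ hΨ hΨx hB x' (pb f)
    set g : Ioi (0 : ℝ) → ℂ := fun t =>
      f t * x' (Φ (coef α fun u => pull φ (u + expEquiv.symm t) * Ψ u) x) with hg
    have hae : (fun s => pb f s * x' (Φ (coef α fun u => pull φ (u + s) * Ψ u) x)) =ᵐ[volume]
        g ∘ expEquiv := by
      filter_upwards [hpb f] with s e
      rw [e, Function.comp_apply, hg]
      simp only [expEquiv.symm_apply_apply]
    refine ⟨(hmp.integrable_comp_emb expEquiv.measurableEmbedding).1 (h1.congr hae), ?_⟩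
    rw [← h2, integral_congr_ae hae]
    exact (hmp.integral_comp expEquiv.measurableEmbedding g).symm
  have havg (f : Lp ℂ 2 haarPos) : IsAverage haarPos (core A α ψ)
      (fun t : Ioi (0 : ℝ) => locOp A α ψ fun s => φ (t * s)) hdom f (Φ (B (pb f))) :=
    fun x hx x' => (key x hx x' f).2.symm
  have hdense := hΦ.dense_core hA hα hψ
  -- The family to be bounded consists of all bounded operators satisfying the averaging identity;
  -- density of `D_A` leaves only `Φ (B (pb f))`.
  have huniq (f : Lp ℂ 2 haarPos) (T : X →L[ℂ] X) (hT : IsAverage haarPos (core A α ψ)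
      (fun t : Ioi (0 : ℝ) => locOp A α ψ fun s => φ (t * s)) hdom f T) : T = Φ (B (pb f)) := by
    refine ContinuousLinearMap.ext fun x => ?_
    refine congrFun (Continuous.ext_on hdense T.continuous (Φ (B (pb f))).continuous
      fun x hx => ?_) x
    refine (SeparatingDual.eq_iff_forall_dual_eq (R := ℂ)).2 fun x' => ?_
    rw [hT x hx x', havg f x hx x']
  refine ⟨fun t => hΦ.isClosed_locOp hA hα hψ (hloc t), hdense, hdom, fun x hx => ?_,
    fun x hx x' f => (key x hx x' f).1, fun f => ⟨_, havg f⟩, ?_,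
    ENNReal.mul_lt_top ENNReal.coe_lt_top hE⟩
  · obtain ⟨Ψ, hΨ, hΨx, hv⟩ := hval x hx
    simp only [hv]
    have hc : Continuous fun s => Φ (coef α fun u => pull φ (u + s) * Ψ u) x :=
      ((ContinuousLinearMap.apply ℂ X x).comp Φ).continuous.comp
        (continuous_coef_comp_add_mul hα hφ hΨ)
    exact hc.stronglyMeasurable.comp_measurable expEquiv.symm.measurable
  · refine (rBound_le_of_smul (M := M) ?_ hC).trans (le_of_eq ?_)
    · rintro T ⟨f, hf1, hT⟩
      have hle : ‖B (pb f)‖ ≤ M := by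
        refine (hBM _).trans ?_
        rw [hpbn]
        exact mul_le_of_le_one_right M.2 hf1
      -- For `M = 0` the inverse is `0`, which is harmless because then `B (pb f) = 0` as well.
      set F : Lp ℂ 2 (volume : Measure ℝ) := ((M : ℝ) : ℂ)⁻¹ • B (pb f) with hF
      have hF1 : ‖F‖ ≤ 1 := by
        rw [hF, norm_smul, norm_inv, Complex.norm_real, Real.norm_of_nonneg (r := (M : ℝ)) M.2]
        exact inv_mul_le_one_of_le₀ hle M.2
      have hBF : B (pb f) = ((M : ℝ) : ℂ) • F := by
        by_cases h0 : (M : ℝ) = 0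
        · rw [h0, Complex.ofReal_zero, zero_smul]
          exact norm_le_zero_iff.1 (h0 ▸ hle)
        · rw [hF, smul_inv_smul₀ (by exact_mod_cast h0)]
      -- Composition with `log` realizes `F` by an honest function on `(0, ∞)`, as the definition of
      -- the `R`-bounded set requires.
      have hp : pull (fun t => synth α F (Real.log t)) = synth α F := by
        ext u
        rw [pull, Real.log_exp]
      have hS := memSob_synth hα F
      refine ⟨Φ F, ⟨fun t => synth α F (Real.log t), ?_, ?_, (hΦ.isSobOp_iff hA).2 ⟨?_, ?_⟩⟩, ?_⟩
      · rwa [hp]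
      · rw [hp, ← hS.enorm_coef, coef_synth hα, ← ofReal_norm]
        exact ENNReal.ofReal_le_one.2 hF1
      · rwa [hp]
      · rw [hp, coef_synth hα]
      · rw [huniq f T hT, hBF, map_smul]
    · rw [hM, mul_right_comm, ENNReal.coe_mul, ENNReal.coe_toNNReal hE.ne]
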